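/- All graphs are finite and simple. The fork is the graph obtained from a four-vertex path by adding a vertex whose only neighbour is the second vertex of the path; the antifork is its complement. A graph is uncluttered if no induced subgraph of it is isomorphic to a fork or an antifork. Distinct vertices $u,v$ of $G$ are twins if they have the same neighbours in $V(G)\setminus\{u,v\}$; a vertex is simplicial if its neighbours form a clique. For disjoint $X,Y\subseteq V(G)$, $X$ is complete (respectively anticomplete) to $Y$ if every (respectively no) vertex of $X$ is adjacent to every (respectively any) vertex of $Y$. A graph $H$ is a candelabrum with base $Z$ if for some integer $k\ge 1$ its vertex set can be partitioned into nonempty sets $Y_1,\dots,Y_k,Z_1,\dots,Z_k$ with $Z=Z_1\cup\cdots\cup Z_k$, such that each $Y_i$ is a clique and each $Z_i$ is a stable set; for $i\ne j$, $Y_i$ is anticomplete to $Y_j$ and $Z_i$ is complete to $Z_j$; and $Y_i$ is complete to $Z_j$ if $i=j$ and anticomplete to $Z_j$ if $i\neq j$. A graph $G$ is candled if it has an induced subgraph $H$ that is a candelabrum, with base $Z$ say, such that $Z$ is complete to $V(G)\setminus V(H)$ and $V(H)\setminus Z$ is anticomplete to $V(G)\setminus V(H)$ (where $V(G)\setminus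 V(H)$ may be empty). **Theorem.** Let $G$ be an uncluttered graph, with complement $\overline{G}$. Then at least one of the following holds: 1. one of $G,\overline{G}$ is disconnected; 2. one of $G,\overline{G}$ has two adjacent simplicial vertices that are twins; 3. one of $G,\overline{G}$ is candled; 4. one of $G,\overline{G}$ is the line graph of a triangle-free graph. -/

import Mathlib

open scoped SimpleGraph

namespace Uncluttered

variable {V : Type*}

/-- The fork: the four-vertex path `0 - 1 - 2 - 3` together with the vertex `4`, whose only
neighbour is the second vertex `1` of the path. -/
def fork : SimpleGraph (Fin 5) :=
  SimpleGraph.fromEdgeSet {s(0, 1), s(1, 2), s(2, 3), s(1, 4)}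

/-- The antifork: the complement of the fork. -/
def antifork : SimpleGraph (Fin 5) := forkᶜ

/-- A graph is uncluttered if no induced subgraph of it is (isomorphic to) a fork or antifork. -/
def IsUncluttered (G : SimpleGraph V) : Prop :=
  ¬ fork ⊴ G ∧ ¬ antifork ⊴ G

/-- Some two vertices are not joined by a path. (The null graph is not disconnected.) -/
def IsDisconnected (G : SimpleGraph V) : Prop :=
  ¬ G.Preconnected

/-- Every vertex of `X` is adjacent to every vertex of `Y`. -/
def CompleteTo (G : SimpleGraph V) (X Y : Set V) : Prop :=
  ∀ x ∈ X, ∀ y ∈ Y, G.Adj x y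

/-- There are no edges between `X` and `Y`. -/
def AnticompleteTo (G : SimpleGraph V) (X Y : Set V) : Prop :=
  ∀ x ∈ X, ∀ y ∈ Y, ¬ G.Adj x y

/-- Distinct vertices with the same neighbours among the other vertices. -/
def IsTwins (G : SimpleGraph V) (u v : V) : Prop :=
  u ≠ v ∧ ∀ w, w ≠ u → w ≠ v → (G.Adj u w ↔ G.Adj v w)

/-- A vertex is simplicial if the set of its neighbours is a clique. -/
def IsSimplicial (G : SimpleGraph V) (v : V) : Prop :=
  G.IsClique (G.neighborSet v)

/-- There are two adjacent twins, both of which are simplicial. -/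
def HasAdjacentSimplicialTwins (G : SimpleGraph V) : Prop :=
  ∃ u v : V, G.Adj u v ∧ IsTwins G u v ∧ IsSimplicial G u ∧ IsSimplicial G v

/-- `G` is a candelabrum with base `B`: the vertex set is partitioned into nonempty sets
`Y₁, …, Yₖ, Z₁, …, Zₖ` with `k ≥ 1`, where the `Yᵢ` are cliques, pairwise anticomplete, the `Zᵢ` are
stable sets, pairwise complete, `Yᵢ` is complete to `Zᵢ` and anticomplete to `Zⱼ` for `j ≠ i`, and
`B = Z₁ ∪ ⋯ ∪ Zₖ`. -/
def IsCandelabrum (G : SimpleGraph V) (B : Set V) : Prop :=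
  ∃ (k : ℕ) (Y Z : Fin k → Set V),
    1 ≤ k ∧
    (∀ i, (Y i).Nonempty) ∧ (∀ i, (Z i).Nonempty) ∧
    (∀ i j, i ≠ j → Disjoint (Y i) (Y j)) ∧
    (∀ i j, i ≠ j → Disjoint (Z i) (Z j)) ∧
    (∀ i j, Disjoint (Y i) (Z j)) ∧
    (⋃ i, Y i) ∪ (⋃ i, Z i) = Set.univ ∧
    (∀ i, G.IsClique (Y i)) ∧ (∀ i, G.IsIndepSet (Z i)) ∧
    (∀ i j, i ≠ j → AnticompleteTo G (Y i) (Y j)) ∧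
    (∀ i j, i ≠ j → CompleteTo G (Z i) (Z j)) ∧
    (∀ i, CompleteTo G (Y i) (Z i)) ∧
    (∀ i j, i ≠ j → AnticompleteTo G (Y i) (Z j)) ∧
    B = ⋃ i, Z i

/-- `G` is candled: for some `S ⊆ V(G)` the induced subgraph `G[S]` is a candelabrum, with base `B`
say, such that `B` is complete to `V(G) ∖ S` and `S ∖ B` is anticomplete to `V(G) ∖ S`. -/
def IsCandled (G : SimpleGraph V) : Prop :=
  ∃ (S : Set V) (B : Set S), IsCandelabrum (G.induce S) B ∧
    CompleteTo G (Subtype.val '' B) Sᶜ ∧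
    AnticompleteTo G (Subtype.val '' Bᶜ) Sᶜ

/-- `G` is (isomorphic to) the line graph of a finite triangle-free graph. -/
def IsLineGraphOfTriangleFree (G : SimpleGraph V) : Prop :=
  ∃ (n : ℕ) (H : SimpleGraph (Fin n)), H.CliqueFree 3 ∧ Nonempty (G ≃g H.lineGraph)

end Uncluttered

namespace Uncluttered

/-! ### Forks and antiforks as conditions on vertices -/

variable {V : Type*} {G : SimpleGraph V}

/-! The idea is to contract the graph to a prime quotient, describe prime uncluttered graphs, and
lift the description back. Fork and antifork are complementary, so everything may be complemented.
If $G$ and its complement are connected, two overlapping proper modules have a proper union, so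
being in a common proper module is an equivalence relation and the quotient $H$ is prime
(`exists_isModularQuotient`). Representatives embed $H$ in $G$ as an induced subgraph, so $H$
inherits the absence of forks and antiforks.

The core is `IsPrime.twoCliques_or_compl`: in $H$ or in its complement, every neighbourhood is a
union of two disjoint cliques with no edges between them. Such a graph is the line graph of a
triangle-free graph: each vertex becomes an edge whose ends are its two cliques
(`isLineGraphOfTriangleFree`).

For the core, primeness first excludes a diamond with an isolated vertex
(`IsPrime.diamondIsolatedFree`), because a nontrivial module could be grown from the diamond.
Suppose next that there is a coclaw, that is, a triangle with an isolated vertex. Enlarge the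
triangle to a clique $K$ that is maximal subject to being missed by some vertex. Every vertex
outside $K$ is complete to $K$, attached to exactly one vertex of $K$, or anticomplete to $K$; the
two-clique property holds near $K$ and propagates outwards along edges (`IsTopClique.twoCliques`).
If neither the graph nor its complement has a coclaw, there are no claws or coclaws at all, and
failure of the property on both sides would produce both a diamond and a codiamond, which cannot
coexist.

For the lifting, let $H$ have two-clique neighbourhoods. A fibre containing an edge cannot sit at an
inner vertex of an induced four-vertex path, so by primeness its vertex in $H$ has a clique as
neighbourhood; dually, a fibre containing a nonedge has a stable nonneighbourhood. If all fibres are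
singletons, $G$ is a line graph. Otherwise there are adjacent simplicial twins in $G$ or its
complement, or $H$ splits into a clique and a stable set. In the split case the stable part is
matched into the clique, and the fibres over matched pairs form a candelabrum
(`IsModularQuotient.isCandled_of_isSplitBy`). -/

/-- The absence of an induced fork, spelled out on vertices. -/
def ForkFree (G : SimpleGraph V) : Prop :=
  ∀ ⦃a b c d e : V⦄, G.Adj a b → G.Adj b c → G.Adj c d → G.Adj b e → ¬G.Adj a c → ¬G.Adj a d →
    ¬G.Adj a e → ¬G.Adj b d → ¬G.Adj c e → ¬G.Adj d e → a ≠ e → False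

/-- The absence of an induced antifork, spelled out on vertices. -/
def AntiforkFree (G : SimpleGraph V) : Prop :=
  ∀ ⦃a b c d e : V⦄, G.Adj a c → G.Adj a d → G.Adj a e → G.Adj b d → G.Adj c e → G.Adj d e →
    ¬G.Adj a b → ¬G.Adj b c → ¬G.Adj c d → ¬G.Adj b e → False

theorem ne_of_adj_of_not_adj {x y v : V} (h : G.Adj v x) (h' : ¬G.Adj v y) : x ≠ y := by
  rintro rfl
  exact h' h

theorem ForkFree.compl (hF : ForkFree G) : AntiforkFree Gᶜ := by
  intro a b c d e ac ad ae bd ce de ab bc cd be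
  simp only [SimpleGraph.compl_adj, not_and, not_not] at *
  have h1 : a ≠ b := by rintro rfl; exact bc ac.1 |> ac.2
  have h2 : b ≠ c := by rintro rfl; exact be ce.1 |> ce.2
  have h3 : c ≠ d := by rintro rfl; exact bc bd.1 |> bd.2
  have h4 : b ≠ e := by rintro rfl; exact ae.2 (ab ae.1)
  exact hF (ab h1) (bc h2) (cd h3) (be h4) ac.2 ad.2 ae.2 bd.2 ce.2 de.2 ae.1

theorem AntiforkFree.compl (hA : AntiforkFree G) : ForkFree Gᶜ := by
  intro a b c d e ab bc cd be ac ad ae bd ce de hae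
  simp only [SimpleGraph.compl_adj, not_and, not_not] at *
  have h1 : a ≠ c := by rintro rfl; exact ad cd.1 |> cd.2
  have h2 : a ≠ d := by rintro rfl; exact bd ab.1.symm |> fun h => ab.2 h.symm
  have h3 : b ≠ d := by rintro rfl; exact ad ab.1 |> ab.2
  have h4 : c ≠ e := by rintro rfl; exact de cd.1.symm |> fun h => cd.2 h.symm
  have h5 : d ≠ e := by rintro rfl; exact bd h3 |> be.2
  exact hA (ac h1) (ad h2) (ae hae) (bd h3) (ce h4) (de h5) ab.2 bc.2 cd.2 be.2

/-- Neither a fork nor an antifork is induced. -/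
structure ForkAntiforkFree (G : SimpleGraph V) : Prop where
  fork : ForkFree G
  antifork : AntiforkFree G

theorem ForkAntiforkFree.compl (h : ForkAntiforkFree G) : ForkAntiforkFree Gᶜ :=
  ⟨h.antifork.compl, h.fork.compl⟩

theorem forkFree_of_not_isIndContained (h : ¬ fork ⊴ G) : ForkFree G := by
  intro a b c d e ab bc cd be ac ad ae bd ce de hae
  apply h
  have hac : a ≠ c := by rintro rfl; exact ad cd
  have hbd : b ≠ d := by rintro rfl; exact ad ab
  have had : a ≠ d := by rintro rfl; exact bd ab.symm
  have hce : c ≠ e := by rintro rfl; exact de cd.symm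
  have hde : d ≠ e := by rintro rfl; exact bd be
  refine ⟨⟨⟨![a, b, c, d, e], ?_⟩, ?_⟩⟩
  · intro i j hij
    fin_cases i <;> fin_cases j <;> simp_all [ab.ne, bc.ne, cd.ne, be.ne, Ne.symm]
  · intro i j
    change G.Adj (![a, b, c, d, e] i) (![a, b, c, d, e] j) ↔ fork.Adj i j
    fin_cases i <;> fin_cases j <;> simp [fork, ab, bc, cd, be, ac, ad, ae, bd, ce, de,
      ab.symm, bc.symm, cd.symm, be.symm, mt G.adj_symm ac, mt G.adj_symm ad,
      mt G.adj_symm ae, mt G.adj_symm bd, mt G.adj_symm ce,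
      mt G.adj_symm de]

theorem IsUncluttered.forkAntiforkFree (h : IsUncluttered G) : ForkAntiforkFree G := by
  refine ⟨forkFree_of_not_isIndContained h.1, ?_⟩
  have h2 : ¬ fork ⊴ Gᶜ := by
    rintro ⟨f⟩
    refine h.2 ⟨?_⟩
    have g := SimpleGraph.Embedding.complEquiv f
    rwa [compl_compl] at g
  simpa using (forkFree_of_not_isIndContained h2).compl

/-! ### Modules, primeness and components -/

/-- Every vertex outside `X` is adjacent to all of `X` or to none of it. -/
def IsModule (G : SimpleGraph V) (X : Set V) : Prop :=
  ∀ ⦃x⦄, x ∈ X → ∀ ⦃y⦄, y ∈ X → ∀ ⦃v⦄, v ∉ X → G.Adj v x → G.Adj v y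

/-- All modules are trivial. -/
def IsPrime (G : SimpleGraph V) : Prop :=
  ∀ X : Set V, IsModule G X → X.Subsingleton ∨ X = Set.univ

theorem IsModule.compl {X : Set V} (h : IsModule G X) : IsModule Gᶜ X := by
  intro x hx y hy v hv hvx
  rw [SimpleGraph.compl_adj] at *
  exact ⟨fun e => hv (e ▸ hy), fun h' => hvx.2 (h hy hx hv h')⟩

theorem IsPrime.compl (h : IsPrime G) : IsPrime Gᶜ := fun X hX =>
  h X (by simpa using hX.compl)

theorem IsPrime.false_of_module (hP : IsPrime G) {X : Set V} (hX : IsModule G X) {x y v : V}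
    (hx : x ∈ X) (hy : y ∈ X) (hxy : x ≠ y) (hv : v ∉ X) : False := by
  rcases hP X hX with h | h
  · exact hxy (h hx hy)
  · exact hv (h ▸ Set.mem_univ v)

/-- Otherwise `{x, y}` is a module; the third vertex `v` makes it proper. -/
theorem IsPrime.exists_distinguishing (hP : IsPrime G) {x y v : V} (hxy : x ≠ y) (hx : v ≠ x)
    (hy : v ≠ y) : ∃ t, t ≠ x ∧ t ≠ y ∧
      (G.Adj t x ∧ ¬G.Adj t y ∨ G.Adj t y ∧ ¬G.Adj t x) := by
  by_contra! hcon
  refine hP.false_of_module (X := {x, y}) (v := v) ?_ (by simp) (by simp) hxy (by simp [hx, hy])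
  intro p hp q hq t ht htp
  simp only [Set.mem_insert_iff, Set.mem_singleton_iff, not_or] at hp hq ht
  have := hcon t ht.1 ht.2
  rcases hp with rfl | rfl <;> rcases hq with rfl | rfl <;> tauto

/-- The vertices reachable from `x` by walks all of whose later vertices lie in `X`. -/
def component (G : SimpleGraph V) (X : Set V) (x : V) : Set V :=
  {y | Relation.ReflTransGen (fun u v => G.Adj u v ∧ v ∈ X) x y}

theorem mem_component_self (X : Set V) (x : V) : x ∈ component G X x :=
  Relation.ReflTransGen.refl

theorem component_subset {X : Set V} {x : V} (hx : x ∈ X) : component G X x ⊆ X := by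
  intro y hy
  rcases Relation.ReflTransGen.cases_tail hy with h | ⟨z, -, h⟩
  · exact h ▸ hx
  · exact h.2

theorem component_closed {X : Set V} {x y z : V} (hy : y ∈ component G X x) (h : G.Adj y z)
    (hz : z ∈ X) : z ∈ component G X x :=
  Relation.ReflTransGen.tail hy ⟨h, hz⟩

theorem component_induction {X : Set V} {x : V} {p : V → Prop} (h0 : p x)
    (hs : ∀ u ∈ component G X x, ∀ v ∈ X, G.Adj u v → p u → p v) :
    ∀ y ∈ component G X x, p y := by
  intro y hy
  induction hy with
  | refl => exact h0
  | tail h1 h2 ih => exact hs _ h1 _ h2.2 h2.1 ih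

/-- A property that varies on a component varies along an edge of it. -/
theorem component_exists_edge {X : Set V} {x p q : V} {P : V → Prop} (hp : p ∈ component G X x)
    (hq : q ∈ component G X x) (hPp : P p) (hPq : ¬P q) :
    ∃ u ∈ component G X x, ∃ v ∈ component G X x, G.Adj u v ∧ P u ∧ ¬P v := by
  by_contra! hcon
  have key : ∀ y ∈ component G X x, (P x ↔ P y) := by
    refine component_induction Iff.rfl ?_
    intro u hu v hv huv ih
    have hv' := component_closed hu huv hv
    exact ih.trans ⟨hcon u hu v hv' huv, hcon v hv' u hu huv.symm⟩
  exact hPq ((key q hq).1 ((key p hp).2 hPp))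

theorem component_univ_isModule (x : V) : IsModule G (component G Set.univ x) := by
  intro p hp q _ v hv h
  exact absurd (component_closed hp h.symm (Set.mem_univ v)) hv

/-- A component is a module. If it is the single vertex `x`, then `x` is isolated and the remaining
vertices form a proper module, nontrivial because of `y` and `z`. -/
theorem IsPrime.component_univ (hP : IsPrime G) {x y z : V} (hxy : x ≠ y) (hxz : x ≠ z)
    (hyz : y ≠ z) : component G Set.univ x = Set.univ := by
  rcases hP _ (component_univ_isModule x) with h | h
  · exfalso
    have hiso : ∀ v, ¬G.Adj x v := fun v hv =>
      hv.ne (h (mem_component_self _ x) (component_closed (mem_component_self _ x) hv trivial))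
    refine hP.false_of_module (X := {x}ᶜ) (x := y) (y := z) (v := x) ?_ hxy.symm hxz.symm hyz
      (by simp)
    intro p _ q _ v hv hvp
    simp only [Set.mem_compl_iff, Set.mem_singleton_iff, not_not] at hv
    exact absurd (hv ▸ hvp) (hiso p)
  · exact h

/-! ### Configurations excluded by primeness -/

/-- No path `y - a - n - w` has an induced path `p - q - r` attached to `a` and `n` only. -/
def BullHeadFree (G : SimpleGraph V) : Prop :=
  ∀ ⦃y a n w p q r : V⦄, G.Adj y a → G.Adj a n → G.Adj n w → G.Adj a p → G.Adj a q → G.Adj a r →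
    G.Adj n p → G.Adj n q → G.Adj n r → G.Adj p q → G.Adj q r → ¬G.Adj y n → ¬G.Adj y w →
    ¬G.Adj a w → ¬G.Adj y p → ¬G.Adj y q → ¬G.Adj y r → ¬G.Adj w p → ¬G.Adj w q → ¬G.Adj w r →
    ¬G.Adj p r → p ≠ r → False

/-- No induced diamond together with an isolated vertex. -/
def DiamondIsolatedFree (G : SimpleGraph V) : Prop :=
  ∀ ⦃a b c d w : V⦄, G.Adj a b → G.Adj a c → G.Adj a d → G.Adj b c → G.Adj b d → ¬G.Adj c d →
    ¬G.Adj a w → ¬G.Adj b w → ¬G.Adj c w → ¬G.Adj d w → c ≠ d → False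

/-- No vertex is complete to an induced codiamond. -/
def CodiamondDominatedFree (G : SimpleGraph V) : Prop :=
  ∀ ⦃a b c d w : V⦄, G.Adj c d → G.Adj a w → G.Adj b w → G.Adj c w → G.Adj d w →
    ¬G.Adj a b → ¬G.Adj a c → ¬G.Adj a d → ¬G.Adj b c → ¬G.Adj b d → a ≠ b → False

/-- The contradictory module is an anticomponent `A` of a component `M` of the set `X`. A vertex `x`
that splits `A` lies outside `M`, and it splits both a nonadjacent pair in `A` and an adjacent pair
in `M`. With both pairs available, every adjacency of `x` to `a`, `n`, `y`, `w` yields an antifork.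
-/
theorem IsPrime.bullHeadFree (hP : IsPrime G) (hG : ForkAntiforkFree G) : BullHeadFree G := by
  intro y a n w p q r e_ya e_an e_nw ap aq ar np nq nr pq qr n_yn n_yw n_aw yp yq yr
    wp wq wr pr hpr
  set X : Set V := {v | G.Adj a v ∧ G.Adj n v ∧ ¬G.Adj y v ∧ ¬G.Adj w v} with hX
  have hqX : q ∈ X := ⟨aq, nq, yq, wq⟩
  set M := component G X q with hM
  have hMX : M ⊆ X := component_subset hqX
  have hpM : p ∈ M := component_closed (mem_component_self X q) pq.symm ⟨ap, np, yp, wp⟩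
  have hrM : r ∈ M := component_closed (mem_component_self X q) qr ⟨ar, nr, yr, wr⟩
  set A := component Gᶜ M p with hA
  have hAM : A ⊆ M := component_subset hpM
  have hrA : r ∈ A := component_closed (mem_component_self M p) ⟨hpr, pr⟩ hrM
  refine hP.false_of_module (X := A) (v := a) ?_ (mem_component_self M p) hrA hpr
    (fun h => G.irrefl (hMX (hAM h)).1)
  intro s hs t ht x hx hxs
  by_contra hxt
  obtain ⟨m, hm, k, hk, hmk, e_xm, n_xk⟩ :=
    component_exists_edge (P := fun v => G.Adj x v) hs ht hxs hxt
  have hxM : x ∉ M := fun h => by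
    refine hx (component_closed hk ⟨?_, fun h' => n_xk h'.symm⟩ h)
    rintro rfl
    exact hmk.2 e_xm.symm
  obtain ⟨u, hu, v, hv, e_uv, e_xu, n_xv⟩ :=
    component_exists_edge (P := fun v => G.Adj x v) (hAM hs) (hAM ht) hxs hxt
  have hxX : x ∉ X := fun h => hxM (component_closed hu e_xu.symm h)
  obtain ⟨e_am, e_nm, n_ym, n_wm⟩ := hMX (hAM hm)
  obtain ⟨e_ak, e_nk, n_yk, n_wk⟩ := hMX (hAM hk)
  obtain ⟨e_au, e_nu, n_yu, n_wu⟩ := hMX hu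
  obtain ⟨e_av, e_nv, n_yv, n_wv⟩ := hMX hv
  have n_mk := hmk.2
  rcases Classical.em (G.Adj x a) with e_xa | n_xa
  · rcases Classical.em (G.Adj x n) with e_xn | n_xn
    · rcases Classical.em (G.Adj y x) with e_yx | n_yx
      · exact hG.antifork e_nv e_xn.symm e_nu e_yx e_uv.symm e_xu (mt G.adj_symm n_yn) n_yv (mt
            G.adj_symm n_xv) n_yu
      · rcases Classical.em (G.Adj w x) with e_wx | n_wx
        · exact hG.antifork e_av e_xa.symm e_au e_wx e_uv.symm e_xu n_aw n_wv (mt G.adj_symm n_xv)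
              n_wu
        · exact hxX ⟨e_xa.symm, e_xn.symm, n_yx, n_wx⟩
    · have e_wx : G.Adj w x := not_not.mp fun h => hG.antifork e_xa.symm e_an e_au e_nw.symm e_xu
          e_nu n_aw h n_xn n_wu
      exact hG.antifork e_av e_xa.symm e_au e_wx e_uv.symm e_xu n_aw n_wv (mt G.adj_symm n_xv)
          n_wu
  · rcases Classical.em (G.Adj x n) with e_xn | n_xn
    · have e_yx : G.Adj y x := not_not.mp fun h => hG.antifork e_xn.symm e_an.symm e_nu e_ya e_xu
          e_au (mt G.adj_symm n_yn) h n_xa n_yu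
      exact hG.antifork e_nv e_xn.symm e_nu e_yx e_uv.symm e_xu (mt G.adj_symm n_yn) n_yv (mt
          G.adj_symm n_xv) n_yu
    · exact hG.antifork e_ak e_am e_an e_xm e_nk.symm e_nm.symm (mt G.adj_symm n_xa) n_xk (mt
          G.adj_symm n_mk) n_xn

/-! ### Diamonds with an isolated vertex -/

/-- `a, b` are the adjacent and `c, d` the nonadjacent vertices of an induced diamond. -/
structure IsDiamond (G : SimpleGraph V) (a b c d : V) : Prop where
  ab : G.Adj a b
  ac : G.Adj a c
  ad : G.Adj a d
  bc : G.Adj b c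
  bd : G.Adj b d
  cd : ¬G.Adj c d
  ne : c ≠ d

theorem IsDiamond.swap_mids {a b c d : V} (h : IsDiamond G a b c d) : IsDiamond G b a c d :=
  ⟨h.ab.symm, h.bc, h.bd, h.ac, h.ad, h.cd, h.ne⟩

theorem IsDiamond.swap_ends {a b c d : V} (h : IsDiamond G a b c d) : IsDiamond G a b d c :=
  ⟨h.ab, h.ad, h.ac, h.bd, h.bc, mt G.adj_symm h.cd, h.ne.symm⟩

/-- `v` is adjacent to each of four vertices. -/
def AdjAll (G : SimpleGraph V) (v a b c d : V) : Prop :=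
  G.Adj v a ∧ G.Adj v b ∧ G.Adj v c ∧ G.Adj v d

/-- `v` is adjacent to none of four vertices. -/
def AdjNone (G : SimpleGraph V) (v a b c d : V) : Prop :=
  ¬G.Adj v a ∧ ¬G.Adj v b ∧ ¬G.Adj v c ∧ ¬G.Adj v d

theorem AdjAll.swap_mids {v a b c d : V} (h : AdjAll G v a b c d) : AdjAll G v b a c d :=
  ⟨h.2.1, h.1, h.2.2⟩

theorem AdjAll.swap_ends {v a b c d : V} (h : AdjAll G v a b c d) : AdjAll G v a b d c :=
  ⟨h.1, h.2.1, h.2.2.2, h.2.2.1⟩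

theorem AdjNone.swap_mids {v a b c d : V} (h : AdjNone G v a b c d) : AdjNone G v b a c d :=
  ⟨h.2.1, h.1, h.2.2⟩

theorem AdjNone.swap_ends {v a b c d : V} (h : AdjNone G v a b c d) : AdjNone G v a b d c :=
  ⟨h.1, h.2.1, h.2.2.2, h.2.2.1⟩

/-- Primeness supplies a vertex `t` distinguishing the ends `c` and `d`; however `t` meets `a`, `b`,
`w`, `x`, a fork or an antifork arises. The later lemmas `diamond_non_ends` and `near_all_ends` use
`t` in the same way. -/
theorem diamond_tail_ends (hG : ForkAntiforkFree G) {a b c d w x t : V} (e_ab : G.Adj a b) (e_ac :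
    G.Adj a c) (e_ad : G.Adj a d) (e_bc : G.Adj b c) (e_bd : G.Adj b d) (n_cd : ¬G.Adj c d) (n_wa
    : ¬G.Adj w a) (n_wb : ¬G.Adj w b) (n_wc : ¬G.Adj w c) (n_wd : ¬G.Adj w d) (e_xc : G.Adj x c)
    (e_xd : G.Adj x d) (n_xa : ¬G.Adj x a) (n_xb : ¬G.Adj x b) (e_xw : G.Adj x w) (e_tc : G.Adj t
    c) (n_td : ¬G.Adj t d) : False := by
  rcases Classical.em (G.Adj a t) with e_at | n_at
  · rcases Classical.em (G.Adj w t) with e_wt | n_wt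
    · have n_tb : ¬G.Adj t b := fun h => hG.antifork e_ad e_at e_ab e_wt e_bd.symm h (mt
          G.adj_symm n_wa) n_wd (mt G.adj_symm n_td) n_wb
      exact hG.antifork e_ab e_at e_ac e_wt e_bc e_tc (mt G.adj_symm n_wa) n_wb (mt G.adj_symm
          n_tb) n_wc
    · have n_xt : ¬G.Adj x t := fun h => hG.antifork e_ac.symm e_xc.symm e_tc.symm e_xw.symm e_at
          h (mt G.adj_symm n_wc) n_wa (mt G.adj_symm n_xa) n_wt
      exact hG.fork e_xd.symm e_xc e_tc.symm e_xw (mt G.adj_symm n_cd) (mt G.adj_symm n_td) (mt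
          G.adj_symm n_wd) n_xt (mt G.adj_symm n_wc) (mt G.adj_symm n_wt) (ne_of_adj_of_not_adj
          e_ad (mt G.adj_symm n_wa))
  · have e_tb : G.Adj t b := not_not.mp fun h => hG.antifork e_ad e_ac e_ab e_tc e_bd.symm
        e_bc.symm n_at n_td (mt G.adj_symm n_cd) h
    have n_wt : ¬G.Adj w t := fun h => hG.antifork e_ab.symm e_tb.symm e_bc h e_ac e_tc (mt
        G.adj_symm n_wb) n_wa n_at n_wc
    have e_xt : G.Adj x t := not_not.mp fun h => hG.fork e_xd.symm e_xc e_tc.symm e_xw (mt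
        G.adj_symm n_cd) (mt G.adj_symm n_td) (mt G.adj_symm n_wd) h (mt G.adj_symm n_wc) (mt
        G.adj_symm n_wt) (ne_of_adj_of_not_adj e_ad (mt G.adj_symm n_wa))
    exact hG.antifork e_bc.symm e_xc.symm e_tc.symm e_xw.symm e_tb.symm e_xt (mt G.adj_symm n_wc)
        n_wb (mt G.adj_symm n_xb) n_wt

/-- A vertex with a neighbour anticomplete to a diamond is not adjacent to the two ends only. -/
theorem diamond_tail (hP : IsPrime G) (hG : ForkAntiforkFree G) {a b c d w x : V}
    (h : IsDiamond G a b c d) (hw : AdjNone G w a b c d) (hxw : G.Adj x w) (hxa : ¬G.Adj x a)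
    (hxb : ¬G.Adj x b) (hxc : G.Adj x c) (hxd : G.Adj x d) : False := by
  obtain ⟨t, -, -, ht | ht⟩ := hP.exists_distinguishing h.ne h.ac.ne h.ad.ne
  · exact diamond_tail_ends hG h.ab h.ac h.ad h.bc h.bd h.cd hw.1 hw.2.1 hw.2.2.1 hw.2.2.2 hxc hxd
      hxa hxb hxw ht.1 ht.2
  · exact diamond_tail_ends hG h.ab h.ad h.ac h.bd h.bc (mt G.adj_symm h.cd) hw.1 hw.2.1 hw.2.2.2
      hw.2.2.1 hxd hxc hxa hxb hxw ht.1 ht.2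

/-- A neighbour of a vertex anticomplete to a diamond is complete or anticomplete to it. -/
theorem diamond_nbr (hP : IsPrime G) (hG : ForkAntiforkFree G) {a b c d w v : V}
    (h : IsDiamond G a b c d) (hw : AdjNone G w a b c d) (e_wv : G.Adj w v) :
    AdjAll G v a b c d ∨ AdjNone G v a b c d := by
  obtain ⟨n_wa, n_wb, n_wc, n_wd⟩ := id hw
  obtain ⟨e_ab, e_ac, e_ad, e_bc, e_bd, n_cd, hcd⟩ := id h
  rcases Classical.em (G.Adj v a) with e_va | n_va
  · have e_vb : G.Adj v b := not_not.mp fun n_vb => by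
      have n_vc : ¬G.Adj v c := fun h => hG.antifork e_ab e_va.symm e_ac e_wv e_bc h (mt
          G.adj_symm n_wa) n_wb (mt G.adj_symm n_vb) n_wc
      have e_vd : G.Adj v d := not_not.mp fun h => hG.fork e_ac.symm e_va.symm e_wv.symm e_ad (mt
          G.adj_symm n_vc) (mt G.adj_symm n_wc) n_cd (mt G.adj_symm n_wa) h n_wd hcd
      exact hG.antifork e_ab e_va.symm e_ad e_wv e_bd e_vd (mt G.adj_symm n_wa) n_wb (mt
          G.adj_symm n_vb) n_wd
    have e_vc : G.Adj v c := not_not.mp fun n_vc => by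
      exact hG.antifork e_ac e_va.symm e_ab e_wv e_bc.symm e_vb (mt G.adj_symm n_wa) n_wc (mt
          G.adj_symm n_vc) n_wb
    have e_vd : G.Adj v d := not_not.mp fun n_vd => by
      exact hG.antifork e_ad e_va.symm e_ab e_wv e_bd.symm e_vb (mt G.adj_symm n_wa) n_wd (mt
          G.adj_symm n_vd) n_wb
    exact Or.inl ⟨e_va, e_vb, e_vc, e_vd⟩
  · have n_vb : ¬G.Adj v b := fun e_vb => by
      have n_vc : ¬G.Adj v c := fun h => hG.antifork e_ab.symm e_vb.symm e_bc e_wv e_ac h (mt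
          G.adj_symm n_wb) n_wa (mt G.adj_symm n_va) n_wc
      have e_vd : G.Adj v d := not_not.mp fun h => hG.fork e_bc.symm e_vb.symm e_wv.symm e_bd (mt
          G.adj_symm n_vc) (mt G.adj_symm n_wc) n_cd (mt G.adj_symm n_wb) h n_wd hcd
      exact hG.antifork e_ab.symm e_vb.symm e_bd e_wv e_ad e_vd (mt G.adj_symm n_wb) n_wa (mt
          G.adj_symm n_va) n_wd
    rcases Classical.em (G.Adj v c) with e_vc | n_vc
    · have e_vd : G.Adj v d := not_not.mp fun n_vd => by
        exact hG.antifork e_ad e_ac e_ab e_vc e_bd.symm e_bc.symm (mt G.adj_symm n_va) n_vd (mt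
            G.adj_symm n_cd) n_vb
      exact (diamond_tail hP hG h hw e_wv.symm n_va n_vb e_vc e_vd).elim
    · have n_vd : ¬G.Adj v d := fun e_vd => by
        exact hG.antifork e_ac e_ad e_ab e_vd e_bc.symm e_bd.symm (mt G.adj_symm n_va) n_vc n_cd
            n_vb
      exact Or.inr ⟨n_va, n_vb, n_vc, n_vd⟩

theorem diamond_non_ends (hG : ForkAntiforkFree G) {a b c d n w z t : V} (e_ab : G.Adj a b) (e_ac
    : G.Adj a c) (e_ad : G.Adj a d) (e_bc : G.Adj b c) (e_bd : G.Adj b d) (n_cd : ¬G.Adj c d)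
    (n_wa : ¬G.Adj w a) (n_wb : ¬G.Adj w b) (n_wc : ¬G.Adj w c) (n_wd : ¬G.Adj w d) (e_na : G.Adj
    n a) (e_nb : G.Adj n b) (e_nc : G.Adj n c) (e_nd : G.Adj n d) (e_nw : G.Adj n w) (n_zn :
    ¬G.Adj z n) (n_zw : ¬G.Adj z w) (n_za : ¬G.Adj z a) (n_zb : ¬G.Adj z b) (e_zc : G.Adj z c)
    (e_zd : G.Adj z d) (e_tc : G.Adj t c) (n_td : ¬G.Adj t d) : False := by
  rcases Classical.em (G.Adj a t) with e_at | n_at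
  · rcases Classical.em (G.Adj w t) with e_wt | n_wt
    · have n_tb : ¬G.Adj t b := fun h => hG.antifork e_ad e_at e_ab e_wt e_bd.symm h (mt
          G.adj_symm n_wa) n_wd (mt G.adj_symm n_td) n_wb
      exact hG.antifork e_ab e_at e_ac e_wt e_bc e_tc (mt G.adj_symm n_wa) n_wb (mt G.adj_symm
          n_tb) n_wc
    · have e_nt : G.Adj n t := not_not.mp fun h => hG.fork e_nd.symm e_nc e_tc.symm e_nw (mt
          G.adj_symm n_cd) (mt G.adj_symm n_td) (mt G.adj_symm n_wd) h (mt G.adj_symm n_wc) (mt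
          G.adj_symm n_wt) (ne_of_adj_of_not_adj e_ad (mt G.adj_symm n_wa))
      have n_zt : ¬G.Adj z t := fun h => hG.antifork e_zc.symm e_nc.symm e_tc.symm e_nw.symm h
          e_nt (mt G.adj_symm n_wc) (mt G.adj_symm n_zw) n_zn n_wt
      exact hG.antifork e_at e_ad e_na.symm e_zd e_nt.symm e_nd.symm (mt G.adj_symm n_za) n_zt
          n_td n_zn
  · have e_tb : G.Adj t b := not_not.mp fun h => hG.antifork e_ad e_ac e_ab e_tc e_bd.symm
        e_bc.symm n_at n_td (mt G.adj_symm n_cd) h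
    have n_wt : ¬G.Adj w t := fun h => hG.antifork e_ab.symm e_tb.symm e_bc h e_ac e_tc (mt
        G.adj_symm n_wb) n_wa n_at n_wc
    have e_nt : G.Adj n t := not_not.mp fun h => hG.fork e_nd.symm e_nc e_tc.symm e_nw (mt
        G.adj_symm n_cd) (mt G.adj_symm n_td) (mt G.adj_symm n_wd) h (mt G.adj_symm n_wc) (mt
        G.adj_symm n_wt) (ne_of_adj_of_not_adj e_ad (mt G.adj_symm n_wa))
    have n_zt : ¬G.Adj z t := fun h => hG.antifork e_zc.symm e_nc.symm e_tc.symm e_nw.symm h e_nt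
        (mt G.adj_symm n_wc) (mt G.adj_symm n_zw) n_zn n_wt
    exact hG.antifork e_tb.symm e_bd e_nb.symm e_zd e_nt.symm e_nd.symm (mt G.adj_symm n_zb) n_zt
        n_td n_zn

/-- If `n` is complete to a diamond and has a neighbour `w` anticomplete to it, then the vertices
nonadjacent to both are anticomplete to the diamond. -/
theorem diamond_non (hP : IsPrime G) (hG : ForkAntiforkFree G) {a b c d n w z : V}
    (h : IsDiamond G a b c d) (hw : AdjNone G w a b c d) (hn : AdjAll G n a b c d)
    (e_nw : G.Adj n w) (n_zn : ¬G.Adj z n) (n_zw : ¬G.Adj z w) : AdjNone G z a b c d := by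
  have hB := hP.bullHeadFree hG
  obtain ⟨n_wa, n_wb, n_wc, n_wd⟩ := id hw
  obtain ⟨e_na, e_nb, e_nc, e_nd⟩ := id hn
  obtain ⟨e_ab, e_ac, e_ad, e_bc, e_bd, n_cd, hcd⟩ := id h
  have n_za : ¬G.Adj z a := fun e_za => by
    have n_zb : ¬G.Adj z b := fun h => hG.antifork e_za.symm e_na.symm e_ab e_nw.symm h e_nb (mt
        G.adj_symm n_wa) (mt G.adj_symm n_zw) n_zn n_wb
    have n_zc : ¬G.Adj z c := fun h => hG.antifork e_za.symm e_na.symm e_ac e_nw.symm h e_nc (mt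
        G.adj_symm n_wa) (mt G.adj_symm n_zw) n_zn n_wc
    have e_zd : G.Adj z d := not_not.mp fun h => hB e_nw.symm e_na e_za.symm e_nc e_nb e_nd e_ac
        e_ab e_ad e_bc.symm e_bd n_wa (mt G.adj_symm n_zw) (mt G.adj_symm n_zn) n_wc n_wb n_wd
        n_zc n_zb h n_cd hcd
    exact hG.antifork e_za.symm e_na.symm e_ad e_nw.symm e_zd e_nd (mt G.adj_symm n_wa) (mt
        G.adj_symm n_zw) n_zn n_wd
  have n_zb : ¬G.Adj z b := fun e_zb => by
    have n_zc : ¬G.Adj z c := fun h => hG.antifork e_zb.symm e_nb.symm e_bc e_nw.symm h e_nc (mt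
        G.adj_symm n_wb) (mt G.adj_symm n_zw) n_zn n_wc
    have e_zd : G.Adj z d := not_not.mp fun h => hB e_nw.symm e_nb e_zb.symm e_nc e_na e_nd e_bc
        e_ab.symm e_bd e_ac.symm e_ad n_wb (mt G.adj_symm n_zw) (mt G.adj_symm n_zn) n_wc n_wa
        n_wd n_zc n_za h n_cd hcd
    exact hG.antifork e_zb.symm e_nb.symm e_bd e_nw.symm e_zd e_nd (mt G.adj_symm n_wb) (mt
        G.adj_symm n_zw) n_zn n_wd
  rcases Classical.em (G.Adj z c) with e_zc | n_zc
  · have e_zd : G.Adj z d := not_not.mp fun n_zd => by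
      exact hG.antifork e_ad e_ac e_ab e_zc e_bd.symm e_bc.symm (mt G.adj_symm n_za) n_zd (mt
          G.adj_symm n_cd) n_zb
    obtain ⟨t, -, -, ⟨e_tc, n_td⟩ | ⟨e_td, n_tc⟩⟩ :=
      hP.exists_distinguishing h.ne e_ac.ne e_ad.ne
    · exfalso
      exact diamond_non_ends hG e_ab e_ac e_ad e_bc e_bd n_cd n_wa n_wb n_wc n_wd e_na e_nb e_nc
          e_nd e_nw n_zn n_zw n_za n_zb e_zc e_zd e_tc n_td
    · exfalso
      exact diamond_non_ends hG e_ab e_ad e_ac e_bd e_bc (mt G.adj_symm n_cd) n_wa n_wb n_wd n_wc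
          e_na e_nb e_nd e_nc e_nw n_zn n_zw n_za n_zb e_zd e_zc e_td n_tc
  · have n_zd : ¬G.Adj z d := fun e_zd => by
      exact hG.antifork e_ac e_ad e_ab e_zd e_bc.symm e_bd.symm (mt G.adj_symm n_za) n_zc n_cd
          n_zb
    exact ⟨n_za, n_zb, n_zc, n_zd⟩

theorem near_all_ends (hG : ForkAntiforkFree G) {a b c d w x z t : V} (e_ab : G.Adj a b) (e_ac :
    G.Adj a c) (e_ad : G.Adj a d) (e_bc : G.Adj b c) (e_bd : G.Adj b d) (n_cd : ¬G.Adj c d) (n_wa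
    : ¬G.Adj w a) (n_wb : ¬G.Adj w b) (n_wc : ¬G.Adj w c) (n_wd : ¬G.Adj w d) (n_xw : ¬G.Adj x w)
    (e_zw : G.Adj z w) (e_za : G.Adj z a) (e_zb : G.Adj z b) (e_zc : G.Adj z c) (e_zd : G.Adj z d)
    (n_zx : ¬G.Adj z x) (n_xa : ¬G.Adj x a) (n_xb : ¬G.Adj x b) (e_xc : G.Adj x c) (e_xd : G.Adj x
    d) (e_tc : G.Adj t c) (n_td : ¬G.Adj t d) : False := by
  rcases Classical.em (G.Adj a t) with e_at | n_at
  · rcases Classical.em (G.Adj w t) with e_wt | n_wt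
    · have n_tb : ¬G.Adj t b := fun h => hG.antifork e_ad e_at e_ab e_wt e_bd.symm h (mt
          G.adj_symm n_wa) n_wd (mt G.adj_symm n_td) n_wb
      exact hG.antifork e_ab e_at e_ac e_wt e_bc e_tc (mt G.adj_symm n_wa) n_wb (mt G.adj_symm
          n_tb) n_wc
    · have e_zt : G.Adj z t := not_not.mp fun h => hG.fork e_zd.symm e_zc e_tc.symm e_zw (mt
          G.adj_symm n_cd) (mt G.adj_symm n_td) (mt G.adj_symm n_wd) h (mt G.adj_symm n_wc) (mt
          G.adj_symm n_wt) (ne_of_adj_of_not_adj e_ad (mt G.adj_symm n_wa))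
      have n_xt : ¬G.Adj x t := fun h => hG.antifork e_xc.symm e_zc.symm e_tc.symm e_zw.symm h
          e_zt (mt G.adj_symm n_wc) (mt G.adj_symm n_xw) (mt G.adj_symm n_zx) n_wt
      exact hG.antifork e_at e_ad e_za.symm e_xd e_zt.symm e_zd.symm (mt G.adj_symm n_xa) n_xt
          n_td (mt G.adj_symm n_zx)
  · have e_tb : G.Adj t b := not_not.mp fun h => hG.antifork e_ad e_ac e_ab e_tc e_bd.symm
        e_bc.symm n_at n_td (mt G.adj_symm n_cd) h
    have n_wt : ¬G.Adj w t := fun h => hG.antifork e_ab.symm e_tb.symm e_bc h e_ac e_tc (mt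
        G.adj_symm n_wb) n_wa n_at n_wc
    have e_zt : G.Adj z t := not_not.mp fun h => hG.fork e_zd.symm e_zc e_tc.symm e_zw (mt
        G.adj_symm n_cd) (mt G.adj_symm n_td) (mt G.adj_symm n_wd) h (mt G.adj_symm n_wc) (mt
        G.adj_symm n_wt) (ne_of_adj_of_not_adj e_ad (mt G.adj_symm n_wa))
    have n_xt : ¬G.Adj x t := fun h => hG.antifork e_xc.symm e_zc.symm e_tc.symm e_zw.symm h e_zt
        (mt G.adj_symm n_wc) (mt G.adj_symm n_xw) (mt G.adj_symm n_zx) n_wt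
    exact hG.antifork e_tb.symm e_bd e_zb.symm e_xd e_zt.symm e_zd.symm (mt G.adj_symm n_xb) n_xt
        n_td (mt G.adj_symm n_zx)

theorem near_all_mid (hG : ForkAntiforkFree G) (hB : BullHeadFree G) {a b c d w x z : V} (e_ab :
    G.Adj a b) (e_ac : G.Adj a c) (e_ad : G.Adj a d) (e_bc : G.Adj b c) (e_bd : G.Adj b d) (n_cd :
    ¬G.Adj c d) (n_wa : ¬G.Adj w a) (n_wb : ¬G.Adj w b) (n_wc : ¬G.Adj w c) (n_wd : ¬G.Adj w d)
    (n_xw : ¬G.Adj x w) (e_zw : G.Adj z w) (e_za : G.Adj z a) (e_zb : G.Adj z b) (e_zc : G.Adj z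
    c) (e_zd : G.Adj z d) (n_zx : ¬G.Adj z x) (e_xa : G.Adj x a) (hcd : c ≠ d) : False := by
  have n_xb : ¬G.Adj x b := fun h => hG.antifork e_xa.symm e_za.symm e_ab e_zw.symm h e_zb (mt
      G.adj_symm n_wa) (mt G.adj_symm n_xw) (mt G.adj_symm n_zx) n_wb
  have n_xc : ¬G.Adj x c := fun h => hG.antifork e_xa.symm e_za.symm e_ac e_zw.symm h e_zc (mt
      G.adj_symm n_wa) (mt G.adj_symm n_xw) (mt G.adj_symm n_zx) n_wc
  have e_xd : G.Adj x d := not_not.mp fun h => hB e_zw.symm e_za e_xa.symm e_zc e_zb e_zd e_ac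
      e_ab e_ad e_bc.symm e_bd n_wa (mt G.adj_symm n_xw) n_zx n_wc n_wb n_wd n_xc n_xb h n_cd hcd
  exact hG.antifork e_xa.symm e_za.symm e_ad e_zw.symm e_xd e_zd (mt G.adj_symm n_wa) (mt
      G.adj_symm n_xw) (mt G.adj_symm n_zx) n_wd

theorem near_none_mid_of_adj (hG : ForkAntiforkFree G) {a b c d w x z : V} (e_ab : G.Adj a b)
    (e_ac : G.Adj a c) (e_ad : G.Adj a d) (e_bc : G.Adj b c) (e_bd : G.Adj b d) (n_cd : ¬G.Adj c
    d) (n_wc : ¬G.Adj w c) (n_wd : ¬G.Adj w d) (n_xw : ¬G.Adj x w) (e_zw : G.Adj z w) (n_za :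
    ¬G.Adj z a) (n_zb : ¬G.Adj z b) (n_zc : ¬G.Adj z c) (n_zd : ¬G.Adj z d) (e_zx : G.Adj z x)
    (e_xa : G.Adj x a) (hcd : c ≠ d) : False := by
  rcases Classical.em (G.Adj c x) with e_cx | n_cx
  · have n_xd : ¬G.Adj x d := fun h => hG.fork e_cx e_zx.symm e_zw h (mt G.adj_symm n_zc) (mt
        G.adj_symm n_wc) n_cd n_xw n_zd n_wd hcd
    have n_xb : ¬G.Adj x b := fun h => hG.antifork e_ad e_xa.symm e_ab e_zx e_bd.symm h (mt
        G.adj_symm n_za) n_zd (mt G.adj_symm n_xd) n_zb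
    exact hG.antifork e_ab e_xa.symm e_ac e_zx e_bc e_cx.symm (mt G.adj_symm n_za) n_zb (mt
        G.adj_symm n_xb) n_zc
  · have e_xd : G.Adj x d := not_not.mp fun h => hG.fork e_ac.symm e_xa.symm e_zx.symm e_ad n_cx
        (mt G.adj_symm n_zc) n_cd (mt G.adj_symm n_za) h n_zd hcd
    have n_xb : ¬G.Adj x b := fun h => hG.antifork e_ac e_xa.symm e_ab e_zx e_bc.symm h (mt
        G.adj_symm n_za) n_zc n_cx n_zb
    exact hG.antifork e_ab e_xa.symm e_ad e_zx e_bd e_xd (mt G.adj_symm n_za) n_zb (mt G.adj_symm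
        n_xb) n_zd

theorem near_none_mid_of_not_adj (hG : ForkAntiforkFree G) (hB : BullHeadFree G) {a c d n w x z :
    V} (e_ac : G.Adj a c) (e_ad : G.Adj a d) (n_cd : ¬G.Adj c d) (n_wa : ¬G.Adj w a) (n_wc :
    ¬G.Adj w c) (n_wd : ¬G.Adj w d) (e_na : G.Adj n a) (e_nc : G.Adj n c) (e_nd : G.Adj n d) (e_nw
    : G.Adj n w) (e_xn : G.Adj x n) (n_xw : ¬G.Adj x w) (n_zw : ¬G.Adj z w) (n_zn : ¬G.Adj z n)
    (n_za : ¬G.Adj z a) (n_zc : ¬G.Adj z c) (n_zd : ¬G.Adj z d) (e_zx : G.Adj z x) (e_xa : G.Adj x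
    a) (hcd : c ≠ d) : False := by
  have e_cx : G.Adj c x := not_not.mp fun h => hG.antifork e_ac e_xa.symm e_na.symm e_zx e_nc.symm
      e_xn (mt G.adj_symm n_za) n_zc h n_zn
  have e_dx : G.Adj d x := not_not.mp fun h => hG.antifork e_ad e_xa.symm e_na.symm e_zx e_nd.symm
      e_xn (mt G.adj_symm n_za) n_zd h n_zn
  exact hB e_nw.symm e_xn.symm e_zx.symm e_nc e_na e_nd e_cx.symm e_xa e_dx.symm e_ac.symm e_ad
      (mt G.adj_symm n_xw) (mt G.adj_symm n_zw) (mt G.adj_symm n_zn) n_wc n_wa n_wd n_zc n_za n_zd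
      n_cd hcd

theorem near_none_end_of_adj (hG : ForkAntiforkFree G) {a b c d w x z : V} (e_ab : G.Adj a b)
    (e_ac : G.Adj a c) (e_ad : G.Adj a d) (e_bc : G.Adj b c) (e_bd : G.Adj b d) (n_cd : ¬G.Adj c
    d) (n_wc : ¬G.Adj w c) (n_wd : ¬G.Adj w d) (n_xw : ¬G.Adj x w) (e_zw : G.Adj z w) (n_zc :
    ¬G.Adj z c) (n_zd : ¬G.Adj z d) (e_zx : G.Adj z x) (n_xa : ¬G.Adj x a) (n_xb : ¬G.Adj x b)
    (e_xc : G.Adj x c) (hcd : c ≠ d) : False := by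
  have e_xd : G.Adj x d := not_not.mp fun h => hG.antifork e_ad e_ac e_ab e_xc e_bd.symm e_bc.symm
      (mt G.adj_symm n_xa) h (mt G.adj_symm n_cd) n_xb
  exact hG.fork e_xc.symm e_zx.symm e_zw e_xd (mt G.adj_symm n_zc) (mt G.adj_symm n_wc) n_cd n_xw
      n_zd n_wd hcd

theorem near_none_end_of_not_adj (hG : ForkAntiforkFree G) {a c n x z : V} (e_ac : G.Adj a c)
    (e_na : G.Adj n a) (e_nc : G.Adj n c) (e_xn : G.Adj x n) (n_zn : ¬G.Adj z n) (n_za : ¬G.Adj z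
    a) (n_zc : ¬G.Adj z c) (e_zx : G.Adj z x) (n_xa : ¬G.Adj x a) (e_xc : G.Adj x c) : False := by
  exact hG.antifork e_ac.symm e_xc.symm e_nc.symm e_zx e_na.symm e_xn (mt G.adj_symm n_zc) n_za
      (mt G.adj_symm n_xa) n_zn

/-- A vertex outside the nonneighbourhood of `w` in the neighbourhood of `n`. -/
theorem diamond_const (hP : IsPrime G) (hG : ForkAntiforkFree G) {a b c d n w z : V}
    (h : IsDiamond G a b c d) (hw : AdjNone G w a b c d) (hn : AdjAll G n a b c d)
    (e_nw : G.Adj n w) (hz : G.Adj z n → G.Adj z w) :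
    AdjAll G z a b c d ∧ G.Adj z w ∨ AdjNone G z a b c d := by
  by_cases hzw : G.Adj z w
  · exact (diamond_nbr hP hG h hw hzw.symm).imp_left fun h => ⟨h, hzw⟩
  · exact Or.inr (diamond_non hP hG h hw hn e_nw (fun h => hzw (hz h)) hzw)

/-- Together with `near_none` this says that `z` does not distinguish the diamond from a vertex `x`
meeting it. If `z` missed `x`, antiforks and `BullHeadFree` would force `x` to see exactly the ends
`c`, `d`, and a vertex distinguishing these ends is impossible. -/
theorem near_all (hP : IsPrime G) (hG : ForkAntiforkFree G) {a b c d w x z : V}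
    (h : IsDiamond G a b c d) (hw : AdjNone G w a b c d) (n_xw : ¬G.Adj x w) (e_zw : G.Adj z w)
    (hz : AdjAll G z a b c d) (hx : ¬AdjNone G x a b c d) : G.Adj z x := by
  by_contra n_zx
  have hB := hP.bullHeadFree hG
  obtain ⟨n_wa, n_wb, n_wc, n_wd⟩ := id hw
  obtain ⟨e_za, e_zb, e_zc, e_zd⟩ := id hz
  obtain ⟨e_ab, e_ac, e_ad, e_bc, e_bd, n_cd, hcd⟩ := id h
  have n_xa : ¬G.Adj x a := fun e_xa => by
    exact near_all_mid hG hB e_ab e_ac e_ad e_bc e_bd n_cd n_wa n_wb n_wc n_wd n_xw e_zw e_za e_zb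
        e_zc e_zd n_zx e_xa hcd
  have n_xb : ¬G.Adj x b := fun e_xb => by
    exact near_all_mid hG hB e_ab.symm e_bc e_bd e_ac e_ad n_cd n_wb n_wa n_wc n_wd n_xw e_zw e_zb
        e_za e_zc e_zd n_zx e_xb hcd
  have key : G.Adj x c ↔ G.Adj x d := by
    constructor
    · intro e_xc
      by_contra n_xd
      exact hG.antifork e_ad e_ac e_ab e_xc e_bd.symm e_bc.symm (mt G.adj_symm n_xa) n_xd (mt
          G.adj_symm n_cd) n_xb
    · intro e_xd
      by_contra n_xc
      exact hG.antifork e_ac e_ad e_ab e_xd e_bc.symm e_bd.symm (mt G.adj_symm n_xa) n_xc n_cd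
          n_xb
  have e_xc : G.Adj x c := not_not.mp fun n_xc => hx ⟨n_xa, n_xb, n_xc, mt key.2 n_xc⟩
  have e_xd := key.1 e_xc
  obtain ⟨t, -, -, ⟨e_tc, n_td⟩ | ⟨e_td, n_tc⟩⟩ := hP.exists_distinguishing h.ne e_ac.ne e_ad.ne
  · exact near_all_ends hG e_ab e_ac e_ad e_bc e_bd n_cd n_wa n_wb n_wc n_wd n_xw e_zw e_za e_zb
        e_zc e_zd n_zx n_xa n_xb e_xc e_xd e_tc n_td
  · exact near_all_ends hG e_ab e_ad e_ac e_bd e_bc (mt G.adj_symm n_cd) n_wa n_wb n_wd n_wc n_xw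
        e_zw e_za e_zb e_zd e_zc n_zx n_xa n_xb e_xd e_xc e_td n_tc

/-- The companion of `near_all` for `z` anticomplete to the diamond. If `z` sees `w`, obstructions
arise from the path `x - z - w`; otherwise `z` also misses `n`, and `n` is used instead. -/
theorem near_none (hP : IsPrime G) (hG : ForkAntiforkFree G) {a b c d n w x z : V}
    (h : IsDiamond G a b c d) (hw : AdjNone G w a b c d) (hn : AdjAll G n a b c d)
    (e_nw : G.Adj n w) (e_xn : G.Adj x n) (n_xw : ¬G.Adj x w) (hzn : G.Adj z n → G.Adj z w)
    (hz : AdjNone G z a b c d) (hx : ¬AdjNone G x a b c d) : ¬G.Adj z x := by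
  intro e_zx
  have hB := hP.bullHeadFree hG
  have key : ∀ {a b c d : V}, IsDiamond G a b c d → AdjNone G w a b c d → AdjAll G n a b c d →
      AdjNone G z a b c d → ¬G.Adj x a := by
    intro a b c d h hw hn hz e_xa
    obtain ⟨n_wa, n_wb, n_wc, n_wd⟩ := id hw
    obtain ⟨e_na, e_nb, e_nc, e_nd⟩ := id hn
    obtain ⟨n_za, n_zb, n_zc, n_zd⟩ := id hz
    obtain ⟨e_ab, e_ac, e_ad, e_bc, e_bd, n_cd, hcd⟩ := id h
    rcases Classical.em (G.Adj z w) with e_zw | n_zw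
    · exact near_none_mid_of_adj hG e_ab e_ac e_ad e_bc e_bd n_cd n_wc n_wd n_xw e_zw n_za n_zb
          n_zc n_zd e_zx e_xa hcd
    · have n_zn := mt hzn n_zw
      exact near_none_mid_of_not_adj hG hB e_ac e_ad n_cd n_wa n_wc n_wd e_na e_nc e_nd e_nw e_xn
          n_xw n_zw n_zn n_za n_zc n_zd e_zx e_xa hcd
  have n_xa := key h hw hn hz
  have n_xb := key h.swap_mids hw.swap_mids hn.swap_mids hz.swap_mids
  have key2 : ∀ {c d : V}, IsDiamond G a b c d → AdjNone G w a b c d → AdjAll G n a b c d →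
      AdjNone G z a b c d → ¬G.Adj x c := by
    intro c d h hw hn hz e_xc
    obtain ⟨n_wa, n_wb, n_wc, n_wd⟩ := id hw
    obtain ⟨e_na, e_nb, e_nc, e_nd⟩ := id hn
    obtain ⟨n_za, n_zb, n_zc, n_zd⟩ := id hz
    obtain ⟨e_ab, e_ac, e_ad, e_bc, e_bd, n_cd, hcd⟩ := id h
    rcases Classical.em (G.Adj z w) with e_zw | n_zw
    · exact near_none_end_of_adj hG e_ab e_ac e_ad e_bc e_bd n_cd n_wc n_wd n_xw e_zw n_zc n_zd
          e_zx n_xa n_xb e_xc hcd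
    · have n_zn := mt hzn n_zw
      exact near_none_end_of_not_adj hG e_ac e_na e_nc e_xn n_zn n_za n_zc e_zx n_xa e_xc
  exact hx ⟨n_xa, n_xb, key2 h hw hn hz, key2 h.swap_ends hw.swap_ends hn.swap_ends hz.swap_ends⟩

/-- This controls vertices `x` at distance two from the diamond. In the first case `u` can replace
`a`, and `x` meets the new diamond; in the second, the nonadjacent ends `c`, `d` can serve as leaves
of a fork centred at `u`. -/
theorem dist_two (hG : ForkAntiforkFree G) {a b c d u x : V} (h : IsDiamond G a b c d)
    (hu : ¬AdjNone G u a b c d) (hx : AdjNone G x a b c d) (e_xu : G.Adj x u) :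
    AdjAll G u a b c d ∨ ¬G.Adj u a ∧ ¬G.Adj u b ∧ G.Adj u c ∧ G.Adj u d := by
  obtain ⟨e_ab, e_ac, e_ad, e_bc, e_bd, n_cd, hcd⟩ := id h
  obtain ⟨n_xa, n_xb, n_xc, n_xd⟩ := id hx
  rcases Classical.em (G.Adj u a) with e_ua | n_ua
  · have e_ub : G.Adj u b := not_not.mp fun n_ub => by
      have n_uc : ¬G.Adj u c := fun h => hG.antifork e_ab e_ua.symm e_ac e_xu e_bc h (mt
          G.adj_symm n_xa) n_xb (mt G.adj_symm n_ub) n_xc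
      have e_ud : G.Adj u d := not_not.mp fun h => hG.fork e_ac.symm e_ua.symm e_xu.symm e_ad (mt
          G.adj_symm n_uc) (mt G.adj_symm n_xc) n_cd (mt G.adj_symm n_xa) h n_xd hcd
      exact hG.antifork e_ab e_ua.symm e_ad e_xu e_bd e_ud (mt G.adj_symm n_xa) n_xb (mt
          G.adj_symm n_ub) n_xd
    have e_uc : G.Adj u c := not_not.mp fun n_uc => by
      exact hG.antifork e_ac e_ua.symm e_ab e_xu e_bc.symm e_ub (mt G.adj_symm n_xa) n_xc (mt
          G.adj_symm n_uc) n_xb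
    have e_ud : G.Adj u d := not_not.mp fun n_ud => by
      exact hG.antifork e_ad e_ua.symm e_ab e_xu e_bd.symm e_ub (mt G.adj_symm n_xa) n_xd (mt
          G.adj_symm n_ud) n_xb
    exact Or.inl ⟨e_ua, e_ub, e_uc, e_ud⟩
  · have n_ub : ¬G.Adj u b := fun e_ub => by
      have n_uc : ¬G.Adj u c := fun h => hG.antifork e_ab.symm e_ub.symm e_bc e_xu e_ac h (mt
          G.adj_symm n_xb) n_xa (mt G.adj_symm n_ua) n_xc
      have e_ud : G.Adj u d := not_not.mp fun h => hG.fork e_bc.symm e_ub.symm e_xu.symm e_bd (mt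
          G.adj_symm n_uc) (mt G.adj_symm n_xc) n_cd (mt G.adj_symm n_xb) h n_xd hcd
      exact hG.antifork e_ab.symm e_ub.symm e_bd e_xu e_ad e_ud (mt G.adj_symm n_xb) n_xa (mt
          G.adj_symm n_ua) n_xd
    rcases Classical.em (G.Adj u c) with e_uc | n_uc
    · have e_ud : G.Adj u d := not_not.mp fun n_ud => by
        exact hG.antifork e_ad e_ac e_ab e_uc e_bd.symm e_bc.symm (mt G.adj_symm n_ua) n_ud (mt
            G.adj_symm n_cd) n_ub
      exact Or.inr ⟨n_ua, n_ub, e_uc, e_ud⟩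
    · have e_ud : G.Adj u d := not_not.mp fun n_ud => hu ⟨n_ua, n_ub, n_uc, n_ud⟩
      exfalso
      exact hG.antifork e_ac e_ad e_ab e_ud e_bc.symm e_bd.symm (mt G.adj_symm n_ua) n_uc n_cd
          n_ub

/-- `x` is within distance two, inside `X`, of a diamond in `X`, and `z` does not distinguish `x` from
the diamond; it is complete to it if `ε` holds and anticomplete otherwise. -/
def NearDiamond (G : SimpleGraph V) (X : Set V) (z : V) (ε : Prop) (x : V) : Prop :=
  ∃ a b c d, IsDiamond G a b c d ∧ (a ∈ X ∧ b ∈ X ∧ c ∈ X ∧ d ∈ X) ∧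
    (ε ∧ AdjAll G z a b c d ∨ ¬ε ∧ AdjNone G z a b c d) ∧ (G.Adj z x ↔ ε) ∧
    (¬AdjNone G x a b c d ∨ ∃ u ∈ X, ¬AdjNone G u a b c d ∧ G.Adj u x)

theorem nearDiamond_of_isDiamond (hP : IsPrime G) (hG : ForkAntiforkFree G) {n w z : V} {ε : Prop}
    (e_nw : G.Adj n w) (hz : G.Adj z n → G.Adj z w) {X : Set V}
    (hX : X = {v | G.Adj v n ∧ ¬G.Adj v w}) {a b c d x : V} (h : IsDiamond G a b c d)
    (hDX : a ∈ X ∧ b ∈ X ∧ c ∈ X ∧ d ∈ X)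
    (hzD : ε ∧ AdjAll G z a b c d ∨ ¬ε ∧ AdjNone G z a b c d) (hxX : x ∈ X)
    (hx : ¬AdjNone G x a b c d) : NearDiamond G X z ε x := by
  refine ⟨a, b, c, d, h, hDX, hzD, ?_, Or.inl hx⟩
  subst hX
  obtain ⟨ha, hb, hc, hd⟩ := hDX
  have hw : AdjNone G w a b c d := ⟨fun h => ha.2 h.symm, fun h => hb.2 h.symm,
    fun h => hc.2 h.symm, fun h => hd.2 h.symm⟩
  have hn : AdjAll G n a b c d := ⟨ha.1.symm, hb.1.symm, hc.1.symm, hd.1.symm⟩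
  rcases hzD with ⟨hε, hzD⟩ | ⟨hε, hzD⟩
  · refine iff_of_true ?_ hε
    rcases diamond_const hP hG h hw hn e_nw hz with h' | h'
    · exact near_all hP hG h hw hxX.2 h'.2 h'.1 hx
    · exact absurd hzD.1 h'.1
  · exact iff_of_false (near_none hP hG h hw hn e_nw hxX.1 hxX.2 hz hzD hx) hε

theorem nearDiamond_step (hP : IsPrime G) (hG : ForkAntiforkFree G) {n w z : V} {ε : Prop}
    (e_nw : G.Adj n w) (hz : G.Adj z n → G.Adj z w) {X : Set V}
    (hX : X = {v | G.Adj v n ∧ ¬G.Adj v w}) {a b c d u x : V} (h : IsDiamond G a b c d)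
    (hDX : a ∈ X ∧ b ∈ X ∧ c ∈ X ∧ d ∈ X)
    (hzD : ε ∧ AdjAll G z a b c d ∨ ¬ε ∧ AdjNone G z a b c d) (huX : u ∈ X) (hxX : x ∈ X)
    (hu : ¬AdjNone G u a b c d) (hux : G.Adj u x) : NearDiamond G X z ε x := by
  by_cases hx : AdjNone G x a b c d
  swap
  · exact nearDiamond_of_isDiamond hP hG e_nw hz hX h hDX hzD hxX hx
  have hzu : G.Adj z u ↔ ε := by
    obtain ⟨-, -, -, -, -, -, -, h, -⟩ := nearDiamond_of_isDiamond hP hG e_nw hz hX h hDX hzD huX hu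
    exact h
  rcases dist_two hG h hu hx hux.symm with h1 | ⟨hua, hub, huc, hud⟩
  · refine nearDiamond_of_isDiamond (a := u) (b := b) (c := c) (d := d) hP hG e_nw hz hX
      ⟨h1.2.1, h1.2.2.1, h1.2.2.2, h.bc, h.bd, h.cd, h.ne⟩ ⟨huX, hDX.2⟩ ?_ hxX
      fun h => h.1 hux.symm
    rcases hzD with ⟨hε, hzD⟩ | ⟨hε, hzD⟩
    · exact Or.inl ⟨hε, hzu.2 hε, hzD.2⟩
    · exact Or.inr ⟨hε, mt hzu.1 hε, hzD.2⟩
  · refine ⟨a, b, c, d, h, hDX, hzD, ?_, Or.inr ⟨u, huX, hu, hux⟩⟩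
    rcases hzD with ⟨hε, hzD⟩ | ⟨hε, hzD⟩
    · refine iff_of_true (not_not.mp fun hzx => ?_) hε
      exact hG.antifork h.ac.symm huc.symm hzD.2.2.1.symm hux.symm hzD.1.symm (hzu.2 hε).symm
        (mt G.adj_symm hx.2.2.1) hx.1 (mt G.adj_symm hua) (mt G.adj_symm hzx)
    · refine iff_of_false (fun hzx => ?_) hε
      exact hG.fork huc.symm hux hzx.symm hud (mt G.adj_symm hx.2.2.1) (mt G.adj_symm hzD.2.2.1)
        h.cd (fun h => hε (hzu.1 h.symm)) hx.2.2.2 hzD.2.2.2 h.ne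

/-- Distance three never occurs: either `v` is complete to the diamond and replaces `a` in it, or `c
- v - u - x` together with `d` is a fork. -/
theorem nearDiamond_of_adj (hP : IsPrime G) (hG : ForkAntiforkFree G) {n w z : V} {ε : Prop}
    (e_nw : G.Adj n w) (hz : G.Adj z n → G.Adj z w) {X : Set V}
    (hX : X = {v | G.Adj v n ∧ ¬G.Adj v w}) {u x : V} (huX : u ∈ X) (hxX : x ∈ X)
    (hux : G.Adj u x) (hu : NearDiamond G X z ε u) : NearDiamond G X z ε x := by
  obtain ⟨a, b, c, d, h, hDX, hzD, hzu, hu | ⟨v, hvX, hv, hvu⟩⟩ := hu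
  · exact nearDiamond_step hP hG e_nw hz hX h hDX hzD huX hxX hu hux
  by_cases hu : AdjNone G u a b c d
  swap
  · exact nearDiamond_step hP hG e_nw hz hX h hDX hzD huX hxX hu hux
  by_cases hx : AdjNone G x a b c d
  swap
  · exact nearDiamond_of_isDiamond hP hG e_nw hz hX h hDX hzD hxX hx
  by_cases hvx : G.Adj v x
  · exact nearDiamond_step hP hG e_nw hz hX h hDX hzD hvX hxX hv hvx
  have hzv : G.Adj z v ↔ ε := by
    obtain ⟨-, -, -, -, -, -, -, h, -⟩ := nearDiamond_of_isDiamond hP hG e_nw hz hX h hDX hzD hvX hv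
    exact h
  rcases dist_two hG h hv hu hvu.symm with h1 | ⟨hva, hvb, hvc, hvd⟩
  · refine nearDiamond_step (a := v) (b := b) (c := c) (d := d) hP hG e_nw hz hX
      ⟨h1.2.1, h1.2.2.1, h1.2.2.2, h.bc, h.bd, h.cd, h.ne⟩ ⟨hvX, hDX.2⟩ ?_ huX hxX
      (fun h => h.1 hvu.symm) hux
    rcases hzD with ⟨hε, hzD⟩ | ⟨hε, hzD⟩
    · exact Or.inl ⟨hε, hzv.2 hε, hzD.2⟩
    · exact Or.inr ⟨hε, mt hzv.1 hε, hzD.2⟩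
  · exact (hG.fork hvc.symm hvu hux hvd (mt G.adj_symm hu.2.2.1) (mt G.adj_symm hx.2.2.1)
        h.cd hvx hu.2.2.2 hx.2.2.2 h.ne).elim

/-- By connectivity the isolated vertex `w` can be chosen with a neighbour `n` complete to the
diamond. Let `X` consist of the neighbours of `n` that miss `w`. The component of `X` containing the
diamond is a module: an outside vertex with a neighbour in it is not in `X`, hence is complete or
anticomplete to the diamond, and `NearDiamond` carries this adjacency through the component. The
vertex `n` lies outside, against primeness. -/
theorem IsPrime.diamondIsolatedFree (hP : IsPrime G) (hG : ForkAntiforkFree G) :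
    DiamondIsolatedFree G := by
  intro a b c d w ab ac ad bc bd cd aw bw cw dw hcd
  have h : IsDiamond G a b c d := ⟨ab, ac, ad, bc, bd, cd, hcd⟩
  have hw : AdjNone G w a b c d :=
    ⟨mt G.adj_symm aw, mt G.adj_symm bw, mt G.adj_symm cw, mt G.adj_symm dw⟩
  obtain ⟨w, hw, n, e_nw, hn⟩ : ∃ w, AdjNone G w a b c d ∧ ∃ n, G.Adj n w ∧ AdjAll G n a b c d := by
    have hu := hP.component_univ ab.ne ac.ne bc.ne
    have hwa : w ∈ component G Set.univ a := by rw [hu]; trivial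
    obtain ⟨p, -, q, -, hpq, hp, hq⟩ := component_exists_edge (P := fun v => AdjNone G v a b c d)
      hwa (mem_component_self _ a) hw (fun h => h.2.1 ab)
    exact ⟨p, hp, q, hpq.symm, (diamond_nbr hP hG h hp hpq).resolve_right hq⟩
  set X : Set V := {v | G.Adj v n ∧ ¬G.Adj v w} with hX
  have haX : a ∈ X := ⟨hn.1.symm, fun h => hw.1 h.symm⟩
  have hDX : a ∈ X ∧ b ∈ X ∧ c ∈ X ∧ d ∈ X := ⟨haX, ⟨hn.2.1.symm, fun h => hw.2.1 h.symm⟩,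
    ⟨hn.2.2.1.symm, fun h => hw.2.2.1 h.symm⟩, ⟨hn.2.2.2.symm, fun h => hw.2.2.2 h.symm⟩⟩
  have haZ := mem_component_self (G := G) X a
  refine hP.false_of_module (X := component G X a) (v := n) ?_ haZ
    (component_closed haZ ab hDX.2.1) ab.ne (fun h => G.irrefl (component_subset haX h).1)
  intro p hp q hq z hzZ hzp
  have hzX : z ∉ X := fun h => hzZ (component_closed hp hzp.symm h)
  have hz : G.Adj z n → G.Adj z w := fun h1 => not_not.mp fun h2 => hzX ⟨h1, h2⟩
  have key : ∀ ε : Prop, (ε ∧ AdjAll G z a b c d ∨ ¬ε ∧ AdjNone G z a b c d) →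
      ∀ x ∈ component G X a, (G.Adj z x ↔ ε) := by
    intro ε hzD x hx
    have : NearDiamond G X z ε x := by
      revert x
      refine component_induction ?_ ?_
      · exact nearDiamond_of_isDiamond hP hG e_nw hz hX h hDX hzD haX fun h => h.2.1 ab
      · intro u hu v hv huv ih
        exact nearDiamond_of_adj hP hG e_nw hz hX (component_subset haX hu) hv huv ih
    obtain ⟨-, -, -, -, -, -, -, h, -⟩ := this
    exact h
  rcases diamond_const hP hG h hw hn e_nw hz with h' | h'
  · exact (key True (Or.inl ⟨trivial, h'.1⟩) q hq).2 trivial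
  · exact ((key False (Or.inr ⟨id, h'⟩) p hp).1 hzp).elim

theorem IsPrime.codiamondDominatedFree (hP : IsPrime G) (hG : ForkAntiforkFree G) :
    CodiamondDominatedFree G := by
  have := hP.compl.diamondIsolatedFree hG.compl
  intro a b c d w cd aw bw cw dw ab ac ad bc bd hab
  have hac : a ≠ c := by rintro rfl; exact ad cd
  have had : a ≠ d := by rintro rfl; exact ac cd.symm
  have hbc : b ≠ c := by rintro rfl; exact bd cd
  have hbd : b ≠ d := by rintro rfl; exact bc cd.symm
  refine this (a := a) (b := b) (c := c) (d := d) (w := w) ⟨hab, ab⟩ ⟨hac, ac⟩ ⟨had, ad⟩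
    ⟨hbc, bc⟩ ⟨hbd, bd⟩ ?_ ?_ ?_ ?_ ?_ cd.ne <;> simp_all

/-! ### Local configurations around a triangle -/

/-- Let `n` be complete to a triangle `a, b, c` and to a vertex `w` anticomplete to it, and adjacent
to a vertex `p` whose only neighbour in the triangle is `a`. Then nonneighbours of `n` do not
distinguish these vertices. -/
theorem nonneighbor_const (hP : IsPrime G) (hG : ForkAntiforkFree G) {a b c n w p z : V}
    (e_ab : G.Adj a b) (e_ac : G.Adj a c) (e_bc : G.Adj b c) (n_wa : ¬G.Adj w a)
    (n_wb : ¬G.Adj w b) (n_wc : ¬G.Adj w c) (e_na : G.Adj n a) (e_nb : G.Adj n b)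
    (e_nc : G.Adj n c) (e_nw : G.Adj n w) (e_np : G.Adj n p) (e_pa : G.Adj p a)
    (n_pb : ¬G.Adj p b) (n_pc : ¬G.Adj p c) (n_nz : ¬G.Adj n z) :
    AdjAll G z a b w p ∨ AdjNone G z a b w p := by
  have hB := hP.bullHeadFree hG
  have hDc := hP.codiamondDominatedFree hG
  -- Otherwise `n` dominates the codiamond made of `w`, `p` and the edge `bc`.
  have e_pw : G.Adj p w := not_not.mp fun n_pw => by
    exact hDc e_bc e_nw.symm e_np.symm e_nb.symm e_nc.symm (mt G.adj_symm n_pw) n_wb n_wc n_pb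
        n_pc (ne_of_adj_of_not_adj e_pa.symm (mt G.adj_symm n_wa)).symm
  rcases Classical.em (G.Adj z p) with e_zp | n_zp
  · have e_za : G.Adj z a := not_not.mp fun n_za => by
      have e_zb : G.Adj z b := not_not.mp fun h => hG.antifork e_ab e_pa.symm e_na.symm e_zp
          e_nb.symm e_np.symm (mt G.adj_symm n_za) h (mt G.adj_symm n_pb) (mt G.adj_symm n_nz)
      have e_zc : G.Adj z c := not_not.mp fun h => hG.antifork e_ac e_pa.symm e_na.symm e_zp
          e_nc.symm e_np.symm (mt G.adj_symm n_za) h (mt G.adj_symm n_pc) (mt G.adj_symm n_nz)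
      have e_wz : G.Adj w z := not_not.mp fun h => hG.antifork e_zb.symm e_nb.symm e_bc e_nw.symm
          e_zc e_nc (mt G.adj_symm n_wb) h (mt G.adj_symm n_nz) n_wc
      exact hG.antifork e_ab.symm e_zb.symm e_bc e_wz e_ac e_zc (mt G.adj_symm n_wb) n_wa (mt
          G.adj_symm n_za) n_wc
    rcases Classical.em (G.Adj z b) with e_zb | n_zb
    · have e_zw : G.Adj z w := not_not.mp fun n_zw => by
        exact hG.antifork e_ab e_pa.symm e_za.symm e_pw.symm e_zb.symm e_zp.symm (mt G.adj_symm
            n_wa) n_wb (mt G.adj_symm n_pb) (mt G.adj_symm n_zw)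
      exact Or.inl ⟨e_za, e_zb, e_zw, e_zp⟩
    · exfalso
      have n_zc : ¬G.Adj z c := fun e_zc => by
        have e_wz : G.Adj w z := not_not.mp fun h => hG.antifork e_ac e_pa.symm e_za.symm
            e_pw.symm e_zc.symm e_zp.symm (mt G.adj_symm n_wa) n_wc (mt G.adj_symm n_pc) h
        exact hG.antifork e_ab e_za.symm e_ac e_wz e_bc e_zc (mt G.adj_symm n_wa) n_wb (mt
            G.adj_symm n_zb) n_wc
      have n_zw : ¬G.Adj z w := fun e_zw => by
        exact hG.antifork e_zw.symm e_nw.symm e_pw.symm e_nb.symm e_zp e_np n_wb (mt G.adj_symm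
            n_zb) (mt G.adj_symm n_nz) (mt G.adj_symm n_pb)
      -- Now `z` sees `a` and `p` but none of `b`, `c`, `n`, `w`. A vertex distinguishing `b` from
      -- `c` excludes this.
      obtain ⟨t, htb, htc, ⟨e_tb, n_tc⟩ | ⟨e_tc, n_tb⟩⟩ :=
        hP.exists_distinguishing e_bc.ne e_ab.ne e_ac.ne
      · have hct := htc.symm
        rcases Classical.em (G.Adj a t) with e_at | n_at
        · have n_wt : ¬G.Adj w t := fun h => hG.antifork e_ac e_at e_ab h e_bc.symm e_tb (mt
              G.adj_symm n_wa) n_wc (mt G.adj_symm n_tc) n_wb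
          have n_pt : ¬G.Adj p t := fun h => hG.antifork e_ab e_pa.symm e_at e_pw.symm e_tb.symm h
              (mt G.adj_symm n_wa) n_wb (mt G.adj_symm n_pb) n_wt
          exact hG.fork e_ac.symm e_pa.symm e_pw e_at (mt G.adj_symm n_pc) (mt G.adj_symm n_wc)
              (mt G.adj_symm n_tc) (mt G.adj_symm n_wa) n_pt n_wt hct
        · rcases Classical.em (G.Adj t p) with e_tp | n_tp
          · have e_tn : G.Adj t n := not_not.mp fun h => hG.antifork e_ac e_pa.symm e_na.symm e_tp
                e_nc.symm e_np.symm n_at n_tc (mt G.adj_symm n_pc) h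
            have n_zt : ¬G.Adj z t := fun h => hG.antifork e_bc e_tb.symm e_nb.symm h e_nc.symm
                e_tn (mt G.adj_symm n_zb) n_zc (mt G.adj_symm n_tc) (mt G.adj_symm n_nz)
            exact hG.antifork e_tb.symm e_ab.symm e_nb.symm e_za e_tn e_na.symm (mt G.adj_symm
                n_zb) n_zt (mt G.adj_symm n_at) (mt G.adj_symm n_nz)
          · have e_tn : G.Adj t n := not_not.mp fun h => hG.antifork e_pa.symm e_ab e_na.symm e_tb
                e_np.symm e_nb.symm n_at n_tp n_pb h
            have n_zt : ¬G.Adj z t := fun h => hG.antifork e_bc e_tb.symm e_nb.symm h e_nc.symm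
                e_tn (mt G.adj_symm n_zb) n_zc (mt G.adj_symm n_tc) (mt G.adj_symm n_nz)
            exact hG.antifork e_tb.symm e_ab.symm e_nb.symm e_za e_tn e_na.symm (mt G.adj_symm
                n_zb) n_zt (mt G.adj_symm n_at) (mt G.adj_symm n_nz)
      · have hbt := htb.symm
        rcases Classical.em (G.Adj a t) with e_at | n_at
        · have n_wt : ¬G.Adj w t := fun h => hG.antifork e_ab e_at e_ac h e_bc e_tc (mt G.adj_symm
              n_wa) n_wb (mt G.adj_symm n_tb) n_wc
          have n_pt : ¬G.Adj p t := fun h => hG.antifork e_ac e_pa.symm e_at e_pw.symm e_tc.symm h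
              (mt G.adj_symm n_wa) n_wc (mt G.adj_symm n_pc) n_wt
          exact hG.fork e_ab.symm e_pa.symm e_pw e_at (mt G.adj_symm n_pb) (mt G.adj_symm n_wb)
              (mt G.adj_symm n_tb) (mt G.adj_symm n_wa) n_pt n_wt hbt
        · rcases Classical.em (G.Adj t p) with e_tp | n_tp
          · have e_tn : G.Adj t n := not_not.mp fun h => hG.antifork e_ab e_pa.symm e_na.symm e_tp
                e_nb.symm e_np.symm n_at n_tb (mt G.adj_symm n_pb) h
            have n_zt : ¬G.Adj z t := fun h => hG.antifork e_bc.symm e_tc.symm e_nc.symm h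
                e_nb.symm e_tn (mt G.adj_symm n_zc) n_zb (mt G.adj_symm n_tb) (mt G.adj_symm n_nz)
            exact hG.antifork e_tc.symm e_ac.symm e_nc.symm e_za e_tn e_na.symm (mt G.adj_symm
                n_zc) n_zt (mt G.adj_symm n_at) (mt G.adj_symm n_nz)
          · have e_tn : G.Adj t n := not_not.mp fun h => hG.antifork e_pa.symm e_ac e_na.symm e_tc
                e_np.symm e_nc.symm n_at n_tp n_pc h
            have n_zt : ¬G.Adj z t := fun h => hG.antifork e_bc.symm e_tc.symm e_nc.symm h
                e_nb.symm e_tn (mt G.adj_symm n_zc) n_zb (mt G.adj_symm n_tb) (mt G.adj_symm n_nz)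
            exact hG.antifork e_tc.symm e_ac.symm e_nc.symm e_za e_tn e_na.symm (mt G.adj_symm
                n_zc) n_zt (mt G.adj_symm n_at) (mt G.adj_symm n_nz)
  · have n_za : ¬G.Adj z a := fun e_za => by
      have e_zw : G.Adj z w := not_not.mp fun h => hG.antifork e_nw e_na e_np e_za e_pw.symm
          e_pa.symm n_nz h n_wa n_zp
      rcases Classical.em (G.Adj z b) with e_zb | n_zb
      · have n_zc : ¬G.Adj z c := fun h => hG.antifork e_zb.symm e_nb.symm e_bc e_np.symm h e_nc
            (mt G.adj_symm n_pb) (mt G.adj_symm n_zp) (mt G.adj_symm n_nz) n_pc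
        exact hG.antifork e_ac e_za.symm e_ab e_zw.symm e_bc.symm e_zb (mt G.adj_symm n_wa) n_wc
            (mt G.adj_symm n_zc) n_wb
      · have e_zc : G.Adj z c := not_not.mp fun h => hDc e_bc e_pa e_za e_ab.symm e_ac.symm (mt
            G.adj_symm n_zp) n_pb n_pc n_zb h (ne_of_adj_of_not_adj e_np n_nz)
        exact hG.antifork e_ab e_za.symm e_ac e_zw.symm e_bc e_zc (mt G.adj_symm n_wa) n_wb (mt
            G.adj_symm n_zb) n_wc
    have n_zb : ¬G.Adj z b := fun e_zb => by
      exact hG.antifork e_pa.symm e_ab e_na.symm e_zb e_np.symm e_nb.symm (mt G.adj_symm n_za)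
          n_zp n_pb (mt G.adj_symm n_nz)
    have n_zw : ¬G.Adj z w := fun e_zw => by
      exact hG.antifork e_na e_nw e_np e_zw e_pa.symm e_pw.symm n_nz n_za (mt G.adj_symm n_wa)
          n_zp
    exact Or.inr ⟨n_za, n_zb, n_zw, n_zp⟩

/-- An auxiliary configuration: a triangle `a, b, c` whose vertices have neighbours `p, x, y`, where
`p` is the centre of a claw. -/
theorem claw_over_triangle (hG : ForkAntiforkFree G) {a b c w p x y : V}
    (e_ab : G.Adj a b) (e_ac : G.Adj a c) (e_bc : G.Adj b c) (n_wa : ¬G.Adj w a)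
    (n_wb : ¬G.Adj w b) (n_wc : ¬G.Adj w c) (e_pa : G.Adj p a) (n_pb : ¬G.Adj p b)
    (n_pc : ¬G.Adj p c) (e_px : G.Adj p x) (e_py : G.Adj p y) (n_xy : ¬G.Adj x y)
    (e_xb : G.Adj x b) (n_xa : ¬G.Adj x a) (n_xc : ¬G.Adj x c) (e_yc : G.Adj y c)
    (n_ya : ¬G.Adj y a) (n_yb : ¬G.Adj y b) :
    ¬G.Adj w p ∧ ¬G.Adj w x ∧ ¬G.Adj w y := by
  have hxy : x ≠ y := ne_of_adj_of_not_adj e_xb.symm (mt G.adj_symm n_yb)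
  have n_wx : ¬G.Adj w x := fun e_wx => by
    have e_wp : G.Adj w p := not_not.mp fun h => hG.fork e_wx e_xb e_bc e_px.symm n_wb n_wc h n_xc
        (mt G.adj_symm n_pb) (mt G.adj_symm n_pc) (ne_of_adj_of_not_adj e_pa.symm (mt G.adj_symm
        n_wa)).symm
    have e_wy : G.Adj w y := not_not.mp fun h => hG.fork e_wp e_pa e_ab e_py n_wa n_wb h n_pb (mt
        G.adj_symm n_ya) (mt G.adj_symm n_yb) (ne_of_adj_of_not_adj e_yc.symm (mt G.adj_symm
        n_wc)).symm
    exact hG.antifork e_wy e_wx e_wp e_xb.symm e_py.symm e_px.symm n_wb (mt G.adj_symm n_yb) (mt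
        G.adj_symm n_xy) (mt G.adj_symm n_pb)
  have n_wy : ¬G.Adj w y := fun e_wy => by
    have e_pw : G.Adj p w := not_not.mp fun h => hG.fork e_pa.symm e_py e_wy.symm e_px (mt
        G.adj_symm n_ya) (mt G.adj_symm n_wa) (mt G.adj_symm n_xa) h (mt G.adj_symm n_xy) n_wx
        (ne_of_adj_of_not_adj e_ac.symm (mt G.adj_symm n_xc))
    exact hG.fork e_pw.symm e_pa e_ac e_px n_wa n_wc n_wx n_pc (mt G.adj_symm n_xa) (mt G.adj_symm
        n_xc) (ne_of_adj_of_not_adj e_xb.symm (mt G.adj_symm n_wb)).symm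
  have n_wp : ¬G.Adj w p := fun e_wp => by
    exact hG.fork e_wp e_pa e_ab e_py n_wa n_wb n_wy n_pb (mt G.adj_symm n_ya) (mt G.adj_symm
        n_yb) (ne_of_adj_of_not_adj e_yc.symm (mt G.adj_symm n_wc)).symm
  exact ⟨n_wp, n_wx, n_wy⟩

/-- Here `w` is anticomplete to the triangle and the claw, and its neighbour `t` leads back to the
triangle at the same vertex `a` as the centre `p`. -/
theorem claw_over_triangle_tail (hG : ForkAntiforkFree G) {a b c w p x y t : V} (e_ab : G.Adj a b)
    (e_ac : G.Adj a c) (e_bc : G.Adj b c) (n_wa : ¬G.Adj w a) (n_wb : ¬G.Adj w b) (n_wc : ¬G.Adj w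
    c) (e_pa : G.Adj p a) (n_pb : ¬G.Adj p b) (n_pc : ¬G.Adj p c) (e_px : G.Adj p x) (e_py : G.Adj
    p y) (n_xy : ¬G.Adj x y) (e_xb : G.Adj x b) (n_xa : ¬G.Adj x a) (n_xc : ¬G.Adj x c) (e_yc :
    G.Adj y c) (n_ya : ¬G.Adj y a) (n_yb : ¬G.Adj y b) (n_wx : ¬G.Adj w x) (n_wy : ¬G.Adj w y)
    (n_wp : ¬G.Adj w p) (e_tw : G.Adj t w) (e_ta : G.Adj t a) (n_tb : ¬G.Adj t b) (n_tc : ¬G.Adj t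
    c) : False := by
  have e_tp : G.Adj t p := not_not.mp fun h => hG.fork e_ab.symm e_ta.symm e_tw e_pa.symm (mt
      G.adj_symm n_tb) (mt G.adj_symm n_wb) (mt G.adj_symm n_pb) (mt G.adj_symm n_wa) h n_wp
      (ne_of_adj_of_not_adj e_bc.symm (mt G.adj_symm n_pc))
  have n_ty : ¬G.Adj t y := fun h => hG.fork e_tw.symm e_ta e_ab h n_wa n_wb n_wy n_tb (mt
      G.adj_symm n_ya) (mt G.adj_symm n_yb) (ne_of_adj_of_not_adj e_yc.symm (mt G.adj_symm
      n_wc)).symm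
  have e_xt : G.Adj x t := not_not.mp fun h => hG.fork e_px.symm e_py e_yc e_tp.symm n_xy n_xc h
      n_pc (mt G.adj_symm n_ty) (mt G.adj_symm n_tc) (ne_of_adj_of_not_adj e_ta.symm (mt
      G.adj_symm n_xa)).symm
  exact hG.fork e_tw.symm e_ta e_ac e_xt.symm n_wa n_wc n_wx n_tc (mt G.adj_symm n_xa) (mt
      G.adj_symm n_xc) (ne_of_adj_of_not_adj e_xb.symm (mt G.adj_symm n_wb)).symm

/-- The same situation with `t` attached at `b`, the vertex below the leaf `x`. -/
theorem claw_over_triangle_tail_side (hG : ForkAntiforkFree G) {a b c w p x y t : V} (e_ab : G.Adj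
    a b) (e_ac : G.Adj a c) (e_bc : G.Adj b c) (n_wa : ¬G.Adj w a) (n_wb : ¬G.Adj w b) (n_wc :
    ¬G.Adj w c) (e_pa : G.Adj p a) (n_pb : ¬G.Adj p b) (n_pc : ¬G.Adj p c) (e_px : G.Adj p x)
    (e_py : G.Adj p y) (n_xy : ¬G.Adj x y) (e_xb : G.Adj x b) (n_xa : ¬G.Adj x a) (n_xc : ¬G.Adj x
    c) (e_yc : G.Adj y c) (n_ya : ¬G.Adj y a) (n_yb : ¬G.Adj y b) (n_wx : ¬G.Adj w x) (n_wy :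
    ¬G.Adj w y) (n_wp : ¬G.Adj w p) (e_tw : G.Adj t w) (n_ta : ¬G.Adj t a) (e_tb : G.Adj t b)
    (n_tc : ¬G.Adj t c) : False := by
  have e_tx : G.Adj t x := not_not.mp fun h => hG.fork e_ab e_tb.symm e_tw e_xb.symm (mt
      G.adj_symm n_ta) (mt G.adj_symm n_wa) (mt G.adj_symm n_xa) (mt G.adj_symm n_wb) h n_wx
      (ne_of_adj_of_not_adj e_ac.symm (mt G.adj_symm n_xc))
  have n_ty : ¬G.Adj t y := fun h => hG.fork e_tw.symm e_tb e_ab.symm h n_wb n_wa n_wy n_ta (mt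
      G.adj_symm n_yb) (mt G.adj_symm n_ya) (ne_of_adj_of_not_adj e_yc.symm (mt G.adj_symm
      n_wc)).symm
  have e_pt : G.Adj p t := not_not.mp fun h => hG.fork e_pa.symm e_px e_tx.symm e_py (mt
      G.adj_symm n_xa) (mt G.adj_symm n_ta) (mt G.adj_symm n_ya) h n_xy n_ty (ne_of_adj_of_not_adj
      e_ab.symm (mt G.adj_symm n_yb))
  exact hG.fork e_tw.symm e_tb e_bc e_pt.symm n_wb n_wc n_wp n_tc (mt G.adj_symm n_pb) (mt
      G.adj_symm n_pc) (ne_of_adj_of_not_adj e_pa.symm (mt G.adj_symm n_wa)).symm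

/-! ### Neighbourhoods made of two cliques -/

/-- The neighbourhood of `v` is the union of two disjoint cliques, anticomplete to each other. -/
def TwoCliques (G : SimpleGraph V) (v : V) : Prop :=
  ∃ S : Set V, ∀ x y, G.Adj v x → G.Adj v y → x ≠ y → (G.Adj x y ↔ (x ∈ S ↔ y ∈ S))

theorem TwoCliques.no_claw {v x y z : V} (h : TwoCliques G v) (hx : G.Adj v x) (hy : G.Adj v y)
    (hz : G.Adj v z) (nxy : x ≠ y) (nxz : x ≠ z) (nyz : y ≠ z) (hxy : ¬G.Adj x y)
    (hxz : ¬G.Adj x z) (hyz : ¬G.Adj y z) : False := by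
  obtain ⟨S, h⟩ := h
  have h1 := h x y hx hy nxy
  have h2 := h x z hx hz nxz
  have h3 := h y z hy hz nyz
  tauto

theorem TwoCliques.trans {v x y z : V} (h : TwoCliques G v) (hx : G.Adj v x) (hy : G.Adj v y)
    (hz : G.Adj v z) (nxz : x ≠ z) (hxy : G.Adj x y) (hyz : G.Adj y z) : G.Adj x z := by
  obtain ⟨S, h⟩ := h
  have h1 := h x y hx hy hxy.ne
  have h2 := h x z hx hz nxz
  have h3 := h y z hy hz hyz.ne
  tauto

/-- If `p` has a two-clique neighbourhood then so has its neighbour `w`, provided that any two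
nonadjacent neighbours of `w` outside the closed neighbourhood of `p` are missed by a neighbour of `p`
that is not adjacent to `w`. -/
theorem TwoCliques.propagate (hG : ForkAntiforkFree G) {p w : V} (hp : TwoCliques G p)
    (hpw : G.Adj p w)
    (H : ∀ x y, G.Adj w x → G.Adj w y → ¬G.Adj p x → ¬G.Adj p y → x ≠ p → y ≠ p → ¬G.Adj x y →
      ∃ r, G.Adj p r ∧ ¬G.Adj r w ∧ r ≠ w ∧ ¬G.Adj r x ∧ ¬G.Adj r y) :
    TwoCliques G w := by
  have cross : ∀ x y, G.Adj w x → G.Adj w y → (x = p ∨ G.Adj p x) → ¬(y = p ∨ G.Adj p y) →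
      ¬G.Adj x y := by
    intro x y hx hy hxp hyp hxy
    rw [not_or] at hyp
    rcases hxp with rfl | hxp
    · exact hyp.2 hxy
    -- Since `y` is not adjacent to itself, `H` applies to the pair `y, y`.
    obtain ⟨r, hpr, hrw, hne, hry, -⟩ := H y y hy hy hyp.2 hyp.2 hyp.1 hyp.1 (G.irrefl)
    have hrx : ¬G.Adj r x := fun h => hrw (hp.trans hpr hxp hpw hne h hx.symm)
    exact hG.antifork (a := w) (b := r) (c := y) (d := p) (e := x) hy hpw.symm hx hpr.symm hxy.symm
      hxp (mt G.adj_symm hrw) hry (mt G.adj_symm hyp.2) hrx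
  -- Within the neighbourhood of `w`, one clique is the part in the closed neighbourhood of `p` and
  -- the other is the rest.
  refine ⟨{x | x = p ∨ G.Adj p x}, fun x y hx hy hxy => ?_⟩
  simp only [Set.mem_ofPred_eq]
  by_cases hxp : x = p ∨ G.Adj p x <;> by_cases hyp : y = p ∨ G.Adj p y
  · simp only [hxp, hyp, iff_true]
    rcases hxp with rfl | hxp
    · exact hyp.resolve_left hxy.symm
    · rcases hyp with rfl | hyp
      · exact hxp.symm
      · exact hp.trans hxp hpw hyp hxy hx.symm hy
  · simp only [hxp, hyp, iff_false, not_true]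
    exact cross x y hx hy hxp hyp
  · exact iff_of_false (fun h => cross y x hy hx hyp hxp h.symm) (fun h => hxp (h.2 hyp))
  · simp only [hxp, hyp, iff_true]
    rw [not_or] at hxp hyp
    by_contra hxy'
    obtain ⟨r, hpr, hrw, hne, hrx, hry⟩ := H x y hx hy hxp.2 hyp.2 hxp.1 hyp.1 hxy'
    exact hG.fork (a := x) (b := w) (c := p) (d := r) (e := y) hx.symm hpw.symm hpr hy
      (mt G.adj_symm hxp.2) (mt G.adj_symm hrx) hxy' (mt G.adj_symm hrw) hyp.2 hry hxy

/-! ### Top cliques -/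

/-- A clique with at least three vertices, anticomplete to some vertex, and such that each outside
vertex complete to it is adjacent to all vertices anticomplete to it. -/
structure IsTopClique (G : SimpleGraph V) (K : Set V) : Prop where
  adj : ∀ ⦃x⦄, x ∈ K → ∀ ⦃y⦄, y ∈ K → x ≠ y → G.Adj x y
  third : ∀ x y, ∃ c ∈ K, c ≠ x ∧ c ≠ y
  far : ∃ w, ∀ x ∈ K, ¬G.Adj w x
  top : ∀ ⦃n⦄, n ∉ K → (∀ x ∈ K, G.Adj n x) → ∀ w, (∀ x ∈ K, ¬G.Adj w x) → G.Adj n w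

/-- Take a maximal clique containing the triangle and missed by some vertex. If a vertex `n`
complete to it missed a vertex `w` anticomplete to it, then `n` could be added, with `w` still
missing the larger clique. -/
theorem exists_isTopClique [Finite V] {a b c w : V} (ab : G.Adj a b) (ac : G.Adj a c)
    (bc : G.Adj b c) (aw : ¬G.Adj a w) (bw : ¬G.Adj b w) (cw : ¬G.Adj c w) :
    ∃ K, IsTopClique G K := by
  set F : Set (Set V) := {K | a ∈ K ∧ b ∈ K ∧ c ∈ K ∧ (∀ x ∈ K, ∀ y ∈ K, x ≠ y → G.Adj x y) ∧
    ∃ w, ∀ x ∈ K, ¬G.Adj w x} with hF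
  have h0 : {a, b, c} ∈ F := by
    refine ⟨by simp, by simp, by simp, ?_, w, ?_⟩
    · have := ab.symm; have := ac.symm; have := bc.symm
      rintro x (rfl | rfl | rfl) y (rfl | rfl | rfl) hxy <;> first | assumption | exact absurd rfl hxy
    · rintro x (rfl | rfl | rfl) h
      exacts [aw h.symm, bw h.symm, cw h.symm]
  obtain ⟨K, -, ⟨ha, hb, hc, hK, hw⟩, hmax⟩ := (Set.toFinite F).exists_le_maximal h0
  refine ⟨K, hK, ?_, hw, ?_⟩
  · intro x y
    by_cases h1 : a ≠ x ∧ a ≠ y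
    · exact ⟨a, ha, h1⟩
    by_cases h2 : b ≠ x ∧ b ≠ y
    · exact ⟨b, hb, h2⟩
    refine ⟨c, hc, ?_⟩
    have := ab.ne; have := ac.ne; have := bc.ne
    constructor <;> rintro rfl <;> simp_all [eq_comm]
  · intro n hn hnK w hw
    by_contra hnw
    refine hn (hmax (y := insert n K) ⟨Or.inr ha, Or.inr hb, Or.inr hc, ?_, w, ?_⟩
      (Set.subset_insert n K) (Set.mem_insert n K))
    · rintro x (rfl | hx) y (rfl | hy) hxy
      · exact absurd rfl hxy
      · exact hnK y hy
      · exact (hnK x hx).symm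
      · exact hK x hx y hy hxy
    · rintro x (rfl | hx)
      · exact fun h => hnw h.symm
      · exact hw x hx

/-- `a` is the only neighbour of `v` in `K`. -/
def AttachedAt (G : SimpleGraph V) (K : Set V) (v a : V) : Prop :=
  a ∈ K ∧ G.Adj v a ∧ ∀ x ∈ K, x ≠ a → ¬G.Adj v x

namespace IsTopClique

variable {K : Set V}

theorem notMem_of_attachedAt (hK : IsTopClique G K) {v a : V} (h : AttachedAt G K v a) : v ∉ K := by
  intro hv
  obtain ⟨c, hc, hca, hcv⟩ := hK.third a v
  exact h.2.2 c hc hca (hK.adj hv hc hcv.symm)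

theorem notMem_of_far (hK : IsTopClique G K) {w : V} (h : ∀ x ∈ K, ¬G.Adj w x) : w ∉ K := by
  intro hw
  obtain ⟨c, hc, hcw, -⟩ := hK.third w w
  exact h c hc (hK.adj hw hc hcw.symm)

/-- A vertex `v` with two neighbours and a nonneighbour in `K` forms a diamond with them. A vertex
`w` missing `K` is isolated from this diamond, since an edge `vw` would give an antifork. -/
theorem trichotomy (hK : IsTopClique G K) (hP : IsPrime G) (hG : ForkAntiforkFree G) {v : V}
    (hv : v ∉ K) : (∀ x ∈ K, G.Adj v x) ∨ (∃ a, AttachedAt G K v a) ∨ ∀ x ∈ K, ¬G.Adj v x := by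
  by_contra! hcon
  obtain ⟨⟨c, hc, hvc⟩, h1, a, ha, hva⟩ := hcon
  have : ∃ b ∈ K, b ≠ a ∧ G.Adj v b := by
    by_contra! h
    exact h1 a ⟨ha, hva, fun x hx hxa => h x hx hxa⟩
  obtain ⟨b, hb, hba, hvb⟩ := this
  obtain ⟨w, hw⟩ := hK.far
  have hac : a ≠ c := by rintro rfl; exact hvc hva
  have hbc : b ≠ c := by rintro rfl; exact hvc hvb
  have ab := hK.adj ha hb hba.symm
  have ac := hK.adj ha hc hac
  have bc := hK.adj hb hc hbc
  have hvw : ¬G.Adj v w := fun h => hG.antifork ac hva.symm ab h.symm bc.symm hvb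
    (mt G.adj_symm (hw a ha)) (hw c hc) (mt G.adj_symm hvc) (hw b hb)
  exact hP.diamondIsolatedFree hG ab ac hva.symm bc hvb.symm (mt G.adj_symm hvc)
    (mt G.adj_symm (hw a ha)) (mt G.adj_symm (hw b hb)) (mt G.adj_symm (hw c hc)) hvw
    (fun h => hv (h ▸ hc))

end IsTopClique

/-- `n` is an outside vertex complete to `K`. -/
def Dominates (G : SimpleGraph V) (K : Set V) (n : V) : Prop :=
  n ∉ K ∧ ∀ x ∈ K, G.Adj n x

/-- `w` is anticomplete to `K`. -/
def Avoids (G : SimpleGraph V) (K : Set V) (w : V) : Prop :=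
  ∀ x ∈ K, ¬G.Adj w x

theorem IsPrime.false_of_const (hP : IsPrime G) {X : Set V}
    (hX : ∀ v ∉ X, (∀ x ∈ X, G.Adj v x) ∨ ∀ x ∈ X, ¬G.Adj v x) {x y v : V}
    (hx : x ∈ X) (hy : y ∈ X) (hxy : x ≠ y) (hv : v ∉ X) : False := by
  refine hP.false_of_module (fun p hp q hq u hu hup => ?_) hx hy hxy hv
  exact (hX u hu).elim (fun h => h q hq) (fun h => absurd hup (h p hp))

namespace IsTopClique

variable {K : Set V}

theorem cases (hK : IsTopClique G K) (hP : IsPrime G) (hG : ForkAntiforkFree G) (v : V) :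
    v ∈ K ∨ Dominates G K v ∨ (∃ a, AttachedAt G K v a) ∨ Avoids G K v := by
  by_cases hv : v ∈ K
  · exact Or.inl hv
  · rcases hK.trichotomy hP hG hv with h | h | h
    · exact Or.inr (Or.inl ⟨hv, h⟩)
    · exact Or.inr (Or.inr (Or.inl h))
    · exact Or.inr (Or.inr (Or.inr h))

theorem exists_two_others (hK : IsTopClique G K) (a : V) :
    ∃ b ∈ K, ∃ c ∈ K, b ≠ a ∧ c ≠ a ∧ G.Adj b c := by
  obtain ⟨b, hb, hba, -⟩ := hK.third a a
  obtain ⟨c, hc, hca, hcb⟩ := hK.third a b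
  exact ⟨b, hb, c, hc, hba, hca, hK.adj hb hc hcb.symm⟩

/-- Otherwise `M` is a proper nontrivial module. The vertex `n` is complete to it. A further
neighbour of `n` outside `M` dominates `K` and is complete to `P`; an antifork then makes it
complete to `L`. Nonneighbours of `n` are constant on `K`, on the avoiding vertices and on `P` by
`nonneighbor_const`, and antiforks extend this to `L`. -/
theorem not_adj_of_dominates_of_attachedAt (hK : IsTopClique G K) (hP : IsPrime G)
    (hG : ForkAntiforkFree G) {n p a : V} (hn : Dominates G K n) (hp : AttachedAt G K p a) :
    ¬G.Adj n p := by
  intro e_np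
  set P : Set V := {q | (∃ d, AttachedAt G K q d) ∧ G.Adj n q} with hPdef
  set L : Set V := {m | Dominates G K m ∧ G.Adj n m ∧ ∃ q ∈ P, ¬G.Adj m q} with hL
  set M : Set V := K ∪ {w | Avoids G K w} ∪ P ∪ L with hM
  obtain ⟨b, hb, c, hc, hba, hca, hbc⟩ := hK.exists_two_others a
  obtain ⟨w₀, hw₀⟩ := hK.far
  refine hP.false_of_const (X := M) (v := n) ?_ (Or.inl (Or.inl (Or.inl hb)))
    (Or.inl (Or.inl (Or.inl hc))) hbc.ne ?_
  · intro v hv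
    have hvK : v ∉ K := fun h => hv (Or.inl (Or.inl (Or.inl h)))
    have hvC : ¬Avoids G K v := fun h => hv (Or.inl (Or.inl (Or.inr h)))
    have hvP : v ∉ P := fun h => hv (Or.inl (Or.inr h))
    have hvL : v ∉ L := fun h => hv (Or.inr h)
    rcases eq_or_ne v n with rfl | hvn
    · left
      rintro x (((hx | hx) | hx) | hx)
      · exact hn.2 x hx
      · exact hK.top hn.1 hn.2 x hx
      · exact hx.2
      · exact hx.2.1
    by_cases e_nv : G.Adj n v
    · left
      have hvd : Dominates G K v := by
        rcases hK.cases hP hG v with h | h | h | h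
        · exact absurd h hvK
        · exact h
        · exact absurd ⟨h, e_nv⟩ hvP
        · exact absurd h hvC
      have hall : ∀ q ∈ P, G.Adj v q := by
        by_contra! h
        exact hvL ⟨hvd, e_nv, h⟩
      rintro x (((hx | hx) | hx) | hx)
      · exact hvd.2 x hx
      · exact hK.top hvd.1 hvd.2 x hx
      · exact hall x hx
      · obtain ⟨hxd, e_nx, q, ⟨⟨d, hqd⟩, e_nq⟩, n_xq⟩ := hx
        obtain ⟨b, hb, c, hc, hbd, hcd, e_bc⟩ := hK.exists_two_others d
        by_contra n_vx
        exact hG.antifork (hxd.2 b hb).symm (hvd.2 b hb).symm e_bc (hall q ⟨⟨d, hqd⟩, e_nq⟩).symm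
          (hxd.2 c hc) (hvd.2 c hc) (mt G.adj_symm (hqd.2.2 b hb hbd)) (mt G.adj_symm n_xq)
          (mt G.adj_symm n_vx) (hqd.2.2 c hc hcd)
    · have key : ∀ w, Avoids G K w → ∀ d q, AttachedAt G K q d → G.Adj n q → ∀ b ∈ K, b ≠ d →
          AdjAll G v d b w q ∨ AdjNone G v d b w q := by
        intro w hw d q hqd e_nq b hb hbd
        obtain ⟨c, hc, hcd, hcb⟩ := hK.third d b
        exact nonneighbor_const hP hG (hK.adj hqd.1 hb hbd.symm) (hK.adj hqd.1 hc hcd.symm)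
          (hK.adj hb hc hcb.symm) (hw d hqd.1) (hw b hb) (hw c hc) (hn.2 d hqd.1) (hn.2 b hb)
          (hn.2 c hc) (hK.top hn.1 hn.2 w hw) e_nq hqd.2.1 (hqd.2.2 b hb hbd) (hqd.2.2 c hc hcd)
          (mt G.adj_symm (fun h => e_nv h.symm))
      have hKc : ∀ b ∈ K, (G.Adj v a ↔ G.Adj v b) := by
        intro b hb
        rcases eq_or_ne b a with rfl | hba
        · rfl
        · rcases key w₀ hw₀ a p hp e_np b hb hba with h | h
          · exact iff_of_true h.1 h.2.1
          · exact iff_of_false h.1 h.2.1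
      have hCc : ∀ w, Avoids G K w → (G.Adj v a ↔ G.Adj v w) := by
        intro w hw
        rcases key w hw a p hp e_np b hb hba with h | h
        · exact iff_of_true h.1 h.2.2.1
        · exact iff_of_false h.1 h.2.2.1
      have hPc : ∀ q ∈ P, (G.Adj v a ↔ G.Adj v q) := by
        rintro q ⟨⟨d, hqd⟩, e_nq⟩
        obtain ⟨b, hb, hbd, -⟩ := hK.third d d
        refine (hKc d hqd.1).trans ?_
        rcases key w₀ hw₀ d q hqd e_nq b hb hbd with h | h
        · exact iff_of_true h.1 h.2.2.2
        · exact iff_of_false h.1 h.2.2.2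
      have hLc : ∀ m ∈ L, (G.Adj v a ↔ G.Adj v m) := by
        rintro m ⟨hmd, e_nm, q, hqP, n_mq⟩
        have hq := hPc q hqP
        obtain ⟨⟨d, hqd⟩, e_nq⟩ := hqP
        constructor
        · intro e_va
          obtain ⟨b, hb, c, hc, hbd, hcd, e_bc⟩ := hK.exists_two_others d
          by_contra n_vm
          exact hG.antifork (hmd.2 b hb).symm ((hKc b hb).1 e_va).symm e_bc (hq.1 e_va).symm
            (hmd.2 c hc) ((hKc c hc).1 e_va) (mt G.adj_symm (hqd.2.2 b hb hbd))
            (mt G.adj_symm n_mq) (mt G.adj_symm n_vm) (hqd.2.2 c hc hcd)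
        · intro e_vm
          by_contra n_va
          exact hG.antifork hqd.2.1.symm (hmd.2 d hqd.1).symm (hn.2 d hqd.1).symm e_vm e_nq.symm
            e_nm.symm (fun h => n_va ((hKc d hqd.1).2 h.symm)) (fun h => n_va (hq.2 h))
            (mt G.adj_symm n_mq) (fun h => e_nv h.symm)
      have hall : ∀ x ∈ M, (G.Adj v a ↔ G.Adj v x) := by
        rintro x (((hx | hx) | hx) | hx)
        exacts [hKc x hx, hCc x hx, hPc x hx, hLc x hx]
      by_cases h : G.Adj v a
      · exact Or.inl fun x hx => (hall x hx).1 h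
      · exact Or.inr fun x hx => mt (hall x hx).2 h
  · rintro (((h | h) | h) | h)
    · exact hn.1 h
    · exact h b hb (hn.2 b hb)
    · exact G.irrefl h.2
    · exact G.irrefl h.2.1

/-- The dominating vertices form a module: `K` and all avoiding vertices are complete to them, and
attached vertices are anticomplete to them. -/
theorem dominates_subsingleton (hK : IsTopClique G K) (hP : IsPrime G) (hG : ForkAntiforkFree G)
    {m n : V} (hm : Dominates G K m) (hn : Dominates G K n) : m = n := by
  by_contra hmn
  obtain ⟨b, hb, -⟩ := hK.third m m
  refine hP.false_of_const (X := {v | Dominates G K v}) (v := b) ?_ hm hn hmn fun h => h.1 hb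
  intro v hv
  rcases hK.cases hP hG v with h | h | ⟨a, h⟩ | h
  · exact Or.inl fun x hx => (hx.2 v h).symm
  · exact absurd h hv
  · exact Or.inr fun x hx h' => hK.not_adj_of_dominates_of_attachedAt hP hG hx h h'.symm
  · exact Or.inl fun x hx => (hK.top hx.1 hx.2 v h).symm

/-- Otherwise some anticomponent of the set of vertices attached at `a` is nontrivial. A vertex `v`
splitting it splits a nonadjacent pair `q, r`, and `r - a - q - v` with a further vertex of `K` is a
fork. -/
theorem adj_of_attachedAt (hK : IsTopClique G K) (hP : IsPrime G) (hG : ForkAntiforkFree G)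
    {a p p' : V} (hp : AttachedAt G K p a) (hp' : AttachedAt G K p' a) (hne : p ≠ p') :
    G.Adj p p' := by
  by_contra hpp'
  set X : Set V := {v | AttachedAt G K v a} with hX
  have hAX : component Gᶜ X p ⊆ X := component_subset (show p ∈ X from hp)
  have hp'A : p' ∈ component Gᶜ X p :=
    component_closed (mem_component_self X p) ⟨hne, hpp'⟩ hp'
  refine hP.false_of_module (X := component Gᶜ X p) (v := a) ?_ (mem_component_self X p) hp'A hne
    fun h => hK.notMem_of_attachedAt (hAX h) hp.1
  intro s hs t ht v hv hvs
  by_contra hvt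
  obtain ⟨q, hq, r, hr, hqr, e_vq, n_vr⟩ :=
    component_exists_edge (P := fun u => G.Adj v u) hs ht hvs hvt
  have hqX := hAX hq
  have hrX := hAX hr
  have hvX : ¬AttachedAt G K v a := fun h =>
    hv (component_closed hr ⟨fun e => hqr.2 (by rw [e]; exact e_vq.symm), fun h' => n_vr h'.symm⟩ h)
  have hvn : ¬Dominates G K v := fun h =>
    hK.not_adj_of_dominates_of_attachedAt hP hG h hqX e_vq
  have hva : v ≠ a := fun h => n_vr (h ▸ hrX.2.1.symm)
  have hvK : v ∉ K := fun h => hqX.2.2 v h hva e_vq.symm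
  have fin : ¬G.Adj v a → ∀ c ∈ K, c ≠ a → ¬G.Adj v c → False := by
    intro n_va c hc hca n_vc
    exact hG.fork (a := r) (b := a) (c := q) (d := v) (e := c) hrX.2.1 hqX.2.1.symm e_vq.symm
      (hK.adj hqX.1 hc hca.symm) (fun h => hqr.2 h.symm) (mt G.adj_symm n_vr) (hrX.2.2 c hc hca)
      (mt G.adj_symm n_va) (hqX.2.2 c hc hca) n_vc
      (fun h => hK.notMem_of_attachedAt hrX (h ▸ hc))
  rcases hK.cases hP hG v with h | h | ⟨d, h⟩ | h
  · exact hvK h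
  · exact hvn h
  · rcases eq_or_ne d a with rfl | hda
    · exact hvX h
    · obtain ⟨c, hc, hca, hcd⟩ := hK.third a d
      exact fin (h.2.2 a hqX.1 hda.symm) c hc hca (h.2.2 c hc hcd)
  · obtain ⟨c, hc, hca, -⟩ := hK.third a a
    exact fin (h a hqX.1) c hc hca (h c hc)

end IsTopClique

theorem preconnected_of_component_univ {x : V} (h : component G Set.univ x = Set.univ) :
    G.Preconnected := by
  have key : ∀ y, G.Reachable x y := by
    intro y
    refine component_induction (G := G) (X := Set.univ) (x := x) (p := fun y => G.Reachable x y)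
      (SimpleGraph.Reachable.refl x) ?_ y (by rw [h]; trivial)
    exact fun u _ v _ huv hu => hu.trans huv.reachable
  exact fun y z => (key y).symm.trans (key z)

theorem exists_adj_dist_eq (hc : G.Preconnected) {k w : V} {d : ℕ} (h : G.dist k w = d + 1) :
    ∃ p, G.Adj p w ∧ G.dist k p = d := by
  obtain ⟨q, hq⟩ := (hc k w).exists_walk_length_eq_dist
  have hn : ¬q.Nil := fun h' => by
    rw [← SimpleGraph.Walk.length_eq_zero_iff] at h'; omega
  have hadj := q.adj_penultimate hn
  refine ⟨q.penultimate, hadj, ?_⟩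
  have h1 : G.dist k q.penultimate ≤ d := by
    have := SimpleGraph.dist_le q.dropLast
    have h2 : q.dropLast.length + 1 = q.length := by
      simpa using SimpleGraph.Walk.length_dropLast_add_one hn
    omega
  have h2 := hadj.symm.diff_dist_adj (u := k)
  omega

namespace IsTopClique

variable {K : Set V}

/-- One clique is the rest of `K` with the dominating vertex, if there is one; the other consists of
the vertices attached at `a`. -/
theorem twoCliques_of_mem (hK : IsTopClique G K) (hP : IsPrime G) (hG : ForkAntiforkFree G)
    {a : V} (ha : a ∈ K) : TwoCliques G a := by
  refine ⟨{x | AttachedAt G K x a}, fun x y hx hy hxy => ?_⟩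
  have split : ∀ x, G.Adj a x → x ∈ K ∨ Dominates G K x ∨ AttachedAt G K x a := by
    intro x hx
    rcases hK.cases hP hG x with h | h | ⟨d, h⟩ | h
    · exact Or.inl h
    · exact Or.inr (Or.inl h)
    · rcases eq_or_ne d a with rfl | hda
      · exact Or.inr (Or.inr h)
      · exact absurd hx.symm (h.2.2 a ha hda.symm)
    · exact absurd hx.symm (h a ha)
  have hK' : ∀ x, x ∈ K → ¬AttachedAt G K x a := fun x hx h => hK.notMem_of_attachedAt h hx
  have hD' : ∀ x, Dominates G K x → ¬AttachedAt G K x a := fun x hx h => by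
    obtain ⟨b, hb, hba, -⟩ := hK.third a a
    exact h.2.2 b hb hba (hx.2 b hb)
  simp only [Set.mem_ofPred_eq]
  rcases split x hx with h | h | h <;> rcases split y hy with h' | h' | h'
  · exact iff_of_true (hK.adj h h' hxy) (iff_of_false (hK' _ h) (hK' _ h'))
  · exact iff_of_true (h'.2 x h).symm (iff_of_false (hK' _ h) (hD' _ h'))
  · refine iff_of_false (fun e => h'.2.2 x h hx.ne' e.symm) (fun e => hK' _ h (e.2 h'))
  · exact iff_of_true (h.2 y h') (iff_of_false (hD' _ h) (hK' _ h'))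
  · exact absurd (hK.dominates_subsingleton hP hG h h') hxy
  · exact iff_of_false (hK.not_adj_of_dominates_of_attachedAt hP hG h h')
      (fun e => hD' _ h (e.2 h'))
  · refine iff_of_false (fun e => h.2.2 y h' hy.ne' e) (fun e => hK' _ h' (e.1 h))
  · exact iff_of_false (fun e => hK.not_adj_of_dominates_of_attachedAt hP hG h' h e.symm)
      (fun e => hD' _ h' (e.1 h))
  · exact iff_of_true (hK.adj_of_attachedAt hP hG h h' hxy) (iff_of_true h h')

/-- The neighbours of `n` are `K` and avoiding vertices. Two nonadjacent avoiding neighbours and an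
edge of `K` would form a codiamond dominated by `n`. -/
theorem twoCliques_of_dominates (hK : IsTopClique G K) (hP : IsPrime G) (hG : ForkAntiforkFree G)
    {n : V} (hn : Dominates G K n) : TwoCliques G n := by
  refine ⟨K, fun x y hx hy hxy => ?_⟩
  have split : ∀ x, G.Adj n x → x ∈ K ∨ Avoids G K x := by
    intro x hx
    rcases hK.cases hP hG x with h | h | ⟨d, h⟩ | h
    · exact Or.inl h
    · exact absurd (hK.dominates_subsingleton hP hG hn h) hx.ne
    · exact absurd hx (hK.not_adj_of_dominates_of_attachedAt hP hG hn h)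
    · exact Or.inr h
  rcases split x hx with h | h <;> rcases split y hy with h' | h'
  · exact iff_of_true (hK.adj h h' hxy) (iff_of_true h h')
  · exact iff_of_false (fun e => h' x h e.symm) (fun e => hK.notMem_of_far h' (e.1 h))
  · exact iff_of_false (fun e => h y h' e) (fun e => hK.notMem_of_far h (e.2 h'))
  · refine iff_of_true ?_ (iff_of_false (hK.notMem_of_far h) (hK.notMem_of_far h'))
    by_contra hxy'
    obtain ⟨b, hb, c, hc, -, -, e_bc⟩ := hK.exists_two_others n
    exact hP.codiamondDominatedFree hG e_bc hx.symm hy.symm (hn.2 b hb).symm (hn.2 c hc).symm hxy'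
      (h b hb) (h c hc) (h' b hb) (h' c hc) hxy

/-- No claw is centred at a vertex attached to a triangular top clique. -/
theorem false_of_claw_over (hK : IsTopClique G K) (hP : IsPrime G) (hG : ForkAntiforkFree G)
    {a b c p x y : V} (hp : AttachedAt G K p a) (hx : AttachedAt G K x b)
    (hy : AttachedAt G K y c) (hab : a ≠ b) (hac : a ≠ c) (hbc : b ≠ c)
    (hKabc : ∀ r ∈ K, r = a ∨ r = b ∨ r = c) (e_px : G.Adj p x) (e_py : G.Adj p y)
    (n_xy : ¬G.Adj x y) : False := by
  have e_ab := hK.adj hp.1 hx.1 hab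
  have e_ac := hK.adj hp.1 hy.1 hac
  have e_bc := hK.adj hx.1 hy.1 hbc
  have n_pb := hp.2.2 b hx.1 hab.symm
  have n_pc := hp.2.2 c hy.1 hac.symm
  have n_xa := hx.2.2 a hp.1 hab
  have n_xc := hx.2.2 c hy.1 hbc.symm
  have n_ya := hy.2.2 a hp.1 hac
  have n_yb := hy.2.2 b hx.1 hbc
  have hfar : ∀ w, Avoids G K w → ¬G.Adj w p ∧ ¬G.Adj w x ∧ ¬G.Adj w y := fun w hw =>
    claw_over_triangle hG e_ab e_ac e_bc (hw a hp.1) (hw b hx.1) (hw c hy.1) hp.2.1 n_pb n_pc e_px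
      e_py n_xy hx.2.1 n_xa n_xc hy.2.1 n_ya n_yb
  obtain ⟨w, hw⟩ := hK.far
  have hcomp := hP.component_univ hab hac hbc
  -- Connectivity provides an edge leaving the set of avoiding vertices, and every type of its outer
  -- end `t` is impossible.
  obtain ⟨w, -, t, -, e_wt, hw, ht⟩ := component_exists_edge (G := G) (X := Set.univ) (x := a)
    (P := Avoids G K) (p := w) (q := a) (by rw [hcomp]; trivial) (by rw [hcomp]; trivial) hw
    (fun h => h b hx.1 e_ab)
  obtain ⟨n_wp, n_wx, n_wy⟩ := hfar w hw
  have wa := hw a hp.1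
  have wb := hw b hx.1
  have wc := hw c hy.1
  rcases hK.cases hP hG t with h | h | ⟨d, h⟩ | h
  · exact hw t h e_wt
  · have nt := fun {q d : V} (hq : AttachedAt G K q d) =>
      hK.not_adj_of_dominates_of_attachedAt hP hG h hq
    exact hG.fork e_px.symm hp.2.1 (h.2 a hp.1).symm e_py n_xa (mt G.adj_symm (nt hx)) n_xy
      (mt G.adj_symm (nt hp)) (mt G.adj_symm n_ya) (nt hy)
      (ne_of_adj_of_not_adj hx.2.1.symm (mt G.adj_symm n_yb))
  · rcases hKabc d h.1 with rfl | rfl | rfl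
    · exact claw_over_triangle_tail hG e_ab e_ac e_bc wa wb wc hp.2.1 n_pb n_pc e_px e_py n_xy
        hx.2.1 n_xa n_xc hy.2.1 n_ya n_yb n_wx n_wy n_wp e_wt.symm h.2.1 (h.2.2 b hx.1 hab.symm)
        (h.2.2 c hy.1 hac.symm)
    · exact claw_over_triangle_tail_side hG e_ab e_ac e_bc wa wb wc hp.2.1 n_pb n_pc e_px e_py n_xy
        hx.2.1 n_xa n_xc hy.2.1 n_ya n_yb n_wx n_wy n_wp e_wt.symm (h.2.2 a hp.1 hab) h.2.1
        (h.2.2 c hy.1 hbc.symm)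
    · exact claw_over_triangle_tail_side hG e_ac e_ab e_bc.symm wa wc wb hp.2.1 n_pc n_pb e_py e_px
        (mt G.adj_symm n_xy) hy.2.1 n_ya n_yb hx.2.1 n_xa n_xc n_wy n_wx n_wp e_wt.symm
        (h.2.2 a hp.1 hac) h.2.1 (h.2.2 b hx.1 hbc)
  · exact ht h

/-- The property propagates from `a` to `p` if some vertex of `K` other than `a` misses both `x` and
`y`. As `x` and `y` each see at most one vertex of `K`, this fails only for a triangle `K` with `x`,
`y` attached at its other two vertices, which `false_of_claw_over` excludes. -/
theorem twoCliques_of_attachedAt (hK : IsTopClique G K) (hP : IsPrime G)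
    (hG : ForkAntiforkFree G) {a p : V} (hp : AttachedAt G K p a) : TwoCliques G p := by
  refine TwoCliques.propagate hG (hK.twoCliques_of_mem hP hG hp.1) hp.2.1.symm ?_
  intro x y hx hy n_ax n_ay hxa hya n_xy
  have split : ∀ x, G.Adj p x → ¬G.Adj a x → x ≠ a →
      ∃ d, d ≠ a ∧ ((∀ r ∈ K, r ≠ d → ¬G.Adj r x) ∧ (d ∈ K → AttachedAt G K x d)) := by
    intro x hx n_ax hxa
    rcases hK.cases hP hG x with h | h | ⟨d, h⟩ | h
    · exact absurd hx (hp.2.2 x h hxa)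
    · exact absurd (h.2 a hp.1).symm n_ax
    · exact ⟨d, fun e => n_ax (e ▸ h.2.1.symm), fun r hr hrd e => h.2.2 r hr hrd e.symm, fun _ => h⟩
    -- When `x` avoids `K` there is no attaching vertex; `x` itself, which is not in `K`, serves as
    -- a dummy.
    · exact ⟨x, hxa, fun r hr _ e => h r hr e.symm, fun e => absurd e (hK.notMem_of_far h)⟩
  obtain ⟨b, hba, hb, hb'⟩ := split x hx n_ax hxa
  obtain ⟨c, hca, hc, hc'⟩ := split y hy n_ay hya
  have fin : ∀ r ∈ K, r ≠ a → r ≠ b → r ≠ c →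
      ∃ r, G.Adj a r ∧ ¬G.Adj r p ∧ r ≠ p ∧ ¬G.Adj r x ∧ ¬G.Adj r y := fun r hr hra hrb hrc =>
    ⟨r, hK.adj hp.1 hr hra.symm, fun e => hp.2.2 r hr hra e.symm,
      fun e => hK.notMem_of_attachedAt hp (e ▸ hr), hb r hr hrb, hc r hr hrc⟩
  by_cases hbK : b ∈ K
  · by_cases hcK : c ∈ K
    · by_cases hbc : b = c
      · obtain ⟨r, hr, hra, hrb⟩ := hK.third a b
        exact fin r hr hra hrb (hbc ▸ hrb)
      by_contra hcon
      refine hK.false_of_claw_over hP hG hp (hb' hbK) (hc' hcK) hba.symm hca.symm hbc ?_ hx hy n_xy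
      intro r hr
      by_contra! h
      exact hcon (fin r hr h.1 h.2.1 h.2.2)
    · obtain ⟨r, hr, hra, hrb⟩ := hK.third a b
      exact fin r hr hra hrb (fun e => hcK (e ▸ hr))
  · obtain ⟨r, hr, hra, hrc⟩ := hK.third a c
    exact fin r hr hra (fun e => hbK (e ▸ hr)) hrc

/-- Induct on the distance from `k`. Let `p` and `r` be the two preceding vertices on a shortest
path to `w`; the property propagates from `p` with `r` as the required nonneighbour of `w`. A
neighbour `x` of `w` that misses `p` also misses `r`: if `r = k`, because vertices attached at `k`
are pairwise adjacent, and otherwise because `p`, `x` and the predecessor of `r` would form a claw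
at `r`. -/
theorem twoCliques_of_dist (hK : IsTopClique G K) (hP : IsPrime G) (hG : ForkAntiforkFree G)
    (hN : ∀ n, ¬Dominates G K n) (hc : G.Preconnected) {k : V} (hk : k ∈ K) (w : V) :
    TwoCliques G w := by
  induction hd : G.dist k w using Nat.strong_induction_on generalizing w with
  | _ d ih =>
  rcases hK.cases hP hG w with h | h | ⟨a, h⟩ | h
  · exact hK.twoCliques_of_mem hP hG h
  · exact hK.twoCliques_of_dominates hP hG h
  · exact hK.twoCliques_of_attachedAt hP hG h
  have h0 : d ≠ 0 := by
    rintro rfl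
    exact hK.notMem_of_far h (((hc k w).dist_eq_zero_iff.1 hd) ▸ hk)
  have h1 : d ≠ 1 := by
    rintro rfl
    exact h k hk (SimpleGraph.dist_eq_one_iff_adj.1 hd).symm
  obtain ⟨e, rfl⟩ : ∃ e, d = e + 2 := ⟨d - 2, by omega⟩
  obtain ⟨p, e_pw, hdp⟩ := exists_adj_dist_eq hc hd
  obtain ⟨r, e_rp, hdr⟩ := exists_adj_dist_eq hc hdp
  have far : ∀ {s t}, G.Adj s t → G.dist k t ≤ G.dist k s + 1 := fun {s t} hst => by
    have := hst.diff_dist_adj (u := k)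
    omega
  have n_rw : ¬G.Adj r w := fun h => by have := far h; omega
  have hrw : r ≠ w := by rintro rfl; omega
  refine TwoCliques.propagate hG (ih _ (by omega) p hdp) e_pw ?_
  have key : ∀ x, G.Adj w x → ¬G.Adj p x → x ≠ p → ¬G.Adj r x := by
    intro x e_wx n_px hxp e_rx
    have hdx := far e_wx.symm
    rcases Nat.eq_zero_or_pos e with rfl | he
    · obtain rfl := (hc k r).dist_eq_zero_iff.1 hdr
      have att : ∀ y, G.Adj w y → G.Adj k y → AttachedAt G K y k := by
        intro y hwy hky
        rcases hK.cases hP hG y with h' | h' | ⟨a, h'⟩ | h'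
        · exact absurd hwy (h y h')
        · exact absurd h' (hN y)
        · rcases eq_or_ne a k with rfl | hak
          · exact h'
          · exact absurd hky.symm (h'.2.2 k hk hak.symm)
        · exact absurd hky.symm (h' k hk)
      exact n_px (hK.adj_of_attachedAt hP hG (att p e_pw.symm e_rp) (att x e_wx e_rx) hxp.symm)
    · obtain ⟨f, rfl⟩ : ∃ f, e = f + 1 := ⟨e - 1, by omega⟩
      obtain ⟨s, e_sr, hds⟩ := exists_adj_dist_eq hc hdr
      have n_sp : ¬G.Adj s p := fun h => by have := far h; omega
      have n_sx : ¬G.Adj s x := fun h => by have := far h; omega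
      exact (ih _ (by omega) r hdr).no_claw e_sr.symm e_rp e_rx (by rintro rfl; omega)
        (by rintro rfl; omega) hxp.symm n_sp n_sx n_px
  intro x y hx hy n_px n_py hxp hyp _
  exact ⟨r, e_rp.symm, n_rw, hrw, key x hx n_px hxp, key y hy n_py hyp⟩

/-- If a dominating vertex `n` exists, every avoiding vertex is adjacent to it and inherits the
property in one step. Otherwise induction on distance is used. -/
theorem twoCliques (hK : IsTopClique G K) (hP : IsPrime G) (hG : ForkAntiforkFree G) (w : V) :
    TwoCliques G w := by
  by_cases hN : ∃ n, Dominates G K n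
  · obtain ⟨n, hn⟩ := hN
    rcases hK.cases hP hG w with h | h | ⟨a, h⟩ | h
    · exact hK.twoCliques_of_mem hP hG h
    · exact hK.twoCliques_of_dominates hP hG h
    · exact hK.twoCliques_of_attachedAt hP hG h
    refine TwoCliques.propagate hG (hK.twoCliques_of_dominates hP hG hn) (hK.top hn.1 hn.2 w h) ?_
    intro x y hx hy n_nx n_ny hxn hyn _
    have split : ∀ x, G.Adj w x → ¬G.Adj n x → x ≠ n → ∃ a, AttachedAt G K x a := by
      intro x hx n_nx hxn
      rcases hK.cases hP hG x with h' | h' | h' | h'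
      · exact absurd hx (h x h')
      · exact absurd (hK.dominates_subsingleton hP hG h' hn) hxn
      · exact h'
      · exact absurd (hK.top hn.1 hn.2 x h') n_nx
    obtain ⟨a, ha⟩ := split x hx n_nx hxn
    obtain ⟨b, hb⟩ := split y hy n_ny hyn
    obtain ⟨r, hr, hra, hrb⟩ := hK.third a b
    exact ⟨r, hn.2 r hr, fun e => h r hr e.symm, fun e => hK.notMem_of_far h (e ▸ hr),
      fun e => ha.2.2 r hr hra e.symm, fun e => hb.2.2 r hr hrb e.symm⟩
  · obtain ⟨a, ha, -⟩ := hK.third w w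
    obtain ⟨b, hb, hba, -⟩ := hK.third a a
    obtain ⟨c, hc, hca, hcb⟩ := hK.third a b
    exact hK.twoCliques_of_dist hP hG (not_exists.1 hN)
      (preconnected_of_component_univ (hP.component_univ hba.symm hca.symm hcb.symm)) ha w

end IsTopClique

/-! ### Graphs without claws and coclaws -/

/-- No induced complement of a claw. -/
def CoclawFree (G : SimpleGraph V) : Prop :=
  ∀ ⦃a b c w : V⦄, G.Adj a b → G.Adj a c → G.Adj b c → ¬G.Adj a w → ¬G.Adj b w → ¬G.Adj c w → False

theorem IsPrime.coclawFree_or_twoCliques [Finite V] (hP : IsPrime G) (hG : ForkAntiforkFree G) :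
    CoclawFree G ∨ ∀ v, TwoCliques G v := by
  by_contra! h
  obtain ⟨h1, v, hv⟩ := h
  refine h1 fun a b c w ab ac bc aw bw cw => ?_
  obtain ⟨K, hK⟩ := exists_isTopClique ab ac bc aw bw cw
  exact hv (hK.twoCliques hP hG v)

/-- No induced claw. -/
def ClawFree (G : SimpleGraph V) : Prop :=
  ∀ ⦃v x y z : V⦄, G.Adj v x → G.Adj v y → G.Adj v z → ¬G.Adj x y → ¬G.Adj x z → ¬G.Adj y z →
    x ≠ y → x ≠ z → y ≠ z → False

theorem CoclawFree.clawFree_compl (h : CoclawFree G) : ClawFree Gᶜ := by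
  intro v x y z vx vy vz xy xz yz hxy hxz hyz
  simp only [SimpleGraph.compl_adj, not_and, not_not] at *
  exact h (xy hxy) (xz hxz) (yz hyz) (mt G.adj_symm vx.2) (mt G.adj_symm vy.2) (mt G.adj_symm vz.2)

/-- Without diamonds, adjacency is transitive among the neighbours of `v`, and without claws it has
at most two classes there. -/
theorem ClawFree.exists_isDiamond (h : ClawFree G) {v : V} (hv : ¬TwoCliques G v) :
    ∃ a b c d, IsDiamond G a b c d := by
  by_contra! hD
  have htr : ∀ b x y, G.Adj v b → G.Adj v x → G.Adj v y → G.Adj b x → G.Adj b y → x ≠ y →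
      G.Adj x y := by
    intro b x y hb hx hy bx bY hxy
    by_contra hn
    exact hD v b x y ⟨hb, hx, hy, bx, bY, hn, hxy⟩
  refine hv ?_
  by_cases hb : ∃ b, G.Adj v b
  · obtain ⟨b, hb⟩ := hb
    refine ⟨{x | x = b ∨ G.Adj b x}, fun x y hx hy hxy => ?_⟩
    simp only [Set.mem_ofPred_eq]
    by_cases hxb : x = b ∨ G.Adj b x <;> by_cases hyb : y = b ∨ G.Adj b y
    · refine iff_of_true ?_ (iff_of_true hxb hyb)
      rcases hxb with rfl | hxb
      · exact hyb.resolve_left hxy.symm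
      · rcases hyb with rfl | hyb
        · exact hxb.symm
        · exact htr b x y hb hx hy hxb hyb hxy
    · refine iff_of_false (fun e => hyb ?_) (fun e => hyb (e.1 hxb))
      rcases hxb with rfl | hxb
      · exact Or.inr e
      · exact or_iff_not_imp_left.2 fun hne => htr x b y hx hb hy hxb.symm e (Ne.symm hne)
    · refine iff_of_false (fun e => hxb ?_) (fun e => hxb (e.2 hyb))
      rcases hyb with rfl | hyb
      · exact Or.inr e.symm
      · exact or_iff_not_imp_left.2 fun hne => htr y b x hy hb hx hyb.symm e.symm (Ne.symm hne)
    · refine iff_of_true ?_ (iff_of_false hxb hyb)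
      rw [not_or] at hxb hyb
      by_contra hn
      exact h hb hx hy hxb.2 hyb.2 hn (Ne.symm hxb.1) (Ne.symm hyb.1) hxy
  · exact ⟨∅, fun x y hx => absurd ⟨x, hx⟩ hb⟩

/-- The path `c - w - x - d` carries pendants `y` at `c` and `z` at `d`. Once it is decided whether
`a` sees `w`, claws and coclaws force the other adjacencies of `a` into a contradiction. -/
theorem false_of_path_of_clawFree (hC : ClawFree G) (hT : CoclawFree G) {a c d w x y z : V} (e_ac :
    G.Adj a c) (e_ad : G.Adj a d) (n_cd : ¬G.Adj c d) (e_wx : G.Adj w x) (n_yz : ¬G.Adj y z) (n_yw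
    : ¬G.Adj y w) (n_yx : ¬G.Adj y x) (n_zw : ¬G.Adj z w) (n_zx : ¬G.Adj z x) (e_wc : G.Adj w c)
    (n_wd : ¬G.Adj w d) (e_xd : G.Adj x d) (n_xc : ¬G.Adj x c) (e_yc : G.Adj y c) (e_zd : G.Adj z
    d) (hyz : y ≠ z) (hcx : c ≠ x) : False := by
  have n_cz : ¬G.Adj c z := fun h => hC e_wc.symm e_yc.symm h (mt G.adj_symm n_yw) (mt G.adj_symm
      n_zw) n_yz (ne_of_adj_of_not_adj e_wx.symm (mt G.adj_symm n_yx)) (ne_of_adj_of_not_adj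
      e_zd.symm (mt G.adj_symm n_wd)).symm hyz
  have n_dy : ¬G.Adj d y := fun h => hC e_xd.symm h e_zd.symm (mt G.adj_symm n_yx) (mt G.adj_symm
      n_zx) n_yz (ne_of_adj_of_not_adj e_yc.symm (mt G.adj_symm n_xc)).symm (ne_of_adj_of_not_adj
      e_wx (mt G.adj_symm n_zw)) hyz
  rcases Classical.em (G.Adj a w) with e_aw | n_aw
  · have e_az : G.Adj a z := not_not.mp fun h => hT e_ac e_aw e_wc.symm h n_cz (mt G.adj_symm
        n_zw)
    have n_ax : ¬G.Adj a x := fun h => hC e_ac h e_az (mt G.adj_symm n_xc) n_cz (mt G.adj_symm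
        n_zx) hcx (ne_of_adj_of_not_adj e_zd.symm (mt G.adj_symm n_cd)).symm (ne_of_adj_of_not_adj
        e_wx (mt G.adj_symm n_zw))
    have n_ay : ¬G.Adj a y := fun h => hT e_ac h e_yc.symm n_ax (mt G.adj_symm n_xc) n_yx
    exact hT e_ad e_az e_zd.symm n_ay n_dy (mt G.adj_symm n_yz)
  · have e_ay : G.Adj a y := not_not.mp fun h => hC e_ac.symm e_wc.symm e_yc.symm n_aw h (mt
        G.adj_symm n_yw) (ne_of_adj_of_not_adj e_ad.symm (mt G.adj_symm n_wd))
        (ne_of_adj_of_not_adj e_ad.symm n_dy) (ne_of_adj_of_not_adj e_wx.symm (mt G.adj_symm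
        n_yx))
    have e_ax : G.Adj a x := not_not.mp fun h => hT e_ac e_ay e_yc.symm h (mt G.adj_symm n_xc)
        n_yx
    have n_az : ¬G.Adj a z := fun h => hC e_ac e_ax h (mt G.adj_symm n_xc) n_cz (mt G.adj_symm
        n_zx) hcx (ne_of_adj_of_not_adj e_zd.symm (mt G.adj_symm n_cd)).symm (ne_of_adj_of_not_adj
        e_wx (mt G.adj_symm n_zw))
    exact hT e_ac e_ay e_yc.symm n_az n_cz n_yz

theorem false_of_isDiamond_of_cross (hC : ClawFree G) (hT : CoclawFree G) {a c d w x y z : V}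
    (e_ac : G.Adj a c) (e_ad : G.Adj a d) (n_cd : ¬G.Adj c d) (e_wx : G.Adj w x)
    (n_yz : ¬G.Adj y z) (n_yw : ¬G.Adj y w) (n_yx : ¬G.Adj y x) (n_zw : ¬G.Adj z w)
    (n_zx : ¬G.Adj z x) (hyz : y ≠ z) (hcx : c ≠ x) (hdw : d ≠ w) (e_wc : G.Adj w c)
    (n_wd : ¬G.Adj w d) (e_xd : G.Adj x d) (n_xc : ¬G.Adj x c)
    (hy : G.Adj y c ∨ G.Adj y d) (hz : G.Adj z c ∨ G.Adj z d) : False := by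
  have hyw : y ≠ w := by rintro rfl; exact n_yx e_wx
  have hyx : y ≠ x := by rintro rfl; exact n_yw e_wx.symm
  have hzw : z ≠ w := by rintro rfl; exact n_zx e_wx
  have hzx : z ≠ x := by rintro rfl; exact n_zw e_wx.symm
  have hcc : G.Adj y c → G.Adj z c → False := fun h h' =>
    hC h.symm h'.symm e_wc.symm n_yz n_yw n_zw hyz hyw hzw
  have hdd : G.Adj y d → G.Adj z d → False := fun h h' =>
    hC h.symm h'.symm e_xd.symm n_yz n_yx n_zx hyz hyx hzx
  rcases hy with hy | hy <;> rcases hz with hz | hz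
  · exact hcc hy hz
  · exact false_of_path_of_clawFree hC hT e_ac e_ad n_cd e_wx n_yz n_yw n_yx n_zw n_zx e_wc n_wd
      e_xd n_xc hy hz hyz hcx
  · exact false_of_path_of_clawFree hC hT e_ac e_ad n_cd e_wx (mt G.adj_symm n_yz) n_zw n_zx n_yw
      n_yx e_wc n_wd e_xd n_xc hz hy hyz.symm hcx
  · exact hdd hy hz

/-- A vertex missing both ends also misses `a` and `b`, because of claws centred there, and so forms
a coclaw with `a`, `b`, `c`. -/
theorem IsDiamond.adj_or_adj (hC : ClawFree G) (hT : CoclawFree G) {a b c d v : V}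
    (h : IsDiamond G a b c d) (hc : v ≠ c) (hd : v ≠ d) : G.Adj v c ∨ G.Adj v d := by
  obtain ⟨ab, ac, ad, bc, bd, cd, hcd⟩ := h
  by_contra! hv
  have n_va : ¬G.Adj a v := fun h => hC h ac ad hv.1 hv.2 cd hc hd hcd
  have n_vb : ¬G.Adj b v := fun h => hC h bc bd hv.1 hv.2 cd hc hd hcd
  exact hT ab ac bc n_va n_vb (mt G.adj_symm hv.1)

theorem false_of_isDiamond_of_eq (hC : ClawFree G) (hT : CoclawFree G) {a b c d x y z : V}
    (h : IsDiamond G a b c d) (e_cx : G.Adj c x) (n_yz : ¬G.Adj y z) (n_yc : ¬G.Adj y c)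
    (n_yx : ¬G.Adj y x) (n_zc : ¬G.Adj z c) (n_zx : ¬G.Adj z x) (hyz : y ≠ z)
    (hM : ∀ v, G.Adj v c → ¬G.Adj v x) : False := by
  obtain ⟨e_ab, e_ac, e_ad, e_bc, e_bd, n_cd, hcd⟩ := id h
  have hyc : y ≠ c := by rintro rfl; exact n_yx e_cx
  have hzc : z ≠ c := by rintro rfl; exact n_zx e_cx
  have hy : y ≠ d → G.Adj y d := fun hyd => (h.adj_or_adj hC hT hyc hyd).resolve_left n_yc
  have hz : z ≠ d → G.Adj z d := fun hzd => (h.adj_or_adj hC hT hzc hzd).resolve_left n_zc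
  rcases eq_or_ne y d with rfl | hyd
  · exact n_yz (hz hyz.symm).symm
  rcases eq_or_ne z d with rfl | hzd
  · exact n_yz (hy hyz)
  have e_yd := hy hyd
  have e_zd := hz hzd
  have n_ax := hM a e_ac
  have n_bx := hM b e_bc
  have e_dx : G.Adj d x := not_not.mp fun h => hT e_ab e_ad e_bd n_ax n_bx h
  exact hC e_dx e_yd.symm e_zd.symm (mt G.adj_symm n_yx) (mt G.adj_symm n_zx) n_yz
    (ne_of_adj_of_not_adj e_cx (mt G.adj_symm n_yc))
    (ne_of_adj_of_not_adj e_cx (mt G.adj_symm n_zc)) hyz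

/-- A graph without claws and coclaws does not contain both a diamond and a codiamond. -/
theorem IsDiamond.false_of_codiamond (hC : ClawFree G) (hT : CoclawFree G) {a b c d w x y z : V}
    (h : IsDiamond G a b c d) (e_wx : G.Adj w x) (n_yz : ¬G.Adj y z) (n_yw : ¬G.Adj y w)
    (n_yx : ¬G.Adj y x) (n_zw : ¬G.Adj z w) (n_zx : ¬G.Adj z x) (hyz : y ≠ z) : False := by
  have hyw : y ≠ w := by rintro rfl; exact n_yx e_wx
  have hyx : y ≠ x := by rintro rfl; exact n_yw e_wx.symm
  have hzw : z ≠ w := by rintro rfl; exact n_zx e_wx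
  have hzx : z ≠ x := by rintro rfl; exact n_zw e_wx.symm
  -- The edge `wx` is in no triangle: a third vertex `v` would see `y` and `z` by the absence of
  -- coclaws, and be the centre of a claw `y`, `z`, `w`.
  have hM : ∀ v, G.Adj v w → ¬G.Adj v x := by
    intro v vw vx
    have e_vy : G.Adj v y := not_not.mp fun h =>
      hT vw vx e_wx h (mt G.adj_symm n_yw) (mt G.adj_symm n_yx)
    have e_vz : G.Adj v z := not_not.mp fun h =>
      hT vw vx e_wx h (mt G.adj_symm n_zw) (mt G.adj_symm n_zx)
    exact hC e_vy e_vz vw n_yz n_yw n_zw hyz hyw hzw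
  have hM' : ∀ v, G.Adj v x → ¬G.Adj v w := fun v hx hw => hM v hw hx
  have eq1 : ∀ {c d}, IsDiamond G a b c d → c ≠ w := by
    rintro c d h rfl
    exact false_of_isDiamond_of_eq hC hT h e_wx n_yz n_yw n_yx n_zw n_zx hyz hM
  have eq2 : ∀ {c d}, IsDiamond G a b c d → c ≠ x := by
    rintro c d h rfl
    exact false_of_isDiamond_of_eq hC hT h e_wx.symm n_yz n_yx n_yw n_zx n_zw hyz hM'
  have eq3 : ∀ {c d}, IsDiamond G a b c d → ¬G.Adj c w → ¬G.Adj c x → False := by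
    intro c d h cw cx
    have e_wd := (h.adj_or_adj hC hT (eq1 h).symm (eq1 h.swap_ends).symm).resolve_left
      (mt G.adj_symm cw)
    have e_xd := (h.adj_or_adj hC hT (eq2 h).symm (eq2 h.swap_ends).symm).resolve_left
      (mt G.adj_symm cx)
    exact hM d e_wd.symm e_xd.symm
  have hyc : y ≠ c := by rintro rfl; exact eq3 h n_yw n_yx
  have hyd : y ≠ d := by rintro rfl; exact eq3 h.swap_ends n_yw n_yx
  have hzc : z ≠ c := by rintro rfl; exact eq3 h n_zw n_zx
  have hzd : z ≠ d := by rintro rfl; exact eq3 h.swap_ends n_zw n_zx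
  have hcw := eq1 h
  have hcx := eq2 h
  have hdw := eq1 h.swap_ends
  have hdx := eq2 h.swap_ends
  have Hw := h.adj_or_adj hC hT hcw.symm hdw.symm
  have Hx := h.adj_or_adj hC hT hcx.symm hdx.symm
  have Hy := h.adj_or_adj hC hT hyc hyd
  have Hz := h.adj_or_adj hC hT hzc hzd
  have mc : G.Adj w c → ¬G.Adj x c := fun h h' => hM c h.symm h'.symm
  have md : G.Adj w d → ¬G.Adj x d := fun h h' => hM d h.symm h'.symm
  obtain ⟨-, e_ac, e_ad, -, -, n_cd, -⟩ := id h
  rcases Hw with hw | hw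
  · have hx := Hx.resolve_left (mc hw)
    exact false_of_isDiamond_of_cross hC hT e_ac e_ad n_cd e_wx n_yz n_yw n_yx n_zw n_zx hyz hcx
      hdw hw (fun h => md h hx) hx (mc hw) Hy Hz
  · have hx := Hx.resolve_right (md hw)
    exact false_of_isDiamond_of_cross hC hT e_ac e_ad n_cd e_wx.symm n_yz n_yx n_yw n_zx n_zw hyz
      hcw hdx hx (md hw) hw (fun h => mc h hx) Hy Hz

/-- The structure of finite prime graphs without forks and antiforks. -/
theorem IsPrime.twoCliques_or_compl [Finite V] (hP : IsPrime G) (hG : ForkAntiforkFree G) :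
    (∀ v, TwoCliques G v) ∨ ∀ v, TwoCliques Gᶜ v := by
  by_contra! h
  obtain ⟨⟨u, hu⟩, v, hv⟩ := h
  have hT : CoclawFree G := (hP.coclawFree_or_twoCliques hG).resolve_right fun h => hu (h u)
  have hT' : CoclawFree Gᶜ := (hP.compl.coclawFree_or_twoCliques hG.compl).resolve_right
    fun h => hv (h v)
  have hC : ClawFree G := by simpa using hT'.clawFree_compl
  obtain ⟨a, b, c, d, hd⟩ := hC.exists_isDiamond hu
  obtain ⟨y, z, w, x, yz, yw, yx, zw, zx, wx, hwx⟩ := hT.clawFree_compl.exists_isDiamond hv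
  simp only [SimpleGraph.compl_adj, not_and, not_not] at yz yw yx zw zx wx
  exact hd.false_of_codiamond hC hT (wx hwx) yz.2 yw.2 yx.2 zw.2 zx.2 yz.1

/-! ### Line graphs from two-clique neighbourhoods -/

/-- A graph is a line graph if its vertices can be given two distinct ends each such that adjacency
means sharing an end. -/
theorem isLineGraphOfTriangleFree_of_ends {W : Type*} [Finite W] (p : Bool → V → W)
    (hne : ∀ v, p true v ≠ p false v)
    (hinj : ∀ u v i, p true u = p i v → p false u = p (!i) v → u = v)
    (hadj : ∀ u v, u ≠ v → (G.Adj u v ↔ ∃ i j, p i u = p j v))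
    (htri : ∀ u v w i j k, p i u = p (!j) v → p j v = p (!k) w → p k w = p (!i) u → u = v) :
    IsLineGraphOfTriangleFree G := by
  classical
  set e := Finite.equivFin W
  set f : V → Sym2 (Fin (Nat.card W)) := fun v => s(e (p true v), e (p false v)) with hf
  have hfb : ∀ v i, f v = s(e (p i v), e (p (!i) v)) := by
    rintro v (_ | _)
    · exact Sym2.eq_swap
    · rfl
  have hmem : ∀ v x, x ∈ f v ↔ ∃ i, x = e (p i v) := by
    intro v x
    simp [hf, or_comm]
  set H : SimpleGraph (Fin (Nat.card W)) := SimpleGraph.fromEdgeSet (Set.range f) with hH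
  have hadjH : ∀ x y, H.Adj x y → ∃ v i, x = e (p i v) ∧ y = e (p (!i) v) := by
    intro x y hxy
    rw [hH, SimpleGraph.fromEdgeSet_adj] at hxy
    obtain ⟨⟨v, hv⟩, -⟩ := hxy
    rcases Sym2.eq_iff.1 hv with ⟨h1, h2⟩ | ⟨h1, h2⟩
    · exact ⟨v, true, h1.symm, h2.symm⟩
    · exact ⟨v, false, h2.symm, h1.symm⟩
  have hedge : ∀ v, f v ∈ H.edgeSet := by
    intro v
    rw [hf, SimpleGraph.mem_edgeSet, hH, SimpleGraph.fromEdgeSet_adj]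
    exact ⟨⟨v, rfl⟩, fun h => hne v (e.injective h)⟩
  have hfinj : Function.Injective f := by
    intro u v huv
    rcases Sym2.eq_iff.1 huv with ⟨h1, h2⟩ | ⟨h1, h2⟩
    · exact hinj u v true (e.injective h1) (e.injective h2)
    · exact hinj u v false (e.injective h1) (e.injective h2)
  refine ⟨Nat.card W, H, ?_, ⟨⟨Equiv.ofBijective (fun v => ⟨f v, hedge v⟩) ⟨?_, ?_⟩, ?_⟩⟩⟩
  · intro s hs
    obtain ⟨x, y, z, hxy, hxz, hyz, -⟩ := SimpleGraph.is3Clique_iff.1 hs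
    obtain ⟨u, i, hux, huy⟩ := hadjH x y hxy
    obtain ⟨v, j, hvy, hvz⟩ := hadjH y z hyz
    obtain ⟨w, k, hwz, hwx⟩ := hadjH z x hxz.symm
    have h1 := e.injective (huy.symm.trans hvy)
    have h2 := e.injective (hvz.symm.trans hwz)
    have h3 := e.injective (hwx.symm.trans hux)
    -- The indices are negated because `i` marks the end of `u` at `x`, while `u` meets `v` at its
    -- other end `y`.
    obtain rfl := htri u v w (!i) (!j) (!k) (by simpa using h1) (by simpa using h2)
      (by simpa using h3)
    have hij : f u = s(x, y) := by rw [hfb u i, hux, huy]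
    have hjk : f u = s(y, z) := by rw [hfb u j, hvy, hvz]
    rcases Sym2.eq_iff.1 (hij.symm.trans hjk) with ⟨h1, -⟩ | ⟨h1, -⟩
    · exact hxy.ne h1
    · exact hxz.ne h1
  · intro u v huv
    exact hfinj (congrArg Subtype.val huv)
  · rintro ⟨x, hx⟩
    rw [hH, SimpleGraph.edgeSet_fromEdgeSet] at hx
    obtain ⟨⟨v, rfl⟩, -⟩ := hx
    exact ⟨v, rfl⟩
  · intro u v
    rw [SimpleGraph.lineGraph_adj_iff_exists]
    refine Iff.trans (b := u ≠ v ∧ ∃ x, x ∈ f u ∧ x ∈ f v) (and_congr (not_congr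
      ⟨fun h => hfinj (congrArg Subtype.val h), fun h => h ▸ rfl⟩) Iff.rfl) ?_
    simp only [hmem]
    constructor
    · rintro ⟨huv, x, ⟨i, rfl⟩, j, hj⟩
      exact (hadj u v huv).2 ⟨i, j, e.injective hj⟩
    · intro huv
      obtain ⟨i, j, h⟩ := (hadj u v huv.ne).1 huv
      exact ⟨huv.ne, _, ⟨i, rfl⟩, j, congrArg e h⟩

/-- The two cliques at each vertex, with cliques at different vertices identified. -/
def endSetoid (S : V → Set V)
    (hS : ∀ v x y, G.Adj v x → G.Adj v y → x ≠ y → (G.Adj x y ↔ (x ∈ S v ↔ y ∈ S v))) :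
    Setoid (V × Bool) where
  r a b := a = b ∨ G.Adj a.1 b.1 ∧ (b.1 ∈ S a.1 ↔ a.2 = true) ∧ (a.1 ∈ S b.1 ↔ b.2 = true)
  iseqv := by
    refine ⟨fun a => Or.inl rfl, ?_, ?_⟩
    · rintro a b (rfl | ⟨h, h1, h2⟩)
      · exact Or.inl rfl
      · exact Or.inr ⟨h.symm, h2, h1⟩
    · rintro ⟨u, i⟩ ⟨v, j⟩ ⟨w, k⟩ (h | ⟨huv, h1, h2⟩) (h' | ⟨hvw, h3, h4⟩)
      · exact Or.inl (h.trans h')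
      · exact h ▸ Or.inr ⟨hvw, h3, h4⟩
      · exact h' ▸ Or.inr ⟨huv, h1, h2⟩
      · simp only at huv h1 h2 hvw h3 h4
        rcases eq_or_ne u w with rfl | huw
        · exact Or.inl (Prod.ext rfl (Bool.eq_iff_iff.2 (h1.symm.trans h4)))
        · have huw' : G.Adj u w := (hS v u w huv.symm hvw huw).2 (h2.trans h3.symm)
          refine Or.inr ⟨huw', ?_, ?_⟩
          · exact ((hS u v w huv huw' hvw.ne).1 hvw).symm.trans h1
          · exact ((hS w u v huw'.symm hvw.symm huv.ne).1 huv).trans h4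

/-- The root graph has the cliques as vertices, a clique at `u` containing `v` being identified with
the clique at `v` containing `u`; the vertex `v` becomes the edge joining its two cliques, either of
which may be empty. -/
theorem isLineGraphOfTriangleFree [Finite V] (h : ∀ v, TwoCliques G v) :
    IsLineGraphOfTriangleFree G := by
  choose S hS using h
  let W := Quotient (endSetoid S hS)
  let p : Bool → V → W := fun i v => Quotient.mk _ (v, i)
  have hp : ∀ u v i j, u ≠ v → p i u = p j v →
      G.Adj u v ∧ (v ∈ S u ↔ i = true) ∧ (u ∈ S v ↔ j = true) := by
    intro u v i j huv h
    rcases Quotient.exact h with h | h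
    · exact absurd (congrArg Prod.fst h) huv
    · exact h
  have hpp : ∀ v i, p i v ≠ p (!i) v := by
    intro v i h
    rcases Quotient.exact h with h | h
    · simpa using congrArg Prod.snd h
    · exact G.irrefl h.1
  refine isLineGraphOfTriangleFree_of_ends p (fun v => hpp v true) ?_ ?_ ?_
  · intro u v i h h'
    by_contra huv
    have h1 := (hp u v _ _ huv h).2.1
    have h2 := (hp u v _ _ huv h').2.1
    simp_all
  · intro u v huv
    constructor
    · classical
      intro h
      exact ⟨decide (v ∈ S u), decide (u ∈ S v), Quotient.sound (Or.inr ⟨h, by simp, by simp⟩)⟩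
    · rintro ⟨i, j, h⟩
      exact (hp u v i j huv h).1
  · intro u v w i j k h1 h2 h3
    by_contra huv
    -- If `w` equals `v` or `u`, one of `u`, `v` would lie in both cliques of the other.
    rcases eq_or_ne v w with rfl | hvw
    · obtain rfl : j = !k := by
        by_contra hjk
        exact hpp v k (by rw [← h2]; congr 1; cases j <;> cases k <;> simp_all)
      obtain ⟨-, a1, -⟩ := hp u v _ _ huv h1
      obtain ⟨-, a2, -⟩ := hp u v _ _ huv h3.symm
      cases i <;> simp_all
    rcases eq_or_ne u w with rfl | huw
    · obtain rfl : k = !i := by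
        by_contra hjk
        exact hpp u i (by rw [← h3]; congr 1; cases i <;> cases k <;> simp_all)
      obtain ⟨-, a1, -⟩ := hp u v _ _ huv h1
      obtain ⟨-, a2, -⟩ := hp u v _ _ huv (by simpa using h2.symm)
      obtain ⟨-, -, a3⟩ := hp u v _ _ huv h1
      obtain ⟨-, -, a4⟩ := hp u v _ _ huv (by simpa using h2.symm)
      cases j <;> simp_all
    obtain ⟨e_uv, a1, a2⟩ := hp u v _ _ huv h1
    obtain ⟨e_vw, a3, a4⟩ := hp v w _ _ hvw h2
    obtain ⟨e_wu, a5, a6⟩ := hp w u _ _ huw.symm h3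
    -- The adjacent vertices `v`, `w` lie in the same clique at `u`, yet they meet `u` at its
    -- opposite ends `i` and `!i`.
    have := (hS u v w e_uv e_wu.symm hvw).1 e_vw
    cases i <;> simp_all

/-! ### Prime quotients -/

theorem isDisconnected_of_anticomplete {A : Set V} {x y : V} (hx : x ∈ A) (hy : y ∉ A)
    (h : ∀ u ∈ A, ∀ v ∉ A, ¬G.Adj u v) : IsDisconnected G := by
  intro hc
  obtain ⟨p⟩ := hc x y
  induction p with
  | nil => exact hy hx
  | cons e _ ih => exact ih (not_not.1 fun hv => h _ hx _ hv e) hy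

/-- For `u ∉ Y` and `v ∈ Y`, moving `v` to `y` inside `Y` and then `u` to `z` inside `X` preserves
adjacency. So all such pairs behave like `y, z`, and `Y` is complete or anticomplete to its
complement. -/
theorem IsModule.isDisconnected_of_union {X Y : Set V} (hX : IsModule G X) (hY : IsModule G Y)
    (hXu : X ≠ Set.univ) (hYu : Y ≠ Set.univ) (hXY : X ∪ Y = Set.univ) {z : V}
    (hzX : z ∈ X) (hzY : z ∈ Y) : IsDisconnected G ∨ IsDisconnected Gᶜ := by
  obtain ⟨y, hy⟩ := (Set.ne_univ_iff_exists_notMem X).1 hXu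
  obtain ⟨x, hx⟩ := (Set.ne_univ_iff_exists_notMem Y).1 hYu
  have huX : ∀ u ∉ Y, u ∈ X := fun u hu =>
    ((hXY ▸ Set.mem_univ u : u ∈ X ∪ Y)).resolve_right hu
  have huY : ∀ u ∉ X, u ∈ Y := fun u hu =>
    ((hXY ▸ Set.mem_univ u : u ∈ X ∪ Y)).resolve_left hu
  have c : ∀ u ∉ Y, ∀ v ∈ Y, (G.Adj u v ↔ G.Adj y z) := by
    intro u hu v hv
    have h1 : G.Adj u v ↔ G.Adj u y := ⟨hY hv (huY y hy) hu, hY (huY y hy) hv hu⟩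
    have h2 : G.Adj y u ↔ G.Adj y z := ⟨hX (huX u hu) hzX hy, hX hzX (huX u hu) hy⟩
    rw [h1, G.adj_comm, h2]
  by_cases h : G.Adj y z
  · exact Or.inr (isDisconnected_of_anticomplete (A := Y) hzY hx fun v hv u hu e =>
      e.2 ((c u hu v hv).2 h).symm)
  · exact Or.inl (isDisconnected_of_anticomplete (A := Y) hzY hx fun v hv u hu e =>
      h ((c u hu v hv).1 e.symm))

theorem IsModule.union {X Y : Set V} (hX : IsModule G X) (hY : IsModule G Y) {z : V}
    (hzX : z ∈ X) (hzY : z ∈ Y) : IsModule G (X ∪ Y) := by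
  have key : ∀ v ∉ X ∪ Y, ∀ x ∈ X ∪ Y, (G.Adj v x ↔ G.Adj v z) := by
    rintro v hv x (hx | hx)
    · have hvX : v ∉ X := fun h => hv (Or.inl h)
      exact ⟨hX hx hzX hvX, hX hzX hx hvX⟩
    · have hvY : v ∉ Y := fun h => hv (Or.inr h)
      exact ⟨hY hx hzY hvY, hY hzY hx hvY⟩
  exact fun x hx y hy v hv h => (key v hv y hy).2 ((key v hv x hx).1 h)

/-- `H` is the quotient of `G` by a partition into modules, the fibres of `π`. -/
structure IsModularQuotient {W : Type*} (G : SimpleGraph V) (H : SimpleGraph W) (π : V → W) :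
    Prop where
  surj : Function.Surjective π
  adj : ∀ u v, π u ≠ π v → (G.Adj u v ↔ H.Adj (π u) (π v))

theorem IsModularQuotient.compl {W : Type*} {H : SimpleGraph W} {π : V → W}
    (h : IsModularQuotient G H π) : IsModularQuotient Gᶜ Hᶜ π := by
  refine ⟨h.surj, fun u v huv => ?_⟩
  have : u ≠ v := fun e => huv (congrArg π e)
  simp [huv, this, h.adj u v huv]

/-- A right inverse of `π` embeds `H` as an induced subgraph of `G`. -/
theorem IsModularQuotient.forkAntiforkFree {W : Type*} {H : SimpleGraph W} {π : V → W}
    (h : IsModularQuotient G H π) (hG : ForkAntiforkFree G) : ForkAntiforkFree H := by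
  obtain ⟨f, hf⟩ := h.surj.hasRightInverse
  have hadj : ∀ x y, H.Adj x y ↔ G.Adj (f x) (f y) := by
    intro x y
    rcases eq_or_ne x y with rfl | hxy
    · simp
    · rw [h.adj _ _ (by rwa [hf, hf]), hf, hf]
  constructor
  · intro a b c d e ab bc cd be ac ad ae bd ce de hae
    simp only [hadj] at *
    exact hG.fork ab bc cd be ac ad ae bd ce de (fun h => hae (hf.injective h))
  · intro a b c d e ac ad ae bd ce de ab bc cd be
    simp only [hadj] at *
    exact hG.antifork ac ad ae bd ce de ab bc cd be

/-- Every finite graph, connected together with its complement, has a prime quotient. -/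
theorem exists_isModularQuotient.{u} {V : Type u} {G : SimpleGraph V} [Finite V] [Nontrivial V]
    (h1 : ¬IsDisconnected G) (h2 : ¬IsDisconnected Gᶜ) : ∃ (W : Type u) (_ : Finite W) (_ : Nontrivial W)
      (H : SimpleGraph W) (π : V → W), IsModularQuotient G H π ∧ IsPrime H := by
  let r : Setoid V :=
    { r := fun u v => u = v ∨ ∃ X, IsModule G X ∧ X ≠ Set.univ ∧ u ∈ X ∧ v ∈ X
      iseqv := by
        refine ⟨fun u => Or.inl rfl, ?_, ?_⟩
        · rintro u v (rfl | ⟨X, hX, hXu, hu, hv⟩)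
          · exact Or.inl rfl
          · exact Or.inr ⟨X, hX, hXu, hv, hu⟩
        · rintro u v w (rfl | ⟨X, hX, hXu, hu, hv⟩) (rfl | ⟨Y, hY, hYu, hv', hw⟩)
          · exact Or.inl rfl
          · exact Or.inr ⟨Y, hY, hYu, hv', hw⟩
          · exact Or.inr ⟨X, hX, hXu, hu, hv⟩
          -- Transitivity is where the connectedness of both graphs enters: the union of overlapping
          -- proper modules is proper.
          · refine Or.inr ⟨X ∪ Y, hX.union hY hv hv', fun h => ?_, Or.inl hu, Or.inr hw⟩
            exact (hX.isDisconnected_of_union hY hXu hYu h hv hv').elim h1 h2 }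
  let π : V → Quotient r := Quotient.mk r
  have hsound : ∀ X, IsModule G X → X ≠ Set.univ → ∀ u ∈ X, ∀ v ∈ X, π u = π v :=
    fun X hX hXu u hu v hv => Quotient.sound (Or.inr ⟨X, hX, hXu, hu, hv⟩)
  have hconst : ∀ u v w, π u = π v → π w ≠ π u → G.Adj w u → G.Adj w v := by
    intro u v w huv hwu hadj
    rcases Quotient.exact huv with rfl | ⟨X, hX, hXu, hu, hv⟩
    · exact hadj
    · exact hX hu hv (fun hw => hwu (hsound X hX hXu w hw u hu)) hadj
  let H : SimpleGraph (Quotient r) :=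
    { Adj := fun a b => a ≠ b ∧ G.Adj a.out b.out
      symm := ⟨fun a b h => ⟨h.1.symm, h.2.symm⟩⟩
      loopless := ⟨fun a h => h.1 rfl⟩ }
  have hout : ∀ u, π (π u).out = π u := fun u => Quotient.out_eq _
  have hq : IsModularQuotient G H π := by
    refine ⟨Quotient.mk_surjective, fun u v huv => ⟨fun h => ⟨huv, ?_⟩, fun h => ?_⟩⟩
    · have h3 := (hconst v (π v).out u (hout v).symm huv h).symm
      exact (hconst u (π u).out _ (hout u).symm (by rw [hout]; exact huv.symm) h3).symm
    · have h3 := (hconst (π v).out v _ (hout v) (by rw [hout, hout]; exact huv) h.2).symm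
      exact (hconst (π u).out u _ (hout u) (by rw [hout]; exact huv.symm) h3).symm
  refine ⟨Quotient r, inferInstance, ?_, H, π, hq, ?_⟩
  · obtain ⟨v⟩ : Nonempty V := inferInstance
    have h0 : IsModule G {v} := by
      rintro x rfl y rfl w - h
      exact h
    have hv0 : ({v} : Set V) ≠ Set.univ := by
      obtain ⟨u, hu⟩ := exists_ne v
      exact fun h => hu (h.symm ▸ Set.mem_univ u : u ∈ ({v} : Set V))
    -- A maximal proper module containing `v` absorbs the whole class of `v`, so a vertex outside it
    -- gives a second class.
    obtain ⟨X, hvX, hX⟩ := (Set.toFinite {X : Set V | IsModule G X ∧ X ≠ Set.univ}).exists_le_maximal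
      (⟨h0, hv0⟩ : {v} ∈ {X : Set V | IsModule G X ∧ X ≠ Set.univ})
    have hvX' : v ∈ X := hvX rfl
    obtain ⟨u, hu⟩ := (Set.ne_univ_iff_exists_notMem X).1 hX.1.2
    refine ⟨⟨π u, π v, fun huv => hu ?_⟩⟩
    rcases Quotient.exact huv with rfl | ⟨Y, hY, hYu, huY, hvY⟩
    · exact hvX'
    · refine hX.2 (y := X ∪ Y) ⟨hX.1.1.union hY hvX' hvY, fun h => ?_⟩ Set.subset_union_left
        (Or.inr huY)
      exact (hX.1.1.isDisconnected_of_union hY hX.1.2 hYu h hvX' hvY).elim h1 h2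
  · intro X hX
    by_cases hXu : X = Set.univ
    · exact Or.inr hXu
    left
    obtain ⟨w, hw⟩ := (Set.ne_univ_iff_exists_notMem X).1 hXu
    -- The preimage of a proper module is a proper module of `G`, hence lies in a single class.
    have hmod : IsModule G (π ⁻¹' X) := by
      intro x hx y hy v hv h
      have hne : ∀ {y}, y ∈ π ⁻¹' X → π v ≠ π y := fun hy e => hv (by
        rw [Set.mem_preimage, e]; exact hy)
      exact (hq.adj v y (hne hy)).2 (hX hx hy hv ((hq.adj v x (hne hx)).1 h))
    obtain ⟨w, rfl⟩ := hq.surj w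
    have hpu : π ⁻¹' X ≠ Set.univ := fun h => hw (by
      rw [← Set.mem_preimage, h]; trivial)
    intro x hx y hy
    obtain ⟨x, rfl⟩ := hq.surj x
    obtain ⟨y, rfl⟩ := hq.surj y
    exact hsound _ hmod hpu x hx y hy

/-! ### Nontrivial fibres -/

section Quotient

variable {W : Type*} {H : SimpleGraph W} {π : V → W}

/-- Some two vertices in the fibre of `w` are adjacent. -/
def FibreHasEdge (G : SimpleGraph V) (π : V → W) (w : W) : Prop :=
  ∃ u v, π u = w ∧ π v = w ∧ G.Adj u v

/-- The neighbours of `v` are pairwise adjacent. -/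
def CliqueNeighbours (H : SimpleGraph W) (v : W) : Prop :=
  ∀ ⦃x y⦄, H.Adj v x → H.Adj v y → x ≠ y → H.Adj x y

/-- Doubling an inner vertex of a four-vertex path into two adjacent twins gives an antifork. -/
theorem FibreHasEdge.false_of_path (hq : IsModularQuotient G H π) (hG : ForkAntiforkFree G)
    {a b c d : W} (hb : FibreHasEdge G π b) (ab : H.Adj a b) (bc : H.Adj b c) (cd : H.Adj c d)
    (ac : ¬H.Adj a c) (ad : ¬H.Adj a d) (bd : ¬H.Adj b d) : False := by
  have hac : a ≠ c := by rintro rfl; exact ad cd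
  have had : a ≠ d := by rintro rfl; exact ac cd.symm
  have hbd : b ≠ d := by rintro rfl; exact ad ab
  obtain ⟨u, v, rfl, hv, huv⟩ := hb
  obtain ⟨a, rfl⟩ := hq.surj a
  obtain ⟨c, rfl⟩ := hq.surj c
  obtain ⟨d, rfl⟩ := hq.surj d
  have pos : ∀ {x y}, H.Adj (π x) (π y) → G.Adj x y := fun h => (hq.adj _ _ h.ne).2 h
  have neg : ∀ {x y}, π x ≠ π y → ¬H.Adj (π x) (π y) → ¬G.Adj x y := fun hne h h' =>
    h ((hq.adj _ _ hne).1 h')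
  exact hG.antifork (a := u) (b := d) (c := a) (d := c) (e := v) (pos ab.symm) (pos bc) huv
    (pos cd.symm) (pos (hv.symm ▸ ab)) (pos (hv.symm ▸ bc.symm)) (neg hbd bd)
    (neg had.symm (mt H.adj_symm ad)) (neg hac ac) (neg (hv.symm ▸ hbd.symm)
      (hv.symm ▸ mt H.adj_symm bd))

/-- If the neighbourhood of `v` is not a clique, it has a nontrivial anticomponent, and some `u`
splits a nonadjacent pair `q, r` in it. Then `r - v - q - u` is an induced path with `v` inside. -/
theorem FibreHasEdge.cliqueNeighbours (hP : IsPrime H) (hq : IsModularQuotient G H π)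
    (hG : ForkAntiforkFree G) {v : W} (hv : FibreHasEdge G π v) : CliqueNeighbours H v := by
  intro x y hx hy hxy
  by_contra n_xy
  set X : Set W := {u | H.Adj v u} with hX
  have hsub : component Hᶜ X x ⊆ X := component_subset (show x ∈ X from hx)
  refine hP.false_of_module (X := component Hᶜ X x) (v := v) ?_ (mem_component_self X x)
    (component_closed (mem_component_self X x) ⟨hxy, n_xy⟩ hy) hxy fun h => H.irrefl (hsub h)
  intro s hs t ht u hu hus
  by_contra hut
  obtain ⟨q, hq', r, hr, hqr, e_uq, n_ur⟩ :=
    component_exists_edge (P := fun p => H.Adj u p) hs ht hus hut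
  have n_vu : ¬H.Adj v u := fun h =>
    hu (component_closed hr ⟨fun e => hqr.2 (by rw [e]; exact e_uq.symm), fun h' => n_ur h'.symm⟩ h)
  exact hv.false_of_path hq hG (hsub hr).symm (hsub hq') e_uq.symm (fun h => hqr.2 h.symm)
    (mt H.adj_symm n_ur) n_vu

/-- A nontrivial clique fibre whose neighbours have clique fibres gives simplicial twins. -/
theorem FibreHasEdge.hasAdjacentSimplicialTwins (hq : IsModularQuotient G H π) {v : W}
    (hv : FibreHasEdge G π v) (hN : CliqueNeighbours H v) (hvc : ¬FibreHasEdge Gᶜ π v)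
    (hc : ∀ z, H.Adj v z → ¬FibreHasEdge Gᶜ π z) : HasAdjacentSimplicialTwins G := by
  obtain ⟨a, b, rfl, hb, hab⟩ := hv
  have fib : ∀ x y, π x = π y → ¬FibreHasEdge Gᶜ π (π x) → x ≠ y → G.Adj x y := by
    intro x y h hn hxy
    by_contra h'
    exact hn ⟨x, y, rfl, h.symm, hxy, h'⟩
  have simp : ∀ x, π x = π a → IsSimplicial G x := by
    intro x hx y hy z hz hyz
    simp only [SimpleGraph.mem_neighborSet] at hy hz
    have cl : ∀ y, G.Adj x y → π y ≠ π a → H.Adj (π a) (π y) := by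
      intro y h hne
      rw [← hx]
      exact (hq.adj x y (by rw [hx]; exact hne.symm)).1 h
    by_cases h1 : π y = π a <;> by_cases h2 : π z = π a
    · exact fib y z (h1.trans h2.symm) (h1 ▸ hvc) hyz
    · exact (hq.adj y z (by rw [h1]; exact Ne.symm h2)).2 (h1 ▸ cl z hz h2)
    · exact (hq.adj y z (by rw [h2]; exact h1)).2 (h2 ▸ (cl y hy h1).symm)
    · by_cases h3 : π y = π z
      · exact fib y z h3 (hc _ (cl y hy h1)) hyz
      · exact (hq.adj y z h3).2 (hN (cl y hy h1) (cl z hz h2) h3)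
  refine ⟨a, b, hab, ⟨hab.ne, fun w hwa hwb => ?_⟩, simp a rfl, simp b hb⟩
  by_cases h : π w = π a
  · exact iff_of_true (fib a w h.symm hvc hwa.symm)
      (fib b w (hb.trans h.symm) (hb.symm ▸ hvc) hwb.symm)
  · rw [hq.adj a w (Ne.symm h), hq.adj b w (by rw [hb]; exact Ne.symm h), hb]

end Quotient

/-! ### Split quotients and candelabra -/

/-- `B` is a clique and its complement is stable. -/
def IsSplitBy (G : SimpleGraph V) (B : Set V) : Prop :=
  (∀ x ∈ B, ∀ y ∈ B, x ≠ y → G.Adj x y) ∧ ∀ x ∉ B, ∀ y ∉ B, ¬G.Adj x y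

theorem CliqueNeighbours.isSplitBy {r : V} (h : CliqueNeighbours G r)
    (h' : CliqueNeighbours Gᶜ r) : IsSplitBy G {x | x = r ∨ G.Adj r x} := by
  refine ⟨?_, ?_⟩
  · rintro x (rfl | hx) y (rfl | hy) hxy
    · exact absurd rfl hxy
    · exact hy
    · exact hx.symm
    · exact h hx hy hxy
  · intro x hx y hy hxy
    simp only [Set.mem_ofPred_eq, not_or] at hx hy
    exact (h' ⟨Ne.symm hx.1, hx.2⟩ ⟨Ne.symm hy.1, hy.2⟩ hxy.ne).2 hxy

/-- Two crossing pairs of vertices with clique neighbourhoods and stable nonneighbourhoods. -/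
theorem exists_isSplitBy_of_cross (hL : ∀ v, TwoCliques G v) {v z v' z' : V}
    (hv : CliqueNeighbours G v) (hv' : CliqueNeighbours G v') (hz : CliqueNeighbours Gᶜ z)
    (hz' : CliqueNeighbours Gᶜ z') (e_vz : G.Adj v z) (n_zv' : Gᶜ.Adj z v')
    (e_vz' : G.Adj v' z') : ∃ B, IsSplitBy G B := by
  have hzv' := n_zv'.1
  replace n_zv' := n_zv'.2
  have hvv' : v ≠ v' := by rintro rfl; exact n_zv' e_vz.symm
  have n_vv : ¬G.Adj v v' := fun h => n_zv' (hv e_vz h hzv')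
  have hzz' : z ≠ z' := by rintro rfl; exact n_zv' e_vz'.symm
  have e_zz : G.Adj z z' := by
    by_contra h
    exact (hz ⟨hzv', n_zv'⟩ ⟨hzz', h⟩ e_vz'.ne).2 e_vz'
  have hS : ∀ x y, x ≠ z → ¬G.Adj z x → y ≠ z → ¬G.Adj z y → ¬G.Adj x y :=
    fun x y hx hx' hy hy' h => (hz ⟨hx.symm, hx'⟩ ⟨hy.symm, hy'⟩ h.ne).2 h
  have hS' : ∀ x y, x ≠ z' → ¬G.Adj z' x → y ≠ z' → ¬G.Adj z' y → ¬G.Adj x y :=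
    fun x y hx hx' hy hy' h => (hz' ⟨hx.symm, hx'⟩ ⟨hy.symm, hy'⟩ h.ne).2 h
  have hvS : ∀ s, s ≠ z → ¬G.Adj z s → ¬G.Adj v s := fun s hs hs' h =>
    hs' (hv e_vz h hs.symm)
  -- The nonneighbours of `z` are stable, so it remains to divide the neighbourhood of `z`. If `z'`
  -- sees `v`, at most one neighbour of `z` other than `v` misses `v`, and it moves to the stable
  -- side. If `z'` misses `v`, then `v` itself moves there.
  by_cases e_z'v : G.Adj z' v
  · have hP1 : ∀ p, G.Adj z p → p ≠ v → ¬G.Adj v p → ∀ p', G.Adj z p' → p' ≠ v → ¬G.Adj v p' →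
        p = p' := by
      intro p hp hpv n_vp p' hp' hpv' n_vp'
      by_contra hne
      have h1 : G.Adj p p' := by
        by_contra h
        exact (hL z).no_claw e_vz.symm hp hp' hpv.symm hpv'.symm hne n_vp n_vp' h
      have h2 : ∀ p, G.Adj z p → p ≠ v → ¬G.Adj v p → p ≠ z' ∧ ¬G.Adj z' p := by
        intro p hp hpv n_vp
        have : p ≠ z' := by rintro rfl; exact n_vp e_z'v.symm
        exact ⟨this, fun h => n_vp ((hL z).trans e_vz.symm e_zz hp hpv.symm e_z'v.symm h)⟩
      obtain ⟨h3, h4⟩ := h2 p hp hpv n_vp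
      obtain ⟨h5, h6⟩ := h2 p' hp' hpv' n_vp'
      exact hS' p p' h3 h4 h5 h6 h1
    refine ⟨{x | x = z ∨ G.Adj z x ∧ (x = v ∨ G.Adj v x)}, ?_, ?_⟩
    · have : ∀ x y, G.Adj z x → (x = v ∨ G.Adj v x) → G.Adj z y → (y = v ∨ G.Adj v y) → x ≠ y →
          G.Adj x y := by
        rintro x y - (rfl | hx) - (rfl | hy) hxy
        · exact absurd rfl hxy
        · exact hy
        · exact hx.symm
        · exact hv hx hy hxy
      rintro x (rfl | hx) y (rfl | hy) hxy
      · exact absurd rfl hxy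
      · exact hy.1
      · exact hx.1.symm
      · exact this x y hx.1 hx.2 hy.1 hy.2 hxy
    -- An edge `ps` would make `v`, `v'`, `s` a claw at `z'`.
    · have hps : ∀ p s, G.Adj z p → p ≠ v → ¬G.Adj v p → s ≠ z → ¬G.Adj z s → ¬G.Adj p s := by
        intro p s hp hpv n_vp hsz n_zs e_ps
        have hpz' : p ≠ z' := by rintro rfl; exact n_vp e_z'v.symm
        have n_pz' : ¬G.Adj z' p := fun h =>
          n_vp ((hL z).trans e_vz.symm e_zz hp hpv.symm e_z'v.symm h)
        have hsz' : s ≠ z' := by rintro rfl; exact n_zs e_zz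
        have e_z's : G.Adj z' s := by
          by_contra h
          exact hS' p s hpz' n_pz' hsz' h e_ps
        have hsv' : s ≠ v' := by
          rintro rfl
          exact n_pz' (hv' e_vz' e_ps.symm hpz'.symm)
        have n_sv' := hS s v' hsz n_zs hzv'.symm n_zv'
        exact (hL z').no_claw e_z'v e_vz'.symm e_z's hvv' (by rintro rfl; exact n_zs e_vz.symm)
          hsv'.symm n_vv (hvS s hsz n_zs) (mt G.adj_symm n_sv')
      intro x hx y hy hxy
      simp only [Set.mem_ofPred_eq, not_or, not_and] at hx hy
      by_cases hzx : G.Adj z x <;> by_cases hzy : G.Adj z y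
      · obtain rfl := hP1 x hzx (hx.2 hzx).1 (hx.2 hzx).2 y hzy (hy.2 hzy).1 (hy.2 hzy).2
        exact G.irrefl hxy
      · exact hps x y hzx (hx.2 hzx).1 (hx.2 hzx).2 hy.1 hzy hxy
      · exact hps y x hzy (hy.2 hzy).1 (hy.2 hzy).2 hx.1 hzx hxy.symm
      · exact hS x y hx.1 hzx hy.1 hzy hxy
  · have hvz' : v ≠ z' := by rintro rfl; exact n_vv e_vz'.symm
    have hpz : ∀ p, G.Adj z p → p ≠ v → p ≠ z' → G.Adj p z' := by
      intro p hp hpv hpz'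
      by_contra h
      have n_vp := hS' v p hvz' e_z'v hpz' (mt G.adj_symm h)
      exact (hL z).no_claw e_vz.symm hp e_zz hpv.symm hvz' hpz' n_vp (mt G.adj_symm e_z'v) h
    refine ⟨{x | x = z ∨ G.Adj z x ∧ x ≠ v}, ?_, ?_⟩
    · rintro x (rfl | hx) y (rfl | hy) hxy
      · exact absurd rfl hxy
      · exact hy.1
      · exact hx.1.symm
      · rcases eq_or_ne x z' with rfl | hxz
        · exact (hpz y hy.1 hy.2 hxy.symm).symm
        rcases eq_or_ne y z' with rfl | hyz
        · exact hpz x hx.1 hx.2 hxy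
        exact (hL z).trans hx.1 e_zz hy.1 hxy (hpz x hx.1 hx.2 hxz) (hpz y hy.1 hy.2 hyz).symm
    · have split : ∀ x, x ∉ {x | x = z ∨ G.Adj z x ∧ x ≠ v} → x = v ∨ x ≠ z ∧ ¬G.Adj z x := by
        intro x hx
        simp only [Set.mem_ofPred_eq, not_or, not_and, not_not] at hx
        by_cases h : G.Adj z x
        · exact Or.inl (hx.2 h)
        · exact Or.inr ⟨hx.1, h⟩
      intro x hx y hy hxy
      rcases split x hx with hx' | hx' <;> rcases split y hy with hy' | hy'
      · exact hxy.ne (hx'.trans hy'.symm)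
      · exact hvS y hy'.1 hy'.2 (hx' ▸ hxy)
      · exact hvS x hx'.1 hx'.2 (hy' ▸ hxy.symm)
      · exact hS x y hx'.1 hx'.2 hy'.1 hy'.2 hxy

/-- `Y i`, `Z i` and the remaining vertices exhibit a candelabrum. -/
theorem isCandled_of_family {ι : Type*} [Finite ι] [Nonempty ι] (Y Z : ι → Set V)
    (hY : ∀ i, (Y i).Nonempty) (hZ : ∀ i, (Z i).Nonempty)
    (hYd : ∀ i j, i ≠ j → Disjoint (Y i) (Y j)) (hZd : ∀ i j, i ≠ j → Disjoint (Z i) (Z j))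
    (hYZd : ∀ i j, Disjoint (Y i) (Z j)) (hYc : ∀ i, G.IsClique (Y i))
    (hZs : ∀ i, G.IsIndepSet (Z i)) (hYa : ∀ i j, i ≠ j → AnticompleteTo G (Y i) (Y j))
    (hZc : ∀ i j, i ≠ j → CompleteTo G (Z i) (Z j)) (hYZ : ∀ i, CompleteTo G (Y i) (Z i))
    (hYZa : ∀ i j, i ≠ j → AnticompleteTo G (Y i) (Z j))
    (hZr : ∀ v, (∀ i, v ∉ Y i ∧ v ∉ Z i) → ∀ i, ∀ z ∈ Z i, G.Adj z v)
    (hYr : ∀ v, (∀ i, v ∉ Y i ∧ v ∉ Z i) → ∀ i, ∀ y ∈ Y i, ¬G.Adj y v) : IsCandled G := by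
  set S : Set V := (⋃ i, Y i) ∪ ⋃ i, Z i with hS
  set e := Finite.equivFin ι
  have hYS : ∀ i, Y i ⊆ S := fun i x hx => Or.inl (Set.mem_iUnion.2 ⟨i, hx⟩)
  have hZS : ∀ i, Z i ⊆ S := fun i x hx => Or.inr (Set.mem_iUnion.2 ⟨i, hx⟩)
  have hne : ∀ {i j : Fin (Nat.card ι)}, i ≠ j → e.symm i ≠ e.symm j := fun h h' =>
    h (e.symm.injective h')
  have hrest : ∀ v ∈ Sᶜ, ∀ i, v ∉ Y i ∧ v ∉ Z i := fun v hv i =>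
    ⟨fun h => hv (hYS i h), fun h => hv (hZS i h)⟩
  refine ⟨S, Subtype.val ⁻¹' ⋃ i, Z i, ⟨Nat.card ι, fun i => Subtype.val ⁻¹' Y (e.symm i),
    fun i => Subtype.val ⁻¹' Z (e.symm i), Nat.card_pos, ?_, ?_, ?_, ?_, ?_, ?_, ?_, ?_, ?_, ?_, ?_,
    ?_, ?_⟩, ?_, ?_⟩
  · intro i
    obtain ⟨x, hx⟩ := hY (e.symm i)
    exact ⟨⟨x, hYS _ hx⟩, hx⟩
  · intro i
    obtain ⟨x, hx⟩ := hZ (e.symm i)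
    exact ⟨⟨x, hZS _ hx⟩, hx⟩
  · exact fun i j hij => (hYd _ _ (hne hij)).preimage _
  · exact fun i j hij => (hZd _ _ (hne hij)).preimage _
  · exact fun i j => (hYZd _ _).preimage _
  · ext ⟨x, hx⟩
    simp only [Set.mem_union, Set.mem_iUnion, Set.mem_preimage, Set.mem_univ, iff_true]
    rcases hx with hx | hx
    · obtain ⟨i, hi⟩ := Set.mem_iUnion.1 hx
      exact Or.inl ⟨e i, by simpa using hi⟩
    · obtain ⟨i, hi⟩ := Set.mem_iUnion.1 hx
      exact Or.inr ⟨e i, by simpa using hi⟩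
  · exact fun i x hx y hy hxy => hYc _ hx hy (fun h => hxy (Subtype.ext h))
  · exact fun i x hx y hy hxy => hZs _ hx hy (fun h => hxy (Subtype.ext h))
  · exact fun i j hij x hx y hy => hYa _ _ (hne hij) x hx y hy
  · exact fun i j hij x hx y hy => hZc _ _ (hne hij) x hx y hy
  · exact fun i x hx y hy => hYZ _ x hx y hy
  · exact fun i j hij x hx y hy => hYZa _ _ (hne hij) x hx y hy
  · ext ⟨x, hx⟩
    simp only [Set.mem_iUnion, Set.mem_preimage]
    exact ⟨fun ⟨i, hi⟩ => ⟨e i, by simpa using hi⟩, fun ⟨i, hi⟩ => ⟨_, hi⟩⟩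
  · rintro _ ⟨⟨x, hx⟩, hxZ, rfl⟩ v hv
    obtain ⟨i, hi⟩ := Set.mem_iUnion.1 hxZ
    exact hZr v (hrest v hv) i x hi
  · rintro _ ⟨⟨x, hx⟩, hxZ, rfl⟩ v hv
    obtain ⟨i, hi⟩ := Set.mem_iUnion.1 (hx.resolve_right hxZ)
    exact hYr v (hrest v hv) i x hi

section Quotient

variable {W : Type*} {H : SimpleGraph W} {π : V → W}

theorem IsModularQuotient.isDisconnected_of_isolated [Nontrivial W]
    (hq : IsModularQuotient G H π) {b : W} (hb : ∀ x, ¬H.Adj b x) : IsDisconnected G := by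
  obtain ⟨c, hc⟩ := exists_ne b
  obtain ⟨u, rfl⟩ := hq.surj b
  obtain ⟨v, rfl⟩ := hq.surj c
  refine isDisconnected_of_anticomplete (A := {x | π x = π u}) (x := u) (y := v) rfl hc ?_
  intro x hx y hy h
  have hx' : π x = π u := hx
  have hne : π x ≠ π y := fun e => hy (e.symm.trans hx')
  exact hb _ (hx' ▸ (hq.adj x y hne).1 h)

/-- A graph whose prime quotient is split, with two-clique neighbourhoods, is candled. -/
theorem IsModularQuotient.isCandled_of_isSplitBy [Finite W] [Nontrivial W]
    (hq : IsModularQuotient G H π) (hG : ForkAntiforkFree G) (hP : IsPrime H)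
    (hL : ∀ v, TwoCliques H v) (h1 : ¬IsDisconnected G) (h2 : ¬IsDisconnected Gᶜ)
    (hB : ∃ B, IsSplitBy H B) : IsCandled G := by
  obtain ⟨B₀, hB₀⟩ := hB
  -- By maximality of `B`, every vertex outside it misses some vertex of `B`.
  obtain ⟨B, -, ⟨hBc, hBs⟩, hmax⟩ :=
    (Set.toFinite {B : Set W | IsSplitBy H B}).exists_le_maximal hB₀
  have hmiss : ∀ d ∉ B, ∃ b ∈ B, ¬H.Adj d b := by
    intro d hd
    by_contra! h
    refine hd (hmax (y := insert d B) ⟨?_, ?_⟩ (Set.subset_insert d B) (Set.mem_insert d B))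
    · rintro x (rfl | hx) y (rfl | hy) hxy
      · exact absurd rfl hxy
      · exact h y hy
      · exact (h x hx).symm
      · exact hBc x hx y hy hxy
    · exact fun x hx y hy => hBs x (fun h => hx (Or.inr h)) y (fun h => hy (Or.inr h))
  have hdom : ∀ b, ∃ x, x ≠ b ∧ ¬H.Adj b x := by
    intro b
    by_contra! h
    exact h2 (hq.compl.isDisconnected_of_isolated (b := b) fun x hx => hx.2 (h x hx.1.symm))
  have hnbr : ∀ d ∉ B, ∃ b ∈ B, H.Adj b d := by
    intro d hd
    by_contra! h
    refine h1 (hq.isDisconnected_of_isolated (b := d) fun x hx => ?_)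
    by_cases hxB : x ∈ B
    · exact h x hxB hx.symm
    · exact hBs d hd x hxB hx
  -- If `b` and `b'` both saw `d`, then at `b` the chain `d`, `b'`, `c` would make `d` adjacent to
  -- the missed vertex `c`.
  have huniq : ∀ d ∉ B, ∀ b ∈ B, ∀ b' ∈ B, H.Adj b d → H.Adj b' d → b = b' := by
    intro d hd b hb b' hb' h h'
    by_contra hbb
    obtain ⟨c, hc, n_dc⟩ := hmiss d hd
    have hbc : b ≠ c := by rintro rfl; exact n_dc h.symm
    have hbc' : b' ≠ c := by rintro rfl; exact n_dc h'.symm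
    exact n_dc ((hL b).trans h (hBc b hb b' hb' hbb) (hBc b hb c hc hbc)
      (fun e => hd (e ▸ hc)) h'.symm (hBc b' hb' c hc hbc'))
  -- Two outside vertices with the same neighbour in `B` would form a module of size two. Hence the
  -- stable side is matched into `B`.
  have hmatch : ∀ b ∈ B, ∀ d ∉ B, ∀ d' ∉ B, H.Adj b d → H.Adj b d' → d = d' := by
    intro b hb d hd d' hd' h h'
    by_contra hdd
    have key : ∀ v, ∀ e ∉ B, ∀ e' ∉ B, H.Adj b e → H.Adj b e' → H.Adj v e → H.Adj v e' := by
      intro v e he e' he' hbe hbe' hve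
      by_cases hv : v ∈ B
      · exact huniq e he b hb v hv hbe hve ▸ hbe'
      · exact absurd hve (hBs v hv e he)
    refine hP.false_of_module (X := {d, d'}) (v := b) ?_ (Or.inl rfl) (Or.inr rfl) hdd ?_
    · rintro x (rfl | rfl) y (rfl | rfl) v - hvx
      · exact hvx
      · exact key v _ hd _ hd' h h' hvx
      · exact key v _ hd' _ hd h' h hvx
      · exact hvx
    · rintro (rfl | rfl)
      · exact hd hb
      · exact hd' hb
  let ι := {b // b ∈ B ∧ ∃ d ∉ B, H.Adj b d}
  choose m hmB hm using fun i : ι => i.2.2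
  have hmij : ∀ i j : ι, H.Adj i.1 (m j) → i = j := fun i j h =>
    Subtype.ext (huniq (m j) (hmB j) i.1 i.2.1 j.1 j.2.1 h (hm j))
  have hminj : ∀ i j : ι, m i = m j → i = j := fun i j h => hmij i j (h ▸ hm i)
  have hij : ∀ i j : ι, i ≠ j → H.Adj i.1 j.1 := fun i j h =>
    hBc _ i.2.1 _ j.2.1 fun e => h (Subtype.ext e)
  have hmm : ∀ i j : ι, ¬H.Adj (m i) (m j) := fun i j => hBs _ (hmB i) _ (hmB j)
  have hmi : ∀ i j : ι, m i ≠ j.1 := fun i j h => hmB i (h ▸ j.2.1)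
  have hother : ∀ i : ι, ∃ j, i ≠ j := by
    intro i
    by_contra! h
    obtain ⟨x, hx, hix⟩ := hdom i.1
    by_cases hxB : x ∈ B
    · exact hix (hBc _ i.2.1 x hxB hx.symm)
    · obtain ⟨b, hb, hbx⟩ := hnbr x hxB
      have := h ⟨b, hb, x, hxB, hbx⟩
      exact hix (this ▸ hbx)
  have hne : Nonempty ι := by
    by_contra hemp
    obtain ⟨b, -⟩ := exists_pair_ne W
    have hall : ∀ x, x ∈ B := by
      intro x
      by_contra hx
      obtain ⟨b, hb, hbx⟩ := hnbr x hx
      exact hemp ⟨⟨b, hb, x, hx, hbx⟩⟩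
    obtain ⟨x, hx, hbx⟩ := hdom b
    exact hbx (hBc b (hall b) x (hall x) hx.symm)
  -- The vertex `i` is inside the induced path `m i - i - j - m j`; dually, `m i` is inside a path
  -- of the complement.
  have hstable : ∀ i : ι, ¬FibreHasEdge G π i.1 := by
    intro i h
    obtain ⟨j, hne⟩ := hother i
    exact h.false_of_path hq hG (hm i).symm (hij i j hne) (hm j)
      (fun h => hne (hmij j i h.symm).symm) (hmm i j) (fun h => hne (hmij i j h))
  have hclique : ∀ i : ι, ¬FibreHasEdge Gᶜ π (m i) := by
    intro i h
    obtain ⟨j, hne⟩ := hother i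
    exact h.false_of_path hq.compl hG.compl (a := j.1) (c := m j) (d := i.1)
      ⟨(hmi i j).symm, fun h => hne (hmij j i h).symm⟩ ⟨fun h => hne (hminj i j h), hmm i j⟩
      ⟨hmi j i, fun h => hne (hmij i j h.symm)⟩ (fun h => h.2 (hm j))
      (fun h => h.2 (hij j i hne.symm)) (fun h => h.2 (hm i).symm)
  have pos : ∀ {u v a b}, π u = a → π v = b → H.Adj a b → G.Adj u v := by
    rintro u v _ _ rfl rfl h
    exact (hq.adj u v h.ne).2 h
  have neg : ∀ {u v a b}, π u = a → π v = b → a ≠ b → ¬H.Adj a b → ¬G.Adj u v := by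
    rintro u v _ _ rfl rfl hne h h'
    exact h ((hq.adj u v hne).1 h')
  have disj : ∀ {a b}, a ≠ b → Disjoint {v | π v = a} {v | π v = b} := by
    intro a b hab
    rw [Set.disjoint_left]
    exact fun v hv hv' => hab (hv.symm.trans hv')
  have hrest : ∀ v, (∀ i : ι, v ∉ {v | π v = m i} ∧ v ∉ {v | π v = i.1}) → π v ∈ B := by
    intro v hv
    by_contra hvB
    obtain ⟨b, hb, hbv⟩ := hnbr _ hvB
    exact (hv ⟨b, hb, _, hvB, hbv⟩).1 (hmatch b hb _ hvB _ (hmB _) hbv (hm ⟨b, hb, _, hvB, hbv⟩))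
  refine isCandled_of_family (fun i : ι => {v | π v = m i}) (fun i : ι => {v | π v = i.1})
    (fun i => hq.surj (m i)) (fun i => hq.surj i.1) (fun i j h => disj (mt (hminj i j) h))
    (fun i j h => disj (fun e => h (Subtype.ext e))) (fun i j => disj (hmi i j)) ?_ ?_ ?_ ?_ ?_ ?_
    ?_ ?_
  · intro i u hu v hv huv
    by_contra h
    exact hclique i ⟨u, v, hu, hv, huv, h⟩
  · intro i u hu v hv _ h
    exact hstable i ⟨u, v, hu, hv, h⟩
  · exact fun i j h u hu v hv => neg hu hv (mt (hminj i j) h) (hmm i j)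
  · exact fun i j h u hu v hv => pos hu hv (hij i j h)
  · exact fun i u hu v hv => pos hu hv (hm i).symm
  · exact fun i j h u hu v hv => neg hu hv (hmi i j) fun e => h (hmij j i e.symm).symm
  · exact fun v hv i z hz => pos hz rfl
      (hBc _ i.2.1 _ (hrest v hv) fun e => (hv i).2 e.symm)
  · refine fun v hv i y hy => neg hy rfl (fun e => (hv i).1 e.symm) fun h => ?_
    exact (hv ⟨π v, hrest v hv, m i, hmB i, h.symm⟩).2 rfl

/-! ### Lifting from the quotient -/

/-- The structure of a graph whose prime quotient has only two-clique neighbourhoods. -/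
theorem IsModularQuotient.outcomes [Finite V] [Finite W] [Nontrivial W]
    (hq : IsModularQuotient G H π) (hG : ForkAntiforkFree G) (hP : IsPrime H)
    (hL : ∀ v, TwoCliques H v) (h1 : ¬IsDisconnected G) (h2 : ¬IsDisconnected Gᶜ) :
    (HasAdjacentSimplicialTwins G ∨ HasAdjacentSimplicialTwins Gᶜ) ∨ IsCandled G ∨
      IsLineGraphOfTriangleFree G := by
  have hcl : ∀ {v}, FibreHasEdge G π v → CliqueNeighbours H v := fun h =>
    h.cliqueNeighbours hP hq hG
  have hcl' : ∀ {v}, FibreHasEdge Gᶜ π v → CliqueNeighbours Hᶜ v := fun h =>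
    h.cliqueNeighbours hP.compl hq.compl hG.compl
  by_cases hmix : ∃ r, FibreHasEdge G π r ∧ FibreHasEdge Gᶜ π r
  · obtain ⟨r, hr, hr'⟩ := hmix
    exact Or.inr (Or.inl (hq.isCandled_of_isSplitBy hG hP hL h1 h2
      ⟨_, (hcl hr).isSplitBy (hcl' hr')⟩))
  by_cases ht : HasAdjacentSimplicialTwins G ∨ HasAdjacentSimplicialTwins Gᶜ
  · exact Or.inl ht
  rw [not_or] at ht
  have step : ∀ v, FibreHasEdge G π v → ∃ z, H.Adj v z ∧ FibreHasEdge Gᶜ π z := by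
    intro v hv
    by_contra! h
    exact ht.1 (hv.hasAdjacentSimplicialTwins hq (hcl hv) (fun h' => hmix ⟨v, hv, h'⟩) h)
  have step' : ∀ z, FibreHasEdge Gᶜ π z → ∃ v, Hᶜ.Adj z v ∧ FibreHasEdge G π v := by
    intro z hz
    by_contra! h
    exact ht.2 (hz.hasAdjacentSimplicialTwins hq.compl (hcl' hz)
      (by rw [compl_compl]; exact fun h' => hmix ⟨z, h', hz⟩) (by rw [compl_compl]; exact h))
  right
  -- With no twins, applying `step`, `step'` and `step` again gives `v`, `z`, `v'`, `z'` whose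
  -- fibres alternately contain an edge and a nonedge, as needed for the split criterion.
  have main : ∀ v, FibreHasEdge G π v → IsCandled G := by
    intro v hv
    obtain ⟨z, hvz, hz⟩ := step v hv
    obtain ⟨v', hzv, hv'⟩ := step' z hz
    obtain ⟨z', hvz', hz'⟩ := step v' hv'
    exact hq.isCandled_of_isSplitBy hG hP hL h1 h2
      (exists_isSplitBy_of_cross hL (hcl hv) (hcl hv') (hcl' hz) (hcl' hz') hvz hzv hvz')
  by_cases hv : ∃ v, FibreHasEdge G π v
  · obtain ⟨v, hv⟩ := hv
    exact Or.inl (main v hv)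
  by_cases hz : ∃ z, FibreHasEdge Gᶜ π z
  · obtain ⟨z, hz⟩ := hz
    obtain ⟨v, -, hv⟩ := step' z hz
    exact Or.inl (main v hv)
  right
  have hinj : Function.Injective π := by
    intro u v huv
    by_contra hne
    by_cases h : G.Adj u v
    · exact hv ⟨_, u, v, rfl, huv.symm, h⟩
    · exact hz ⟨_, u, v, rfl, huv.symm, hne, h⟩
  refine isLineGraphOfTriangleFree fun v => ?_
  obtain ⟨S, hS⟩ := hL (π v)
  refine ⟨π ⁻¹' S, fun x y hx hy hxy => ?_⟩
  have hadj : ∀ {u v}, u ≠ v → (G.Adj u v ↔ H.Adj (π u) (π v)) := fun h =>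
    hq.adj _ _ (hinj.ne h)
  rw [hadj hxy]
  exact hS _ _ ((hadj hx.ne).1 hx) ((hadj hy.ne).1 hy) (hinj.ne hxy)

end Quotient

end Uncluttered

theorem theorem2p1 {V : Type*} [Finite V] (G : SimpleGraph V)
    (hG : Uncluttered.IsUncluttered G) :
    (Uncluttered.IsDisconnected G ∨ Uncluttered.IsDisconnected Gᶜ) ∨
    (Uncluttered.HasAdjacentSimplicialTwins G ∨ Uncluttered.HasAdjacentSimplicialTwins Gᶜ) ∨
    (Uncluttered.IsCandled G ∨ Uncluttered.IsCandled Gᶜ) ∨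
    (Uncluttered.IsLineGraphOfTriangleFree G ∨ Uncluttered.IsLineGraphOfTriangleFree Gᶜ) := by
  have h := hG.forkAntiforkFree
  rcases subsingleton_or_nontrivial V with hV | hV
  -- With at most one vertex all neighbourhoods are empty; the quotient construction needs two
  -- vertices.
  · refine Or.inr (Or.inr (Or.inr (Or.inl (Uncluttered.isLineGraphOfTriangleFree fun v => ?_))))
    exact ⟨∅, fun x y hx _ _ => absurd (Subsingleton.elim v x) hx.ne⟩
  by_cases h1 : Uncluttered.IsDisconnected G
  · exact Or.inl (Or.inl h1)
  by_cases h2 : Uncluttered.IsDisconnected Gᶜ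
  · exact Or.inl (Or.inr h2)
  obtain ⟨W, _, _, H, π, hq, hP⟩ := Uncluttered.exists_isModularQuotient h1 h2
  rcases hP.twoCliques_or_compl (hq.forkAntiforkFree h) with hL | hL
  · rcases hq.outcomes h hP hL h1 h2 with ht | hc | hl
    · exact Or.inr (Or.inl ht)
    · exact Or.inr (Or.inr (Or.inl (Or.inl hc)))
    · exact Or.inr (Or.inr (Or.inr (Or.inl hl)))
  · rcases hq.compl.outcomes h.compl hP.compl hL h2 (by rwa [compl_compl]) with ht | hc | hl
    · rw [compl_compl] at ht
      exact Or.inr (Or.inl ht.symm)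
    · exact Or.inr (Or.inr (Or.inl (Or.inr hc)))
    · exact Or.inr (Or.inr (Or.inr (Or.inr hl)))
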